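/- **Setting.** Let $M$ be a smooth oriented $n$-manifold with a Riemannian metric $g$ and a closed $3$-form $H$; put $d_H=d+H\wedge$. Fix a cover of $M$ by positively oriented coordinate neighbourhoods $U_a$ (with coordinate changes having Jacobians $s_{ab}$) and $2$-forms $B_a\in\Omega^2(U_a)$ with $H=dB_a$ on $U_a$. A section $\rho$ of the spinor bundle $\mathbf S(\mathbf E)_\pm$ of the generalised tangent bundle $\mathbf E=\mathbf E(H)$ is a family of smooth maps $\rho_a:U_a\to\Lambda^{ev,od}(\mathbb R^n)^*$ with $$\rho_a=e^{B_a-B_b}\wedge\sqrt{\det s_{ab}}\;s_{ab}^*\rho_b\quad\text{on }U_a\cap U_b ,$$ and $\mathfrak L(\rho)\in\Omega^{ev,od}(M)$ is the form given on $U_a$ by $(\det g_a)^{1/4}\,e^{-B_a}\wedge\rho_a$. This is an isomorphism between such sections and the even, respectively odd, forms on $M$. Put $\hat\alpha=(-1)^{p(p+1)/2}\alpha$ for $\alpha$ of degree $p$ (extended linearly to forms of mixed degree), and let $\star$, $|\cdot|_g$ be the Hodge star and the norm on forms. On spinors put $$\langle\rho,\tau\rangle=\star\big[\mathfrak L(\rho)\wedge\widehat{\mathfrak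 L(\tau)}\big]^n,\qquad \|\tau\|=|\mathfrak L(\tau)|_g .$$ For an oriented $k$-plane $L\subset T_pM$, $0\le k\le n$, with Euclidean volume form $\varpi_L$, and $\mathcal F\in\Lambda^2L^*$, both regarded as forms on $T_pM$ by means of the orthogonal projection $T_pM\to L$, let $\tau_{L,\mathcal F}=\mathfrak L^{-1}\big(e^{\mathcal F}\wedge\widehat{\star\varpi_L}\big)$. A spinor field $\rho\in\Gamma(\mathbf S(\mathbf E)_\pm)$ is a *generalised calibration* if at every point $p\in M$ one has $\langle\rho_p,\tau_{L,\mathcal F}\rangle\le\|\tau_{L,\mathcal F}\|$ for all $k$ and all such $(L,\mathcal F)$, with equality for at least one $(L,\mathcal F)$. An *isotropic pair* of dimension $k$ is an oriented $k$-dimensional embedded submanifold $j:L\hookrightarrow M$ (possibly with boundary and corners) together with a smooth $2$-form $\mathcal F\in\Omega^2(L)$ such that $d\mathcal F+j^*H=0$. It is *calibrated by* $\rho$ if $\langle\rho,\tau_{L,\mathcal F}\rangle=\|\tau_{L,\mathcal F}\|$ at every point of $L$, where $\tau_{L,\mathcal F}$ is formed with the tangent spaces of $L$. For $\phi\in C^\infty(M)$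 and $\gamma\in\Gamma(\mathbf S(\mathbf E)_\pm)$, the *brane energy* of a compact isotropic pair of dimension $k$ is $$\mathcal E_{\phi,\gamma}(L,\mathcal F)=\int_L e^{-\phi}\,\|\tau_{L,\mathcal F}\|\,\varpi_L-\int_L e^{-\phi}\,\big[e^{-\mathcal F}\wedge j^*\mathfrak L(\gamma)\big]^k .$$ Two compact isotropic pairs $(D,\mathcal F)$, $(D',\mathcal F')$ of dimension $k$ are *homologous* if there is a compact isotropic pair $(\hat D,\hat{\mathcal F})$ of dimension $k+1$ with $\partial\hat D=D-D'$ and with $\hat{\mathcal F}|_D=\mathcal F$, $\hat{\mathcal F}|_{D'}=\mathcal F'$. Here $\partial\hat D=D-D'$ means that the boundary of the manifold with corners $\hat D$ is the union of $D$ and $D'$, which overlap at most in their own boundaries, and that $D$ carries the boundary orientation (outward normal first) and $D'$ the opposite one. **Theorem.** Let $\rho\in\Gamma(\mathbf S(\mathbf E)_\pm)$ be a generalised calibration, $\gamma\in\Gamma(\mathbf S(\mathbf E)_\pm)$ a spinor field of the same parity and $\phi\in C^\infty(M)$, such that $$d_H\big(e^{-\phi}\mathfrak L(\rho)\big)=d_H\big(e^{-\phi}\mathfrak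 L(\gamma)\big).$$ Then every isotropic pair $(L,\mathcal F)$ calibrated by $\rho$ is locally brane-energy minimising for $\mathcal E_{\phi,\gamma}$: for every closed disc $D$ of dimension $\dim L$ embedded in $L$ (with the induced orientation) and every compact isotropic pair $(D',\mathcal F')$ homologous to $(D,\mathcal F|_D)$, where $D'$ need not lie in $L$, $$\mathcal E_{\phi,\gamma}(D,\mathcal F|_D)\le\mathcal E_{\phi,\gamma}(D',\mathcal F').$$ -/

import Mathlib

open scoped Manifold ContDiff Topology Bundle
open Module Bundle

universe u

namespace GenCal

/-- The model space `ℝ^m`. -/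
abbrev Euc (m : ℕ) : Type := EuclideanSpace ℝ (Fin m)

/-! ### Exterior algebra -/

section Algebra

variable {V W : Type*} [AddCommGroup V] [Module ℝ V] [TopologicalSpace V]
  [AddCommGroup W] [Module ℝ W] [TopologicalSpace W]

/-- The wedge product of an `i`-form and a `j`-form (shuffle normalisation, so that
`(a ∧ b)(v, w) = a v * b w - a w * b v` in degrees `1, 1`), placed in degree `p = i + j`. -/
noncomputable def wedgeForm {i j p : ℕ} (h : i + j = p)
    (a : V [⋀^Fin i]→L[ℝ] ℝ) (b : V [⋀^Fin j]→L[ℝ] ℝ) : V [⋀^Fin p]→L[ℝ] ℝ :=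
  { ((LinearMap.mul' ℝ ℝ).compAlternatingMap
      (a.toAlternatingMap.domCoprod b.toAlternatingMap)).domDomCongr
        (finSumFinEquiv.trans (finCongr h)) with
    cont := by
      change Continuous fun v : Fin p → V =>
        LinearMap.mul' ℝ ℝ ((∑ σ : Equiv.Perm.ModSumCongr (Fin i) (Fin j),
          AlternatingMap.domCoprod.summand a.toAlternatingMap b.toAlternatingMap σ)
            (fun q => v (finSumFinEquiv.trans (finCongr h) q)))
      simp only [sum_apply, map_sum]
      refine continuous_finsetSum _ fun σ _ => ?_
      induction σ using Quotient.inductionOn' with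
      | h σ =>
        rw [AlternatingMap.domCoprod.summand_mk'']
        have ha : Continuous fun v : Fin p → V =>
            a (fun q => v (finSumFinEquiv.trans (finCongr h) (σ (Sum.inl q)))) :=
          a.cont.comp (continuous_pi fun q => continuous_apply _)
        have hb : Continuous fun v : Fin p → V =>
            b (fun q => v (finSumFinEquiv.trans (finCongr h) (σ (Sum.inr q)))) :=
          b.cont.comp (continuous_pi fun q => continuous_apply _)
        rcases Int.units_eq_one_or (Equiv.Perm.sign σ) with hs | hs
        · rw [hs, one_smul]
          exact ha.mul hb
        · rw [hs, Units.neg_smul, one_smul]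
          simp only [neg_apply, map_neg]
          exact (ha.mul hb).neg }

/-- Forms of mixed degree, i.e. elements of `Λ^* V^*`: the component in every degree. (In degrees
above `dim V` the components vanish automatically.) -/
abbrev MixedForm (V : Type*) [AddCommGroup V] [Module ℝ V] [TopologicalSpace V] : Type _ :=
  (p : ℕ) → V [⋀^Fin p]→L[ℝ] ℝ

/-- The wedge product of mixed forms. -/
noncomputable def wedge (α β : MixedForm V) : MixedForm V := fun p =>
  ∑ i : Fin (p + 1), wedgeForm (show (i : ℕ) + (p - i) = p by omega) (α i) (β (p - i))

/-- A form of pure degree as a mixed form. -/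
noncomputable def pureForm {p : ℕ} (a : V [⋀^Fin p]→L[ℝ] ℝ) : MixedForm V := Pi.single p a

/-- The powers `α ∧ ⋯ ∧ α`. -/
noncomputable def wedgePow (α : MixedForm V) : ℕ → MixedForm V
  | 0 => pureForm (ContinuousAlternatingMap.constOfIsEmpty ℝ V (ι := Fin 0) 1)
  | m + 1 => wedge α (wedgePow α m)

/-- The exponential `e^F = 1 + F + F ∧ F / 2 + ⋯` of a `2`-form. In degree `p` only the term `F^m/m!`
with `2 m = p` contributes, so that the sum may be cut off at `m = p`. -/
noncomputable def expForm (F : V [⋀^Fin 2]→L[ℝ] ℝ) : MixedForm V := fun p =>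
  ∑ m ∈ Finset.range (p + 1), ((m.factorial : ℝ)⁻¹) • wedgePow (pureForm F) m p

/-- The sign-changing operator, `(-1)^{p(p+1)/2}` in degree `p`. -/
noncomputable def hat (α : MixedForm V) : MixedForm V := fun p =>
  ((-1 : ℝ) ^ (p * (p + 1) / 2)) • α p

/-- Pull-back of mixed forms under a linear map. -/
noncomputable def pullLin (f : W →L[ℝ] V) (α : MixedForm V) : MixedForm W := fun p =>
  (α p).compContinuousLinearMap f

end Algebra

/-! ### Euclidean vector spaces: Hodge star, spinor pairing and norm, isotropic pairs -/

section Euclidean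

variable {V : Type*} [NormedAddCommGroup V] [InnerProductSpace ℝ V] [FiniteDimensional ℝ V]
  {n k : ℕ}

/-- On a finite-dimensional space every alternating map is continuous. -/
noncomputable def toCont {p : ℕ} (a : V [⋀^Fin p]→ₗ[ℝ] ℝ) : V [⋀^Fin p]→L[ℝ] ℝ :=
  { a with
    cont := by
      have h : ⇑a = fun v : Fin p → V => ∑ r : Fin p → Fin (finrank ℝ V),
          (∏ i, (finBasis ℝ V).repr (v i) (r i)) * a fun i => finBasis ℝ V (r i) := by
        funext v
        conv_lhs => rw [show v = fun i => ∑ l, (finBasis ℝ V).repr (v i) l • finBasis ℝ V l from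
          funext fun i => ((finBasis ℝ V).sum_repr (v i)).symm]
        refine (a.toMultilinearMap.map_sum
          (fun i l => (finBasis ℝ V).repr (v i) l • finBasis ℝ V l)).trans ?_
        refine Finset.sum_congr rfl fun r _ => ?_
        exact a.toMultilinearMap.map_smul_univ _ _
      change Continuous ⇑a
      rw [h]
      refine continuous_finsetSum _ fun r _ => (continuous_finsetProd _ fun i _ => ?_).mul
        continuous_const
      exact (((finBasis ℝ V).coord (r i)).continuous_of_finiteDimensional).comp
        (continuous_apply i) }

/-- Some orthonormal basis, used as an auxiliary in the definitions below (none of which depends on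
its choice). -/
noncomputable def onb (hn : finrank ℝ V = n) : OrthonormalBasis (Fin n) ℝ V :=
  (stdOrthonormalBasis ℝ V).reindex (finCongr hn)

/-- The Euclidean volume form of an oriented Euclidean vector space. -/
noncomputable def volForm (hn : finrank ℝ V = n) (o : Orientation ℝ V (Fin n)) :
    V [⋀^Fin n]→L[ℝ] ℝ :=
  haveI : Fact (finrank ℝ V = n) := ⟨hn⟩
  toCont o.volumeForm

/-- The coefficient of a top form with respect to the volume form, i.e. its evaluation on the
`n`-vector `ν_g` dual to the volume form. -/
noncomputable def topCoeff (hn : finrank ℝ V = n) (o : Orientation ℝ V (Fin n))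
    (η : V [⋀^Fin n]→L[ℝ] ℝ) : ℝ :=
  η (onb hn) * volForm hn o (onb hn)

/-- The decomposable form `c_1^♭ ∧ ⋯ ∧ c_m^♭`, that is `v ↦ det ⟨c_i, v_j⟩`. -/
noncomputable def decForm {m : ℕ} (c : Fin m → V) : V [⋀^Fin m]→L[ℝ] ℝ :=
  toCont (Matrix.detRowAlternating.compLinearMap (LinearMap.pi fun i => innerₗ V (c i)))

/-- The Hodge star operator, characterised by `α ∧ ⋆β = ⟨α, β⟩ vol`; equivalently
`⟨⋆β, θ⟩ vol = β ∧ θ`, which is used here with `θ` running through the decomposable forms built from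
an orthonormal basis. -/
noncomputable def hodge (hn : finrank ℝ V = n) (o : Orientation ℝ V (Fin n))
    (β : MixedForm V) : MixedForm V := fun m =>
  ((m.factorial : ℝ)⁻¹) • ∑ h : Fin m → Fin n,
    topCoeff hn o (wedge β (pureForm (decForm (onb hn ∘ h))) n) • decForm (onb hn ∘ h)

/-- The inner product `g(α, β)` on `Λ^* V^*`. -/
noncomputable def formInner (hn : finrank ℝ V = n) (α β : MixedForm V) : ℝ :=
  ∑ p ∈ Finset.range (n + 1), ((p.factorial : ℝ)⁻¹) *
    ∑ h : Fin p → Fin n, α p (onb hn ∘ h) * β p (onb hn ∘ h)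

/-- The norm of spinors, in terms of the forms which represent them. -/
noncomputable def formNorm (hn : finrank ℝ V = n) (α : MixedForm V) : ℝ :=
  Real.sqrt (formInner hn α α)

/-- The bilinear form `⟨ρ, τ⟩ = ν_g([ρ ∧ τ^]^n)` on spinors, in terms of the forms which represent
them. -/
noncomputable def pairing (hn : finrank ℝ V = n) (o : Orientation ℝ V (Fin n))
    (ρ τ : MixedForm V) : ℝ :=
  topCoeff hn o (wedge ρ (hat τ) n)

/-- An isotropic pair `(L, F)` in a vector space: an oriented `k`-plane `L` and a `2`-form on it. -/
structure IsotropicPlane (V : Type*) [NormedAddCommGroup V] [InnerProductSpace ℝ V] (k : ℕ) where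
  L : Submodule ℝ V
  finrank_eq : finrank ℝ L = k
  orientation : Orientation ℝ L (Fin k)
  F : L [⋀^Fin 2]→L[ℝ] ℝ

/-- The Euclidean volume form `ϖ_L`, pulled back by the orthogonal projection `p_L`. -/
noncomputable def IsotropicPlane.vol (P : IsotropicPlane V k) : V [⋀^Fin k]→L[ℝ] ℝ :=
  (volForm P.finrank_eq P.orientation).compContinuousLinearMap P.L.orthogonalProjectionOnto

/-- The pure spinor `τ_{L,F} = e^{p_L^* F} ∧ (⋆ϖ_L)^`. -/
noncomputable def IsotropicPlane.tau (hn : finrank ℝ V = n) (o : Orientation ℝ V (Fin n))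
    (P : IsotropicPlane V k) : MixedForm V :=
  wedge (expForm (P.F.compContinuousLinearMap P.L.orthogonalProjectionOnto))
    (hat (hodge hn o (pureForm P.vol)))

/-- `P` meets the bound `⟨ρ, τ_{L,F}⟩ ≤ ‖τ_{L,F}‖`. -/
def IsotropicPlane.IsCalibratedBy (hn : finrank ℝ V = n) (o : Orientation ℝ V (Fin n))
    (P : IsotropicPlane V k) (ρ : MixedForm V) : Prop :=
  pairing hn o ρ (P.tau hn o) = formNorm hn (P.tau hn o)

/-- Generalised calibrations on an oriented Euclidean vector space. -/
def IsCalibrationForm (hn : finrank ℝ V = n) (o : Orientation ℝ V (Fin n))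
    (ρ : MixedForm V) : Prop :=
  (∀ (k : ℕ) (P : IsotropicPlane V k),
      pairing hn o ρ (P.tau hn o) ≤ formNorm hn (P.tau hn o)) ∧
    ∃ (k : ℕ) (P : IsotropicPlane V k), P.IsCalibratedBy hn o ρ

end Euclidean

/-! ### Differential forms on manifolds (possibly with boundary and corners) -/

section Forms

variable {E H : Type*} [NormedAddCommGroup E] [NormedSpace ℝ E] [TopologicalSpace H]
  (I : ModelWithCorners ℝ E H) {X : Type*} [TopologicalSpace X] [ChartedSpace H X]
  {E' H' : Type*} [NormedAddCommGroup E'] [NormedSpace ℝ E'] [TopologicalSpace H']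
  (I' : ModelWithCorners ℝ E' H') {Y : Type*} [TopologicalSpace Y] [ChartedSpace H' Y]

/-- (Not necessarily smooth) differential `p`-forms. -/
abbrev DForm (X : Type*) [TopologicalSpace X] [ChartedSpace H X] (p : ℕ) : Type _ :=
  (x : X) → TangentSpace I x [⋀^Fin p]→L[ℝ] ℝ

/-- (Not necessarily smooth) differential forms of mixed degree. -/
abbrev MForm (X : Type*) [TopologicalSpace X] [ChartedSpace H X] : Type _ :=
  (x : X) → MixedForm (TangentSpace I x)

variable {I I'}

/-- A form in the coordinates of the preferred chart at `x₀`. -/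
noncomputable def DForm.inChart {p : ℕ} (η : DForm I X p) (x₀ : X) (y : E) :
    E [⋀^Fin p]→L[ℝ] ℝ :=
  (η ((extChartAt I x₀).symm y)).compContinuousLinearMap
    (mfderivWithin 𝓘(ℝ, E) I (extChartAt I x₀).symm (Set.range I) y)

/-- Smoothness of a form at a point. -/
def DForm.SmoothAt {p : ℕ} (η : DForm I X p) (x : X) : Prop :=
  ContDiffWithinAt ℝ ∞ (η.inChart x) (Set.range I) (extChartAt I x x)

/-- Smooth forms. -/
def DForm.Smooth {p : ℕ} (η : DForm I X p) : Prop := ∀ x, η.SmoothAt x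

/-- The exterior derivative, computed at `x` in the preferred chart at `x`. -/
noncomputable def DForm.d {p : ℕ} (η : DForm I X p) : DForm I X (p + 1) := fun x =>
  (extDerivWithin (η.inChart x) (Set.range I) (extChartAt I x x)).compContinuousLinearMap
    (mfderiv I 𝓘(ℝ, E) (extChartAt I x) x)

/-- The pull-back of a form. -/
noncomputable def DForm.pull {p : ℕ} (f : X → Y) (η : DForm I' Y p) : DForm I X p := fun x =>
  (η (f x)).compContinuousLinearMap (mfderiv I I' f x)

/-- The exterior derivative of a form of mixed degree. -/
noncomputable def MForm.d (η : MForm I X) : MForm I X := fun x p =>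
  match p with
  | 0 => 0
  | q + 1 => DForm.d (fun y => η y q) x

/-- The twisted differential `d_H = d + H ∧`. -/
noncomputable def MForm.dTwisted (h : DForm I X 3) (η : MForm I X) : MForm I X := fun x =>
  η.d x + wedge (pureForm (h x)) (η x)

variable (I X) in
/-- An orientation of a `k`-dimensional manifold, given by a nowhere vanishing smooth top form. -/
structure OrientationForm (k : ℕ) where
  form : DForm I X k
  smooth : form.Smooth
  ne_zero : ∀ x, form x ≠ 0

/-- The induced orientation of the tangent spaces. -/
noncomputable def OrientationForm.at {k : ℕ} (Ω : OrientationForm I X k) (x : X) :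
    Orientation ℝ (TangentSpace I x) (Fin k) :=
  rayOfNeZero ℝ (Ω.form x).toAlternatingMap fun h =>
    Ω.ne_zero x (ContinuousAlternatingMap.toAlternatingMap_injective h)

end Forms

/-! ### Integration -/

section Integration

variable {k : ℕ} {H : Type*} [TopologicalSpace H] {I : ModelWithCorners ℝ (Euc k) H}
  {X : Type*} [TopologicalSpace X] [ChartedSpace H X] [IsManifold I ∞ X] [T2Space X]
  [CompactSpace X]

variable (I X) in
/-- A smooth partition of unity subordinate to the preferred charts. -/
noncomputable def partitionOfUnity : SmoothPartitionOfUnity X I X Set.univ :=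
  (SmoothPartitionOfUnity.exists_isSubordinate_chartAt_source I X).choose

/-- The integral of a top form over a compact oriented manifold: the sum of the integrals in
coordinates of its parts in a partition of unity. The sign compares the coordinate frame with the
orientation (no orientation-preserving charts need to exist in dimension zero or near a boundary
point in dimension one). -/
noncomputable def integral (Ω : OrientationForm I X k) (η : DForm I X k) : ℝ :=
  ∑ᶠ c : X, ∫ y in (extChartAt I c).target,
    partitionOfUnity I X c ((extChartAt I c).symm y) *
      (SignType.sign (Ω.form.inChart c y fun i => EuclideanSpace.single i 1) : ℝ) *
      η.inChart c y fun i => EuclideanSpace.single i 1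

end Integration

/-! ### The ambient geometry -/

section Ambient

variable {n : ℕ} {M : Type u} [TopologicalSpace M] [ChartedSpace (Euc n) M]

theorem finrank_tangent (x : M) : finrank ℝ (TangentSpace (𝓡 n) x) = n :=
  finrank_euclideanSpace_fin (𝕜 := ℝ) (n := n)

instance (x : M) : FiniteDimensional ℝ (TangentSpace (𝓡 n) x) :=
  inferInstanceAs (FiniteDimensional ℝ (Euc n))

/-- The differential at `x` of a coordinate system. -/
noncomputable def coordDeriv (c : OpenPartialHomeomorph M (Euc n)) (x : M) :
    TangentSpace (𝓡 n) x →L[ℝ] Euc n :=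
  mfderiv (𝓡 n) 𝓘(ℝ, Euc n) c x

/-- The inverse of the differential at `x` of a coordinate system; it maps the standard basis to the
coordinate vector fields at `x`. -/
noncomputable def coordInv (c : OpenPartialHomeomorph M (Euc n)) (x : M) :
    Euc n →L[ℝ] TangentSpace (𝓡 n) x :=
  (coordDeriv c x).inverse

/-- The derivative at `x` of the change of coordinates from `c'` to `c`. -/
noncomputable def transition (c c' : OpenPartialHomeomorph M (Euc n)) (x : M) :
    Euc n →L[ℝ] Euc n :=
  fderiv ℝ (c ∘ c'.symm) (c' x)

/-- The data on which the construction of the generalised tangent bundle `E(H)` is based: a cover by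
positively oriented coordinate neighbourhoods `U_a`, and `2`-forms `B_a` on `U_a` such that
`H = dB_a` on `U_a`. -/
structure Trivialisation (Ω : OrientationForm (𝓡 n) M n) (H : DForm (𝓡 n) M 3) where
  /-- the indices `a` of the cover -/
  index : Type u
  /-- the coordinates on `U_a = (chart a).source` -/
  chart : index → OpenPartialHomeomorph M (Euc n)
  chart_mem : ∀ a, chart a ∈ IsManifold.maximalAtlas (𝓡 n) ∞ M
  /-- a member of the cover around a given point -/
  around : M → index
  mem_around : ∀ x, x ∈ (chart (around x)).source
  oriented : ∀ a, ∀ x ∈ (chart a).source,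
    0 < Ω.form x fun i => coordInv (chart a) x (EuclideanSpace.single i 1)
  B : index → DForm (𝓡 n) M 2
  B_smooth : ∀ a, ∀ x ∈ (chart a).source, (B a).SmoothAt x
  dB : ∀ a, ∀ x ∈ (chart a).source, (B a).d x = H x

variable {Ω : OrientationForm (𝓡 n) M n} {H : DForm (𝓡 n) M 3}

/-- A smooth section of the spinor bundle `S(E(H))_±` (`ε = 0` for even, `ε = 1` for odd spinors):
a family of smooth functions `ρ_a : U_a → Λ^{ev,od}(ℝ^n)^*` which are related on `U_a ∩ U_b` by the
transition functions of the spin structure, `ρ_a = e^{β} ∧ (det s_ab)^{1/2} s_ab^* ρ_b`; here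
`β = B_a - B_b` in the coordinates of `U_a`, `s_ab` is the Jacobian of the change of coordinates and
`s_ab^*` the induced map from forms in the coordinates of `U_b` to forms in those of `U_a`. -/
structure SpinorField (T : Trivialisation Ω H) (ε : ZMod 2) where
  toFun : T.index → M → MixedForm (Euc n)
  smooth : ∀ (a : T.index) (p : ℕ),
    ContDiffOn ℝ ∞ (fun y => toFun a ((T.chart a).symm y) p) (T.chart a).target
  chiral : ∀ (a : T.index), ∀ x ∈ (T.chart a).source, ∀ p : ℕ, (p : ZMod 2) ≠ ε → toFun a x p = 0
  compatible : ∀ (a b : T.index), ∀ x ∈ (T.chart a).source ∩ (T.chart b).source,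
    toFun a x =
      wedge (expForm ((T.B a x - T.B b x).compContinuousLinearMap (coordInv (T.chart a) x)))
        (Real.sqrt (transition (T.chart a) (T.chart b) x).det •
          pullLin (transition (T.chart b) (T.chart a) x) (toFun b x))

variable [RiemannianBundle (fun x : M => TangentSpace (𝓡 n) x)]

/-- The determinant of the matrix of the metric in given coordinates. -/
noncomputable def metricDet (c : OpenPartialHomeomorph M (Euc n)) (x : M) : ℝ :=
  (Matrix.of fun i l : Fin n => inner ℝ (coordInv c x (EuclideanSpace.single i 1))
    (coordInv c x (EuclideanSpace.single l 1))).det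

/-- The isomorphism `𝔏` from spinor fields to even or odd forms determined by the canonical
`n`-vector field `ν_g = (det g_a)^{-1/2} ∂_1 ∧ ⋯ ∧ ∂_n`: on `U_a`, it is given by
`e^{-B_a} ∧ λ_a ρ_a`, where `λ_a = (det g_a)^{1/4}`. -/
noncomputable def SpinorField.toForm {T : Trivialisation Ω H} {ε : ZMod 2}
    (ρ : SpinorField T ε) : MForm (𝓡 n) M := fun x =>
  wedge (expForm (-(T.B (T.around x) x)))
    ((metricDet (T.chart (T.around x)) x ^ (1 / 4 : ℝ)) •
      pullLin (coordDeriv (T.chart (T.around x)) x) (ρ.toFun (T.around x) x))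

/-- Generalised calibrations on `(M, g, H)`. -/
def SpinorField.IsCalibration {T : Trivialisation Ω H} {ε : ZMod 2} (ρ : SpinorField T ε) : Prop :=
  ∀ x : M, IsCalibrationForm (V := TangentSpace (𝓡 n) x) (finrank_tangent x) (Ω.at x) (ρ.toForm x)

/-- The form `e^{-φ} η`. -/
noncomputable def dilate (φ : M → ℝ) (η : MForm (𝓡 n) M) : MForm (𝓡 n) M := fun x =>
  Real.exp (-φ x) • η x

end Ambient

/-! ### Isotropic pairs and brane energy -/

section Pairs

variable {n : ℕ} {M : Type u} [TopologicalSpace M] [ChartedSpace (Euc n) M]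
  {k : ℕ} {HX : Type*} [TopologicalSpace HX]

/-- An isotropic pair for `(M, g, H)`: an embedded oriented `k`-dimensional submanifold `j : X → M`
(`X` may have boundary and corners, depending on the model `I`), together with a smooth `2`-form `F`
on `X` such that `dF + j^* H = 0`. -/
structure IsotropicPair (I : ModelWithCorners ℝ (Euc k) HX) (X : Type*) [TopologicalSpace X]
    [ChartedSpace HX X] (H : DForm (𝓡 n) M 3) where
  j : X → M
  smooth : ContMDiff I (𝓡 n) ∞ j
  isEmbedding : Topology.IsEmbedding j
  immersive : ∀ x, Function.Injective (mfderiv I (𝓡 n) j x)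
  orientation : OrientationForm I X k
  F : DForm I X 2
  F_smooth : F.Smooth
  isotropic : ∀ x, F.d x + H.pull (I := I) j x = 0

variable {I : ModelWithCorners ℝ (Euc k) HX} {X : Type*} [TopologicalSpace X]
    [ChartedSpace HX X] {Ω : OrientationForm (𝓡 n) M n} {H : DForm (𝓡 n) M 3}
    [RiemannianBundle (fun x : M => TangentSpace (𝓡 n) x)]

/-- The identification of `T_x X` with its image in `T_{j(x)} M`. -/
noncomputable def IsotropicPair.tangentEquiv (P : IsotropicPair I X H) (x : X) :
    TangentSpace I x ≃ₗ[ℝ] LinearMap.range (mfderiv I (𝓡 n) P.j x).toLinearMap :=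
  LinearEquiv.ofInjective (mfderiv I (𝓡 n) P.j x).toLinearMap (P.immersive x)

/-- The isotropic pair in `T_{j(x)} M` defined by an isotropic pair at a point `x`. -/
noncomputable def IsotropicPair.planeAt (P : IsotropicPair I X H) (x : X) :
    IsotropicPlane (TangentSpace (𝓡 n) (P.j x)) k where
  L := LinearMap.range (mfderiv I (𝓡 n) P.j x).toLinearMap
  finrank_eq := (P.tangentEquiv x).finrank_eq.symm.trans
    (finrank_euclideanSpace_fin (𝕜 := ℝ) (n := k))
  orientation := Orientation.map (Fin k) (P.tangentEquiv x) (P.orientation.at x)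
  F := (P.F x).compContinuousLinearMap
    (LinearMap.toContinuousLinearMap (P.tangentEquiv x).symm.toLinearMap)

/-- The pure spinor field `τ_{L,F}` along `L`. -/
noncomputable def IsotropicPair.tau (Ω : OrientationForm (𝓡 n) M n) (P : IsotropicPair I X H)
    (x : X) : MixedForm (TangentSpace (𝓡 n) (P.j x)) :=
  (P.planeAt x).tau (finrank_tangent (P.j x)) (Ω.at (P.j x))

/-- Isotropic pairs calibrated by `ρ`. -/
def IsotropicPair.IsCalibratedBy (P : IsotropicPair I X H) {T : Trivialisation Ω H} {ε : ZMod 2}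
    (ρ : SpinorField T ε) : Prop :=
  ∀ x, IsotropicPlane.IsCalibratedBy (V := TangentSpace (𝓡 n) (P.j x)) (finrank_tangent (P.j x)) (Ω.at (P.j x))
    (P.planeAt x) (ρ.toForm (P.j x))

/-- The Riemannian volume form of `L`. -/
noncomputable def IsotropicPair.vol (P : IsotropicPair I X H) : DForm I X k := fun x =>
  (P.planeAt x).vol.compContinuousLinearMap (mfderiv I (𝓡 n) P.j x)

/-- The brane energy, i.e. the Dirac-Born-Infeld term `∫ e^{-φ} ‖τ_{L,F}‖` minus the Wess-Zumino term
`∫ e^{-φ} j^*[e^{-F} ∧ 𝔏(γ)]`. -/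
noncomputable def IsotropicPair.energy [IsManifold I ∞ X] [T2Space X] [CompactSpace X]
    (P : IsotropicPair I X H) {T : Trivialisation Ω H} {ε : ZMod 2} (φ : M → ℝ)
    (γ : SpinorField T ε) : ℝ :=
  integral P.orientation (fun x => (Real.exp (-φ (P.j x)) *
      formNorm (V := TangentSpace (𝓡 n) (P.j x)) (finrank_tangent (P.j x)) (P.tau Ω x)) • P.vol x) -
    integral P.orientation (fun x => Real.exp (-φ (P.j x)) •
      wedge (expForm (-(P.F x))) (pullLin (mfderiv I (𝓡 n) P.j x) (γ.toForm (P.j x))) k)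

end Pairs

/-! ### Homologous pairs and local minimality -/

section Homologous

/-- The model for manifolds with boundary and corners. -/
abbrev Corner (k : ℕ) : ModelWithCorners ℝ (Euc k) (EuclideanQuadrant k) :=
  modelWithCornersEuclideanQuadrant k

/-- A tangent vector at `y` which points strictly outward (read in the chart at `y`). -/
def IsOutward {k : ℕ} {Y : Type*} [TopologicalSpace Y] [ChartedSpace (EuclideanQuadrant k) Y]
    (y : Y) (ν : TangentSpace (Corner k) y) : Prop :=
  ∃ δ > (0 : ℝ), ∀ t ∈ Set.Ioo 0 δ,
    extChartAt (Corner k) y y - t • (show Euc k from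
      mfderiv (Corner k) 𝓘(ℝ, Euc k) (extChartAt (Corner k) y) y ν) ∈ interior (Set.range (Corner k))

variable {n : ℕ} {M : Type u} [TopologicalSpace M] [ChartedSpace (Euc n) M]
  {H : DForm (𝓡 n) M 3} {k : ℕ}

/-- `P = (X, F)` occurs, with `s` times its orientation (`s = ±1`), as a piece of the oriented
boundary of `Q = (Y, F)`: `i` is a smooth map of `X` into the boundary of `Y`, compatible with the
maps to `M` and with the `2`-forms, and the orientation of `X` is `s` times the boundary orientation
("outward normal first"). -/
structure IsBoundaryPiece {X Y : Type*} [TopologicalSpace X] [ChartedSpace (EuclideanQuadrant k) X]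
    [TopologicalSpace Y] [ChartedSpace (EuclideanQuadrant (k + 1)) Y]
    (P : IsotropicPair (Corner k) X H) (Q : IsotropicPair (Corner (k + 1)) Y H)
    (s : ℝ) (i : X → Y) : Prop where
  smooth : ContMDiff (Corner k) (Corner (k + 1)) ∞ i
  boundary : ∀ x, i x ∈ (Corner (k + 1)).boundary Y
  comp : Q.j ∘ i = P.j
  form : ∀ x, Q.F.pull (I := Corner k) i x = P.F x
  orientation : ∀ x ∈ (Corner k).interior X, ∀ ν : TangentSpace (Corner (k + 1)) (i x),
    IsOutward (i x) ν → ∀ v : Fin k → TangentSpace (Corner k) x, P.orientation.form x v ≠ 0 →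
      0 < s * P.orientation.form x v * Q.orientation.form (i x)
        (Matrix.vecCons ν fun l => mfderiv (Corner k) (Corner (k + 1)) i x (v l))

/-- Compact isotropic pairs `P` and `P'` of dimension `k` are homologous if there is a compact
isotropic pair `Q` of dimension `k + 1` with `∂Q = P - P'`, whose `2`-form restricts to those of `P`
and `P'`. The pieces `P` and `P'` make up the boundary and overlap at most in their own boundaries
(such as the common boundary of two discs). -/
def Homologous {X X' : Type*} [TopologicalSpace X] [ChartedSpace (EuclideanQuadrant k) X]
    [TopologicalSpace X'] [ChartedSpace (EuclideanQuadrant k) X']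
    (P : IsotropicPair (Corner k) X H) (P' : IsotropicPair (Corner k) X' H) : Prop :=
  ∃ (Y : Type u) (_ : TopologicalSpace Y) (_ : ChartedSpace (EuclideanQuadrant (k + 1)) Y)
    (_ : IsManifold (Corner (k + 1)) ∞ Y) (_ : T2Space Y) (_ : CompactSpace Y)
    (Q : IsotropicPair (Corner (k + 1)) Y H) (i : X → Y) (i' : X' → Y),
    IsBoundaryPiece P Q 1 i ∧ IsBoundaryPiece P' Q (-1) i' ∧
    (Corner (k + 1)).boundary Y = Set.range i ∪ Set.range i' ∧
    ∀ x ∈ (Corner k).interior X, ∀ x' ∈ (Corner k).interior X', i x ≠ i' x'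

/-- `X` is a closed disc: it is diffeomorphic, via an embedding into `ℝ^k`, to the closed unit
ball. -/
def IsDisc (k : ℕ) (X : Type*) [TopologicalSpace X] [ChartedSpace (EuclideanQuadrant k) X] : Prop :=
  ∃ e : X → Euc k, ContMDiff (Corner k) 𝓘(ℝ, Euc k) ∞ e ∧ Topology.IsEmbedding e ∧
    (∀ x, Function.Injective (mfderiv (Corner k) 𝓘(ℝ, Euc k) e x)) ∧
    Set.range e = Metric.closedBall 0 1

variable {HL : Type*} [TopologicalSpace HL] {I : ModelWithCorners ℝ (Euc k) HL}
  {L : Type*} [TopologicalSpace L] [ChartedSpace HL L]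

/-- `(D, F_D)` is the restriction of `(L, F)` to a domain `D` embedded into `L`, with the induced
orientation. -/
def IsRestriction {D : Type*} [TopologicalSpace D] [ChartedSpace (EuclideanQuadrant k) D]
    (PD : IsotropicPair (Corner k) D H) (P : IsotropicPair I L H) : Prop :=
  ∃ ι : D → L, ContMDiff (Corner k) I ∞ ι ∧ P.j ∘ ι = PD.j ∧
    (∀ x, P.F.pull (I := Corner k) ι x = PD.F x) ∧
    ∀ x, ∃ c > (0 : ℝ), PD.orientation.form x = c • P.orientation.form.pull (I := Corner k) ι x

variable {Ω : OrientationForm (𝓡 n) M n}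
  [RiemannianBundle (fun x : M => TangentSpace (𝓡 n) x)]

/-- `(L, F)` is locally brane-energy minimising: `E(D, F_D) ≤ E(D', F')` for every embedded disc `D`
in `L` and every compact isotropic pair `(D', F')` homologous to `(D, F_D)`. -/
def IsotropicPair.IsLocallyMinimising (P : IsotropicPair I L H) {T : Trivialisation Ω H}
    {ε : ZMod 2} (φ : M → ℝ) (γ : SpinorField T ε) : Prop :=
  ∀ (D : Type u) [TopologicalSpace D] [ChartedSpace (EuclideanQuadrant k) D]
    [IsManifold (Corner k) ∞ D] [T2Space D] [CompactSpace D]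
    (PD : IsotropicPair (Corner k) D H), IsDisc k D → IsRestriction PD P →
  ∀ (D' : Type u) [TopologicalSpace D'] [ChartedSpace (EuclideanQuadrant k) D']
    [IsManifold (Corner k) ∞ D'] [T2Space D'] [CompactSpace D']
    (P' : IsotropicPair (Corner k) D' H), Homologous PD P' →
  PD.energy φ γ ≤ P'.energy φ γ

end Homologous

end GenCal

/-! This is the classical calibration argument, carried over to spinors and twisted by `H`.

The pairing is translated into forms by linear algebra. In an orthonormal basis adapted to a plane
`L`, the spinor `τ_{L,F}` is, up to orientation signs, `e^F` times the covectors normal to `L`. The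
operator `hat` turns `e^F` into `e^{-F}`, and a product with all normal covectors sees only the
restriction to `L`. Hence `⟨σ, τ_{L,F}⟩ ϖ_L` is the top component of `e^{-F} ∧ σ` on `L`
(`IsotropicPlane.pairing_tau_mul_vol`, and along a submanifold `IsotropicPair.expPull_apply`). The
calibration condition therefore bounds the form `e^{-φ} [e^{-F} ∧ j^* 𝔏(ρ)]^k` by the
Dirac-Born-Infeld density, with equality on calibrated pairs.

Put `α = e^{-φ} (𝔏(ρ) - 𝔏(γ))`, which is `d_H`-closed by hypothesis. On an isotropic pair `dF =
-j^*H`, so `d(e^{-F} ∧ j^*α) = e^{-F} ∧ j^*(d_H α) = 0` (`d_expPull`). Stokes' theorem on the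
homology gives the same integral of this form over `D` and over `D'`
(`Homologous.integral_expPull_eq`). Since `D` is calibrated, its energy equals this integral; the
energy of `D'` is at least as large, by the bound (`IsotropicPair.integral_expPull_le`).

Three analytic facts support this. First, `𝔏(ρ)` is a smooth form, although it is defined with an
arbitrary choice of trivialisation at each point: the transition rules of spinors cancel exactly
(`SpinorField.formOn_eq`). Second, Stokes' theorem is needed for a manifold with corners whose
boundary is presented by two immersed pieces (`integral_pull_eq_of_closed`). It follows from the
divergence theorem on a quadrant, a partition of unity, and a change of variables comparing the
charts of the pieces with the faces of the charts of the filling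
(`integralOn_eq_of_parametrisation`); corners and the boundaries of the pieces are null sets. Third,
the energy density is continuous, hence integrable, so that integrals may be subtracted and
compared. -/

set_option linter.unusedSectionVars false

namespace GenCal

/-! ### The exterior algebra: products of decomposable forms, associativity, pull-back. -/

section ExteriorAlgebra

section Basic

variable {V W : Type*} [AddCommGroup V] [Module ℝ V] [TopologicalSpace V]
  [AddCommGroup W] [Module ℝ W] [TopologicalSpace W]

/-- The decomposable form `θ_1 ∧ ⋯ ∧ θ_p`. -/
noncomputable def prodForm {p : ℕ} (θ : Fin p → V →L[ℝ] ℝ) : V [⋀^Fin p]→L[ℝ] ℝ :=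
  { Matrix.detRowAlternating.compLinearMap (LinearMap.pi fun i => (θ i : V →ₗ[ℝ] ℝ)) with
    cont := by
      change Continuous fun v : Fin p → V => Matrix.det (Matrix.of fun i j => θ j (v i))
      exact Continuous.matrix_det (continuous_matrix fun i j =>
        (θ j).continuous.comp (continuous_apply i)) }

theorem prodForm_apply {p : ℕ} (θ : Fin p → V →L[ℝ] ℝ) (v : Fin p → V) :
    prodForm θ v = (Matrix.of fun i j => θ i (v j)).det := by
  rw [← Matrix.det_transpose]; rfl

/-- The Leibniz formula for the determinant is an alternatization. In this shape products of
decomposable forms are accessible to `MultilinearMap.domCoprod_alternization`. -/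
theorem prodForm_toAlternatingMap {p : ℕ} (θ : Fin p → V →L[ℝ] ℝ) :
    (prodForm θ).toAlternatingMap = MultilinearMap.alternatization
      ((MultilinearMap.mkPiAlgebra ℝ (Fin p) ℝ).compLinearMap
        fun q => (θ q : V →ₗ[ℝ] ℝ)) := by
  ext v
  rw [MultilinearMap.alternatization_apply]
  change Matrix.det (Matrix.of fun i j => θ j (v i)) = _
  rw [Matrix.det_apply]
  rfl

/-- The shuffle product of two alternatizations is the alternatization of the tensor product, so
both sides are the same Leibniz sum over permutations; no factorials enter. -/
theorem wedgeForm_prodForm {i j p : ℕ} (h : i + j = p) (θ : Fin i → V →L[ℝ] ℝ)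
    (ψ : Fin j → V →L[ℝ] ℝ) :
    wedgeForm h (prodForm θ) (prodForm ψ) =
      prodForm fun q => Sum.elim θ ψ (finSumFinEquiv.symm (Fin.cast h.symm q)) := by
  subst h
  ext v
  change LinearMap.mul' ℝ ℝ (((prodForm θ).toAlternatingMap.domCoprod
    (prodForm ψ).toAlternatingMap) fun q => v (finSumFinEquiv.trans (finCongr rfl) q)) = _
  rw [prodForm_toAlternatingMap, prodForm_toAlternatingMap,
    ← MultilinearMap.domCoprod_alternization, MultilinearMap.alternatization_apply, map_sum]
  change _ = Matrix.det (Matrix.of fun r c => _)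
  rw [← Matrix.det_submatrix_equiv_self finSumFinEquiv, Matrix.det_apply]
  refine Finset.sum_congr rfl fun σ _ => ?_
  rw [Units.smul_def, Units.smul_def, map_zsmul]
  congr 1
  rw [Fintype.prod_sum_type]
  simp [MultilinearMap.domCoprod_apply, MultilinearMap.domDomCongr_apply]

theorem wedgeForm_apply {i j p : ℕ} (h : i + j = p)
    (a : V [⋀^Fin i]→L[ℝ] ℝ) (b : V [⋀^Fin j]→L[ℝ] ℝ) (v : Fin p → V) :
    wedgeForm h a b v = LinearMap.mul' ℝ ℝ (AlternatingMap.domCoprod'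
      (TensorProduct.tmul ℝ a.toAlternatingMap b.toAlternatingMap)
        fun q => v (finSumFinEquiv.trans (finCongr h) q)) := rfl

/-- The wedge product as a bilinear map on forms of fixed degrees. -/
noncomputable def wedgeFormₗ {i j p : ℕ} (h : i + j = p) :
    (V [⋀^Fin i]→L[ℝ] ℝ) →ₗ[ℝ] (V [⋀^Fin j]→L[ℝ] ℝ) →ₗ[ℝ] V [⋀^Fin p]→L[ℝ] ℝ :=
  LinearMap.mk₂ ℝ (wedgeForm h)
    (fun a a' b => by
      ext v
      simp only [wedgeForm_apply, ContinuousAlternatingMap.toAlternatingMap_add,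
        TensorProduct.add_tmul, map_add, AlternatingMap.add_apply, ContinuousAlternatingMap.add_apply])
    (fun c a b => by
      ext v
      simp only [wedgeForm_apply, ContinuousAlternatingMap.smul_apply,
        ContinuousAlternatingMap.toAlternatingMap_smul,
        ← TensorProduct.smul_tmul', map_smul, AlternatingMap.smul_apply])
    (fun a b b' => by
      ext v
      simp only [wedgeForm_apply, ContinuousAlternatingMap.toAlternatingMap_add,
        TensorProduct.tmul_add, map_add, AlternatingMap.add_apply, ContinuousAlternatingMap.add_apply])
    (fun c a b => by
      ext v
      simp only [wedgeForm_apply, ContinuousAlternatingMap.smul_apply,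
        ContinuousAlternatingMap.toAlternatingMap_smul,
        TensorProduct.tmul_smul, map_smul, AlternatingMap.smul_apply])

@[simp] theorem wedgeFormₗ_apply {i j p : ℕ} (h : i + j = p)
    (a : V [⋀^Fin i]→L[ℝ] ℝ) (b : V [⋀^Fin j]→L[ℝ] ℝ) :
    wedgeFormₗ h a b = wedgeForm h a b := rfl

@[simp] theorem wedgeForm_zero_left {i j p : ℕ} (h : i + j = p) (b : V [⋀^Fin j]→L[ℝ] ℝ) :
    wedgeForm h (0 : V [⋀^Fin i]→L[ℝ] ℝ) b = 0 := (wedgeFormₗ h).map_zero₂ b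

@[simp] theorem wedgeForm_zero_right {i j p : ℕ} (h : i + j = p) (a : V [⋀^Fin i]→L[ℝ] ℝ) :
    wedgeForm h a (0 : V [⋀^Fin j]→L[ℝ] ℝ) = 0 := (wedgeFormₗ h a).map_zero

/-- The wedge product of mixed forms as a bilinear map. -/
noncomputable def wedgeₗ : MixedForm V →ₗ[ℝ] MixedForm V →ₗ[ℝ] MixedForm V :=
  LinearMap.mk₂ ℝ wedge
    (fun a a' b => by
      ext1 p
      simp only [wedge, Pi.add_apply, ← wedgeFormₗ_apply, map_add, LinearMap.add_apply,
        Finset.sum_add_distrib])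
    (fun c a b => by
      ext1 p
      simp only [wedge, Pi.smul_apply, ← wedgeFormₗ_apply, map_smul, LinearMap.smul_apply,
        Finset.smul_sum])
    (fun a b b' => by
      ext1 p
      simp only [wedge, Pi.add_apply, ← wedgeFormₗ_apply, map_add, Finset.sum_add_distrib])
    (fun c a b => by
      ext1 p
      simp only [wedge, Pi.smul_apply, ← wedgeFormₗ_apply, map_smul, Finset.smul_sum])

@[simp] theorem wedgeₗ_apply (α β : MixedForm V) : wedgeₗ α β = wedge α β := rfl

theorem pureForm_self {p : ℕ} (a : V [⋀^Fin p]→L[ℝ] ℝ) : pureForm a p = a :=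
  Pi.single_eq_same (M := fun p => V [⋀^Fin p]→L[ℝ] ℝ) p a

theorem pureForm_of_ne {p q : ℕ} (h : q ≠ p) (a : V [⋀^Fin p]→L[ℝ] ℝ) : pureForm a q = 0 :=
  Pi.single_eq_of_ne (M := fun p => V [⋀^Fin p]→L[ℝ] ℝ) h a

/-- `pureForm` as a linear map. -/
noncomputable def pureFormₗ (p : ℕ) : (V [⋀^Fin p]→L[ℝ] ℝ) →ₗ[ℝ] MixedForm V :=
  LinearMap.single ℝ (fun p => V [⋀^Fin p]→L[ℝ] ℝ) p

@[simp] theorem pureFormₗ_apply {p : ℕ} (a : V [⋀^Fin p]→L[ℝ] ℝ) :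
    pureFormₗ p a = pureForm a := rfl

theorem wedge_pureForm_apply {j p i : ℕ} (h : i + j = p) (α : MixedForm V)
    (b : V [⋀^Fin j]→L[ℝ] ℝ) : wedge α (pureForm b) p = wedgeForm h (α i) b := by
  unfold wedge
  rw [Finset.sum_eq_single (⟨i, by omega⟩ : Fin (p + 1))]
  · obtain rfl : j = p - i := by omega
    simp only [pureForm_self]
  · intro q _ hq
    rw [pureForm_of_ne, wedgeForm_zero_right]
    intro hj
    exact hq (Fin.ext (by simp only; omega))
  · simp

theorem wedge_pureForm_apply_of_lt {j p : ℕ} (h : p < j) (α : MixedForm V)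
    (b : V [⋀^Fin j]→L[ℝ] ℝ) : wedge α (pureForm b) p = 0 := by
  unfold wedge
  refine Finset.sum_eq_zero fun q _ => ?_
  rw [pureForm_of_ne (by omega), wedgeForm_zero_right]

theorem pureForm_wedge_apply {i p j : ℕ} (h : i + j = p) (a : V [⋀^Fin i]→L[ℝ] ℝ)
    (β : MixedForm V) : wedge (pureForm a) β p = wedgeForm h a (β j) := by
  unfold wedge
  rw [Finset.sum_eq_single (⟨i, by omega⟩ : Fin (p + 1))]
  · obtain rfl : j = p - i := by omega
    simp only [pureForm_self]
  · intro q _ hq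
    rw [pureForm_of_ne, wedgeForm_zero_left]
    intro hj
    exact hq (Fin.ext hj)
  · simp

theorem pureForm_wedge_apply_of_lt {i p : ℕ} (h : p < i) (a : V [⋀^Fin i]→L[ℝ] ℝ)
    (β : MixedForm V) : wedge (pureForm a) β p = 0 := by
  unfold wedge
  refine Finset.sum_eq_zero fun q _ => ?_
  rw [pureForm_of_ne (by omega), wedgeForm_zero_left]

theorem wedge_pureForm_pureForm {i j p : ℕ} (h : i + j = p) (a : V [⋀^Fin i]→L[ℝ] ℝ)
    (b : V [⋀^Fin j]→L[ℝ] ℝ) :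
    wedge (pureForm a) (pureForm b) = pureForm (wedgeForm h a b) := by
  subst h
  ext1 q
  rcases lt_or_ge q i with hq | hq
  · rw [pureForm_wedge_apply_of_lt hq, pureForm_of_ne (by omega)]
  · obtain ⟨r, rfl⟩ := Nat.exists_eq_add_of_le hq
    rw [pureForm_wedge_apply rfl]
    by_cases hr : r = j
    · subst hr; simp only [pureForm_self]
    · rw [pureForm_of_ne hr, pureForm_of_ne (by omega), wedgeForm_zero_right]

/-- Degrees such as `(i + j) + k` and `i + (j + k)` give different types of forms. As mixed forms
they can be compared without casts. -/
theorem pureForm_prodForm_congr {p q : ℕ} (h : p = q) {θ : Fin p → V →L[ℝ] ℝ}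
    {ψ : Fin q → V →L[ℝ] ℝ} (hθ : ∀ i, θ i = ψ (Fin.cast h i)) :
    pureForm (prodForm θ) = pureForm (prodForm ψ) := by
  subst h
  congr 2
  exact funext hθ

/-- The expansion of a form with respect to a frame and the dual coframe. -/
theorem eq_sum_prodForm {ι : Type*} [Fintype ι] [DecidableEq ι] {e : ι → V} {θ : ι → V →L[ℝ] ℝ}
    (he : ∀ v, ∑ r, θ r v • e r = v) {p : ℕ} (α : V [⋀^Fin p]→L[ℝ] ℝ) :
    α = (p.factorial : ℝ)⁻¹ • ∑ h : Fin p → ι, α (e ∘ h) • prodForm (θ ∘ h) := by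
  ext v
  have hv (w : Fin p → V) : α w = ∑ h : Fin p → ι, (∏ i, θ (h i) (w i)) * α (e ∘ h) := by
    conv_lhs => rw [show w = fun i => ∑ r, θ r (w i) • e r from funext fun i => (he (w i)).symm]
    refine (α.toMultilinearMap.map_sum (fun i l => θ l (w i) • e l)).trans ?_
    refine Finset.sum_congr rfl fun r _ => ?_
    exact α.toMultilinearMap.map_smul_univ _ _
  -- Summing over permutations accounts for the factor `p!`: all signed permuted values equal `α v`,
  -- and for a fixed index tuple the signed sum of the coordinate products is a determinant.
  have key : (p.factorial : ℝ) * α v = ∑ h : Fin p → ι, α (e ∘ h) * prodForm (θ ∘ h) v := by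
    have h1 : ∀ σ : Equiv.Perm (Fin p), α v = Equiv.Perm.sign σ • α (v ∘ σ) := fun σ => by
      have := α.toAlternatingMap.map_perm v σ
      change α (v ∘ σ) = _ at this
      rw [this, smul_smul, Int.units_mul_self, one_smul]
      rfl
    calc (p.factorial : ℝ) * α v = ∑ σ : Equiv.Perm (Fin p), α v := by
          simp [Fintype.card_perm]
      _ = ∑ σ : Equiv.Perm (Fin p), Equiv.Perm.sign σ •
            ∑ h : Fin p → ι, (∏ i, θ (h i) (v (σ i))) * α (e ∘ h) :=
          Finset.sum_congr rfl fun σ _ => by rw [← hv (fun i => v (σ i))]; exact h1 σ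
      _ = _ := by
          simp_rw [Finset.smul_sum]
          rw [Finset.sum_comm]
          refine Finset.sum_congr rfl fun h _ => ?_
          change _ = α (e ∘ h) * Matrix.det (Matrix.of fun i j => (θ ∘ h) j (v i))
          rw [Matrix.det_apply, Finset.mul_sum]
          refine Finset.sum_congr rfl fun σ _ => ?_
          rw [mul_smul_comm, mul_comm]
          rfl
  have hp : (p.factorial : ℝ) ≠ 0 := by positivity
  simp only [ContinuousAlternatingMap.smul_apply, ContinuousAlternatingMap.sum_apply, smul_eq_mul]
  rw [← key, inv_mul_cancel_left₀ hp]

theorem compContinuousLinearMap_prodForm {p : ℕ} (θ : Fin p → V →L[ℝ] ℝ) (f : W →L[ℝ] V) :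
    (prodForm θ).compContinuousLinearMap f = prodForm fun i => (θ i).comp f := by
  ext v
  simp [prodForm_apply]

/-- Pull-back of mixed forms as a linear map. -/
noncomputable def pullLinₗ (f : W →L[ℝ] V) : MixedForm V →ₗ[ℝ] MixedForm W where
  toFun := pullLin f
  map_add' _ _ := rfl
  map_smul' _ _ := rfl

@[simp] theorem pullLinₗ_apply (f : W →L[ℝ] V) (α : MixedForm V) : pullLinₗ f α = pullLin f α := rfl

theorem pullLin_pureForm {p : ℕ} (f : W →L[ℝ] V) (a : V [⋀^Fin p]→L[ℝ] ℝ) :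
    pullLin f (pureForm a) = pureForm (a.compContinuousLinearMap f) := by
  ext1 q
  by_cases h : q = p
  · subst h; simp only [pullLin, pureForm_self]
  · simp only [pullLin, pureForm_of_ne h]; rfl

theorem pullLin_pullLin {U : Type*} [AddCommGroup U] [Module ℝ U] [TopologicalSpace U]
    (f : W →L[ℝ] V) (g : U →L[ℝ] W) (α : MixedForm V) :
    pullLin g (pullLin f α) = pullLin (f.comp g) α := rfl

end Basic

section FiniteDimensional

variable {V W : Type*} [AddCommGroup V] [Module ℝ V] [TopologicalSpace V]
  [IsTopologicalAddGroup V] [ContinuousSMul ℝ V] [T2Space V] [FiniteDimensional ℝ V]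
  [AddCommGroup W] [Module ℝ W] [TopologicalSpace W]
  [IsTopologicalAddGroup W] [ContinuousSMul ℝ W] [T2Space W] [FiniteDimensional ℝ W]

/-- Coordinate functionals with respect to a basis. -/
noncomputable def coordL {ι : Type*} (b : Basis ι ℝ V) (i : ι) : V →L[ℝ] ℝ :=
  LinearMap.toContinuousLinearMap (b.coord i)

theorem sum_coordL_smul {ι : Type*} [Fintype ι] (b : Basis ι ℝ V) (v : V) :
    ∑ r, coordL b r v • b r = v := b.sum_repr v

theorem form_eq_zero_of_finrank_lt {p : ℕ} (h : finrank ℝ V < p) (α : V [⋀^Fin p]→L[ℝ] ℝ) :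
    α = 0 := by
  ext v
  refine α.toAlternatingMap.map_linearDependent v fun hv => ?_
  have := hv.fintype_card_le_finrank
  simp at this
  omega

theorem mixedForm_eq_sum {N : ℕ} (hN : finrank ℝ V < N) (α : MixedForm V) :
    α = ∑ p ∈ Finset.range N, pureForm (α p) := by
  ext1 q
  rw [Finset.sum_apply]
  by_cases hq : q < N
  · rw [Finset.sum_eq_single q, pureForm_self]
    · intro b _ hb
      exact pureForm_of_ne hb.symm _
    · simp [hq]
  · rw [form_eq_zero_of_finrank_lt (by omega) (α q), Finset.sum_eq_zero]
    intro p hp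
    rw [pureForm_of_ne]
    rintro rfl
    simp at hp
    omega

/-- Decomposable forms span every degree, and only finitely many degrees are nonzero in finite
dimension. Multilinear identities of the exterior algebra thus reduce to statements about lists of
covectors. -/
theorem mixedForm_linearMap_ext {A : Type*} [AddCommMonoid A] [Module ℝ A]
    {f g : MixedForm V →ₗ[ℝ] A}
    (h : ∀ (p : ℕ) (θ : Fin p → V →L[ℝ] ℝ), f (pureForm (prodForm θ)) = g (pureForm (prodForm θ))) :
    f = g := by
  ext1 α
  rw [mixedForm_eq_sum (Nat.lt_succ_self _) α, map_sum, map_sum]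
  refine Finset.sum_congr rfl fun p _ => ?_
  rw [eq_sum_prodForm (sum_coordL_smul (finBasis ℝ V)) (α p)]
  simp only [← pureFormₗ_apply, map_smul, map_sum] at h ⊢
  congr 1
  refine Finset.sum_congr rfl fun r _ => ?_
  congr 1
  exact h _ _

theorem wedge_prodForm {i j : ℕ} (θ : Fin i → V →L[ℝ] ℝ) (ψ : Fin j → V →L[ℝ] ℝ) :
    wedge (pureForm (prodForm θ)) (pureForm (prodForm ψ)) =
      pureForm (prodForm (Fin.append θ ψ)) := by
  rw [wedge_pureForm_pureForm rfl, wedgeForm_prodForm]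
  refine pureForm_prodForm_congr rfl fun q => ?_
  refine Fin.addCases (fun a => ?_) (fun a => ?_) q <;> simp

/-- On decomposable forms the product is concatenation of covectors, which is associative;
trilinearity does the rest. -/
theorem wedge_assoc (α β γ : MixedForm V) : wedge (wedge α β) γ = wedge α (wedge β γ) := by
  have h : (LinearMap.llcomp ℝ (MixedForm V) (MixedForm V) (MixedForm V →ₗ[ℝ] MixedForm V) wedgeₗ)
      ∘ₗ wedgeₗ = (LinearMap.lcomp ℝ _ (wedgeₗ (V := V))) ∘ₗ
        (LinearMap.llcomp ℝ (MixedForm V) (MixedForm V) (MixedForm V)) ∘ₗ wedgeₗ := by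
    refine mixedForm_linearMap_ext fun i θ => mixedForm_linearMap_ext fun j ψ =>
      mixedForm_linearMap_ext fun k χ => ?_
    change wedge (wedge _ _) _ = wedge _ (wedge _ _)
    simp only [wedge_prodForm]
    refine pureForm_prodForm_congr (add_assoc i j k) fun q => ?_
    rw [Fin.append_assoc]
    rfl
  exact congrArg (fun f => f α β γ) h

theorem pureForm_const_one :
    pureForm (ContinuousAlternatingMap.constOfIsEmpty ℝ V (ι := Fin 0) (1 : ℝ)) =
      pureForm (prodForm (Fin.elim0 : Fin 0 → V →L[ℝ] ℝ)) := by
  congr 1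
  ext v
  simp [prodForm_apply]

theorem one_wedge (α : MixedForm V) :
    wedge (pureForm (ContinuousAlternatingMap.constOfIsEmpty ℝ V (ι := Fin 0) (1 : ℝ))) α = α := by
  have h : wedgeₗ (pureForm (ContinuousAlternatingMap.constOfIsEmpty ℝ V (ι := Fin 0) (1 : ℝ))) =
      LinearMap.id := by
    refine mixedForm_linearMap_ext fun i θ => ?_
    rw [wedgeₗ_apply, pureForm_const_one, wedge_prodForm]
    refine pureForm_prodForm_congr (zero_add i) fun q => ?_
    rw [Fin.elim0_append]
    rfl
  exact congrArg (fun f => f α) h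

theorem wedge_one (α : MixedForm V) :
    wedge α (pureForm (ContinuousAlternatingMap.constOfIsEmpty ℝ V (ι := Fin 0) (1 : ℝ))) = α := by
  have h : wedgeₗ.flip (pureForm (ContinuousAlternatingMap.constOfIsEmpty ℝ V (ι := Fin 0)
      (1 : ℝ))) = LinearMap.id := by
    refine mixedForm_linearMap_ext fun i θ => ?_
    rw [LinearMap.flip_apply, wedgeₗ_apply, pureForm_const_one, wedge_prodForm]
    refine pureForm_prodForm_congr (add_zero i) fun q => ?_
    rw [Fin.append_elim0]
    rfl
  exact congrArg (fun f => f α) h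

/-- The exterior algebra. -/
noncomputable instance : Ring (MixedForm V) :=
  { (inferInstance : AddCommGroup (MixedForm V)) with
    mul := wedge
    one := pureForm (ContinuousAlternatingMap.constOfIsEmpty ℝ V (ι := Fin 0) 1)
    left_distrib := fun α β γ => (wedgeₗ α).map_add β γ
    right_distrib := fun α β γ => congrArg (fun f => f γ) (wedgeₗ.map_add α β)
    zero_mul := fun α => wedgeₗ.map_zero₂ α
    mul_zero := fun α => (wedgeₗ α).map_zero
    mul_assoc := wedge_assoc
    one_mul := one_wedge
    mul_one := wedge_one }

theorem wedge_eq_mul (α β : MixedForm V) : wedge α β = α * β := rfl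

theorem mixedForm_one_def : (1 : MixedForm V) =
    pureForm (ContinuousAlternatingMap.constOfIsEmpty ℝ V (ι := Fin 0) 1) := rfl

instance : IsScalarTower ℝ (MixedForm V) (MixedForm V) :=
  ⟨fun c α β => congrArg (fun f => f β) (wedgeₗ.map_smul c α)⟩

instance : SMulCommClass ℝ (MixedForm V) (MixedForm V) :=
  ⟨fun c α β => ((wedgeₗ α).map_smul c β).symm⟩

noncomputable instance : Algebra ℝ (MixedForm V) :=
  Algebra.ofModule (fun c α β => congrArg (fun f => f β) (wedgeₗ.map_smul c α))
    (fun c α β => (wedgeₗ α).map_smul c β)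

theorem wedgePow_eq_pow (α : MixedForm V) (m : ℕ) : wedgePow α m = α ^ m := by
  induction m with
  | zero => rfl
  | succ m ih => rw [wedgePow, ih, pow_succ', wedge_eq_mul]

theorem pullLin_mul (f : W →L[ℝ] V) (α β : MixedForm V) :
    pullLin f (α * β) = pullLin f α * pullLin f β := by
  have h : (LinearMap.llcomp ℝ (MixedForm V) (MixedForm V) (MixedForm W) (pullLinₗ f)) ∘ₗ wedgeₗ =
      (LinearMap.lcomp ℝ _ (pullLinₗ f)) ∘ₗ wedgeₗ ∘ₗ pullLinₗ f := by
    refine mixedForm_linearMap_ext fun i θ => mixedForm_linearMap_ext fun j ψ => ?_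
    change pullLin f (wedge _ _) = wedge (pullLin f _) (pullLin f _)
    simp only [wedge_prodForm, pullLin_pureForm, compContinuousLinearMap_prodForm]
    refine pureForm_prodForm_congr rfl fun q => ?_
    refine Fin.addCases (fun a => ?_) (fun a => ?_) q <;> simp
  exact congrArg (fun f => f α β) h

theorem pullLin_one (f : W →L[ℝ] V) : pullLin f 1 = 1 := by
  rw [mixedForm_one_def, pullLin_pureForm]
  rfl

/-- Pull-back as a homomorphism of exterior algebras. -/
noncomputable def pullLinHom (f : W →L[ℝ] V) : MixedForm V →ₐ[ℝ] MixedForm W :=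
  AlgHom.ofLinearMap (pullLinₗ f) (pullLin_one f) (pullLin_mul f)

@[simp] theorem pullLinHom_apply (f : W →L[ℝ] V) (α : MixedForm V) :
    pullLinHom f α = pullLin f α := rfl

end FiniteDimensional

end ExteriorAlgebra

/-! ### Centrality of two-forms, their exponentials, and the sign operator. -/

section EvenForms

variable {V W : Type*} [AddCommGroup V] [Module ℝ V] [TopologicalSpace V]
  [IsTopologicalAddGroup V] [ContinuousSMul ℝ V] [T2Space V] [FiniteDimensional ℝ V]
  [AddCommGroup W] [Module ℝ W] [TopologicalSpace W]
  [IsTopologicalAddGroup W] [ContinuousSMul ℝ W] [T2Space W] [FiniteDimensional ℝ W]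

/-- A covector as an element of the exterior algebra. -/
noncomputable def oneForm (θ : V →L[ℝ] ℝ) : MixedForm V := pureForm (prodForm fun _ : Fin 1 => θ)

theorem oneForm_mul_prodForm {p : ℕ} (θ : V →L[ℝ] ℝ) (ψ : Fin p → V →L[ℝ] ℝ) :
    oneForm θ * pureForm (prodForm ψ) =
      pureForm (prodForm (Fin.cons θ ψ : Fin (p + 1) → V →L[ℝ] ℝ)) := by
  rw [oneForm, ← wedge_eq_mul, wedge_prodForm]
  refine pureForm_prodForm_congr (add_comm 1 p) fun q => ?_
  refine Fin.addCases (fun a => ?_) (fun a => ?_) q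
  · rw [Fin.append_left, Subsingleton.elim a 0]
    rfl
  · rw [Fin.append_right, show Fin.cast (add_comm 1 p) (Fin.natAdd 1 a) = a.succ from
      Fin.ext (by simp), Fin.cons_succ]

theorem oneForm_anticomm (θ ψ : V →L[ℝ] ℝ) : oneForm θ * oneForm ψ = -(oneForm ψ * oneForm θ) := by
  simp only [oneForm, ← wedge_eq_mul, wedge_prodForm]
  simp only [← pureFormₗ_apply, ← map_neg]
  congr 1
  ext v
  rw [ContinuousAlternatingMap.neg_apply, prodForm_apply, prodForm_apply]
  change Matrix.det (_ : Matrix (Fin 2) (Fin 2) ℝ) = -Matrix.det (_ : Matrix (Fin 2) (Fin 2) ℝ)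
  rw [Matrix.det_fin_two, Matrix.det_fin_two]
  simp only [Matrix.of_apply]
  change θ _ * ψ _ - θ _ * ψ _ = -(ψ _ * θ _ - ψ _ * θ _)
  ring

theorem commute_oneForm_mul_oneForm (θ ψ χ : V →L[ℝ] ℝ) :
    Commute (oneForm θ * oneForm ψ) (oneForm χ) := by
  change _ * _ = _ * _
  rw [mul_assoc, oneForm_anticomm ψ χ, mul_neg, ← mul_assoc, oneForm_anticomm θ χ, neg_mul,
    neg_neg, mul_assoc]

/-- A decomposable two-form is a product of two covectors, and moving a third covector past both
produces two signs which cancel. Centrality is what lets `e^F` obey the rules of the commutative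
exponential. -/
theorem commute_pureForm_two (F : V [⋀^Fin 2]→L[ℝ] ℝ) (α : MixedForm V) :
    Commute (pureForm F) α := by
  have h1 (θ : Fin 2 → V →L[ℝ] ℝ) (j : ℕ) (ψ : Fin j → V →L[ℝ] ℝ) :
      Commute (pureForm (prodForm θ)) (pureForm (prodForm ψ)) := by
    have hθ : pureForm (prodForm θ) = oneForm (θ 0) * oneForm (θ 1) := by
      rw [oneForm, oneForm, ← wedge_eq_mul, wedge_prodForm]
      refine pureForm_prodForm_congr rfl fun q => ?_
      fin_cases q <;> rfl
    rw [hθ]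
    induction j with
    | zero =>
      have : pureForm (prodForm ψ) = 1 := by
        rw [mixedForm_one_def, pureForm_const_one, Subsingleton.elim ψ Fin.elim0]
      rw [this]
      exact Commute.one_right _
    | succ j ih =>
      rw [← Fin.cons_self_tail ψ, ← oneForm_mul_prodForm]
      exact (commute_oneForm_mul_oneForm _ _ _).mul_right (ih _)
  have h2 : (wedgeₗ (V := V)) ∘ₗ pureFormₗ 2 = wedgeₗ.flip ∘ₗ pureFormₗ 2 := by
    ext1 F
    refine mixedForm_linearMap_ext fun j ψ => ?_
    rw [eq_sum_prodForm (sum_coordL_smul (finBasis ℝ V)) F]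
    simp only [map_smul, map_sum, LinearMap.smul_apply, LinearMap.sum_apply]
    congr 1
    refine Finset.sum_congr rfl fun r _ => ?_
    congr 1
    exact h1 _ j ψ
  exact congrArg (fun f => f F α) h2

theorem pureForm_two_mul_apply (F : V [⋀^Fin 2]→L[ℝ] ℝ) (β : MixedForm V) (q : ℕ) :
    (pureForm F * β) (q + 2) = wedgeForm (add_comm 2 q) F (β q) :=
  pureForm_wedge_apply _ F β

theorem pureForm_two_pow_apply {m q : ℕ} (h : q ≠ 2 * m) (F : V [⋀^Fin 2]→L[ℝ] ℝ) :
    (pureForm F ^ m) q = 0 := by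
  induction m generalizing q with
  | zero => exact pureForm_of_ne (by simpa using h) _
  | succ m ih =>
    rw [pow_succ']
    match q with
    | 0 => exact pureForm_wedge_apply_of_lt (by omega) _ _
    | 1 => exact pureForm_wedge_apply_of_lt (by omega) _ _
    | q + 2 => rw [pureForm_two_mul_apply, ih (by omega), wedgeForm_zero_right]

theorem pureForm_two_pow_eq_zero {m : ℕ} (h : finrank ℝ V < m) (F : V [⋀^Fin 2]→L[ℝ] ℝ) :
    pureForm F ^ m = 0 := by
  ext1 q
  by_cases hq : q = 2 * m
  · exact form_eq_zero_of_finrank_lt (by omega) _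
  · exact pureForm_two_pow_apply hq F

/-- The cut-off in `expForm` depends on the degree. A common cut-off is possible because `F^m` lives
in degree `2 m` and all degrees above the dimension vanish. -/
theorem expForm_eq_sum {N : ℕ} (hN : finrank ℝ V < N) (F : V [⋀^Fin 2]→L[ℝ] ℝ) :
    expForm F = ∑ m ∈ Finset.range N, ((m.factorial : ℝ)⁻¹) • pureForm F ^ m := by
  ext1 q
  by_cases hq : finrank ℝ V < q
  · rw [form_eq_zero_of_finrank_lt hq (expForm F q)]
    exact (form_eq_zero_of_finrank_lt hq _).symm
  rw [Finset.sum_apply, expForm]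
  simp only [wedgePow_eq_pow, Pi.smul_apply]
  refine Finset.sum_subset (Finset.range_subset_range.2 (by omega)) fun m _ hm => ?_
  rw [pureForm_two_pow_apply, smul_zero]
  simp at hm
  omega

/-- This imports the addition theorem for exponentials of commuting nilpotent elements, used in
`expForm_add`. -/
theorem expForm_eq_exp (F : V [⋀^Fin 2]→L[ℝ] ℝ) : expForm F = IsNilpotent.exp (pureForm F) := by
  rw [expForm_eq_sum (Nat.lt_succ_self _),
    IsNilpotent.exp_eq_sum (pureForm_two_pow_eq_zero (Nat.lt_succ_self _) F)]
  refine Finset.sum_congr rfl fun m _ => ?_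
  rw [← Rat.cast_smul_eq_qsmul ℝ]
  simp

theorem isNilpotent_pureForm_two (F : V [⋀^Fin 2]→L[ℝ] ℝ) : IsNilpotent (pureForm F) :=
  ⟨_, pureForm_two_pow_eq_zero (Nat.lt_succ_self _) F⟩

theorem expForm_add (F G : V [⋀^Fin 2]→L[ℝ] ℝ) : expForm (F + G) = expForm F * expForm G := by
  rw [expForm_eq_exp, expForm_eq_exp, expForm_eq_exp, ← IsNilpotent.exp_add_of_commute
    (commute_pureForm_two F _) (isNilpotent_pureForm_two F) (isNilpotent_pureForm_two G)]
  congr 1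
  exact (pureFormₗ 2).map_add F G

theorem commute_expForm (F : V [⋀^Fin 2]→L[ℝ] ℝ) (α : MixedForm V) : Commute (expForm F) α := by
  rw [expForm_eq_sum (Nat.lt_succ_self _)]
  exact Commute.sum_left _ _ _ fun m _ => ((commute_pureForm_two F α).pow_left m).smul_left _

theorem pullLin_expForm (f : W →L[ℝ] V) (F : V [⋀^Fin 2]→L[ℝ] ℝ) :
    pullLin f (expForm F) = expForm (F.compContinuousLinearMap f) := by
  -- One truncation beyond both dimensions, so that the two sums can be compared term by term.
  rw [expForm_eq_sum (N := finrank ℝ V + finrank ℝ W + 1) (by omega),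
    expForm_eq_sum (N := finrank ℝ V + finrank ℝ W + 1) (by omega), ← pullLinHom_apply, map_sum]
  simp only [map_smul, map_pow, pullLinHom_apply, pullLin_pureForm]

/-- The operator `hat` as a linear map. -/
noncomputable def hatₗ : MixedForm V →ₗ[ℝ] MixedForm V where
  toFun := hat
  map_add' α β := by ext1 p; simp [hat]
  map_smul' c α := by ext1 p; simp [hat, smul_comm c]

@[simp] theorem hatₗ_apply (α : MixedForm V) : hatₗ α = hat α := rfl

theorem hat_hat (α : MixedForm V) : hat (hat α) = α := by
  ext1 p
  simp only [hat, smul_smul, ← mul_pow]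
  simp

/-- Raising the degree from `q` to `q + 2` changes the exponent `q (q + 1) / 2` by `2 q + 3`, which
is odd. -/
theorem hat_pureForm_two_mul (F : V [⋀^Fin 2]→L[ℝ] ℝ) (β : MixedForm V) :
    hat (pureForm F * β) = pureForm (-F) * hat β := by
  ext1 q
  match q with
  | 0 =>
    rw [hat, ← wedge_eq_mul, ← wedge_eq_mul, pureForm_wedge_apply_of_lt (by omega),
      pureForm_wedge_apply_of_lt (by omega), smul_zero]
  | 1 =>
    rw [hat, ← wedge_eq_mul, ← wedge_eq_mul, pureForm_wedge_apply_of_lt (by omega),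
      pureForm_wedge_apply_of_lt (by omega), smul_zero]
  | q + 2 =>
    rw [hat, pureForm_two_mul_apply, pureForm_two_mul_apply, hat, ← wedgeFormₗ_apply,
      ← wedgeFormₗ_apply, map_smul, map_neg, LinearMap.neg_apply, smul_neg, ← neg_smul]
    congr 1
    rw [show (q + 2) * (q + 2 + 1) / 2 = q * (q + 1) / 2 + (2 * q + 3) by
      rw [show (q + 2) * (q + 2 + 1) = q * (q + 1) + (2 * q + 3) * 2 by ring,
        Nat.add_mul_div_right _ _ (by norm_num)], pow_add, pow_add, pow_mul]
    norm_num

/-- This change of sign is why the Wess-Zumino term contains `e^{-F}` while the pure spinor contains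
`e^F`. -/
theorem hat_expForm_mul (F : V [⋀^Fin 2]→L[ℝ] ℝ) (β : MixedForm V) :
    hat (expForm F * β) = expForm (-F) * hat β := by
  have h (m : ℕ) : hat (pureForm F ^ m * β) = pureForm (-F) ^ m * hat β := by
    induction m with
    | zero => simp
    | succ m ih => rw [pow_succ', mul_assoc, hat_pureForm_two_mul, ih, pow_succ', mul_assoc]
  rw [expForm_eq_sum (Nat.lt_succ_self _), expForm_eq_sum (Nat.lt_succ_self _), Finset.sum_mul,
    Finset.sum_mul, ← hatₗ_apply, map_sum]
  refine Finset.sum_congr rfl fun m _ => ?_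
  rw [smul_mul_assoc, map_smul, hatₗ_apply, h, smul_mul_assoc]

end EvenForms

/-! ### Hodge star, pairing and norm in orthonormal bases. -/

section EuclideanForms

open scoped RealInnerProductSpace

variable {V : Type*} [NormedAddCommGroup V] [InnerProductSpace ℝ V] [FiniteDimensional ℝ V]
  {n k : ℕ}

theorem decForm_eq_prodForm {m : ℕ} (c : Fin m → V) :
    decForm c = prodForm fun i => innerSL ℝ (c i) := rfl

theorem decForm_apply {m : ℕ} (c v : Fin m → V) :
    decForm c v = (Matrix.of fun i j => ⟪c i, v j⟫).det := by
  rw [decForm_eq_prodForm, prodForm_apply]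
  rfl

theorem decForm_comm {m : ℕ} (c v : Fin m → V) : decForm c v = decForm v c := by
  rw [decForm_apply, decForm_apply, ← Matrix.det_transpose]
  congr 1
  ext i j
  simp [real_inner_comm]

theorem eq_sum_decForm {ι : Type*} [Fintype ι] [DecidableEq ι] (b : OrthonormalBasis ι ℝ V) {p : ℕ}
    (α : V [⋀^Fin p]→L[ℝ] ℝ) :
    α = (p.factorial : ℝ)⁻¹ • ∑ h : Fin p → ι, α (b ∘ h) • decForm (b ∘ h) :=
  eq_sum_prodForm (θ := fun r => innerSL ℝ (b r)) (fun v => b.sum_repr' v) α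

/-- Reproducing property: `decForm c` represents evaluation at `c` for the inner product on
`p`-forms, because the Gram determinant is symmetric in its two arguments. -/
theorem sum_apply_mul_decForm {ι : Type*} [Fintype ι] [DecidableEq ι] (b : OrthonormalBasis ι ℝ V)
    {p : ℕ} (α : V [⋀^Fin p]→L[ℝ] ℝ) (c : Fin p → V) :
    (p.factorial : ℝ)⁻¹ * ∑ h : Fin p → ι, α (b ∘ h) * decForm c (b ∘ h) = α c := by
  conv_rhs => rw [eq_sum_decForm b α]
  simp [decForm_comm c]

theorem volForm_apply (hn : finrank ℝ V = n) (o : Orientation ℝ V (Fin n)) (v : Fin n → V) :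
    have : Fact (finrank ℝ V = n) := ⟨hn⟩
    volForm hn o v = o.volumeForm v := rfl

theorem volForm_mul_self (hn : finrank ℝ V = n) (o : Orientation ℝ V (Fin n))
    (b : OrthonormalBasis (Fin n) ℝ V) : volForm hn o b * volForm hn o b = 1 := by
  have : Fact (finrank ℝ V = n) := ⟨hn⟩
  rw [← abs_mul_abs_self, volForm_apply, o.abs_volumeForm_apply_of_orthonormal b, one_mul]

theorem topForm_apply {ι : Type*} [Fintype ι] [DecidableEq ι] (b : OrthonormalBasis ι ℝ V)
    (e : Fin n ≃ ι) (η : V [⋀^Fin n]→L[ℝ] ℝ) (v : Fin n → V) :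
    η v = η (b ∘ e) * (Matrix.of fun i j => ⟪b (e i), v j⟫).det := by
  have h := η.toAlternatingMap.eq_smul_basis_det (b.reindex e.symm).toBasis
  have h2 := congrArg (fun f => f v) h
  simp only [AlternatingMap.smul_apply, smul_eq_mul] at h2
  change η v = _ at h2
  have h3 : η.toAlternatingMap (b.reindex e.symm).toBasis = η (b ∘ e) := by
    change η _ = η _
    congr 1
    ext i : 1
    simp
  rw [h2, h3, Basis.det_apply]
  congr 2
  ext i j
  simp [Basis.toMatrix_apply, OrthonormalBasis.repr_apply_apply]

/-- Under a change of orthonormal basis both factors are multiplied by the same determinant `d`, and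
`d² = 1`. So the auxiliary basis in `topCoeff` may be replaced by an adapted one. -/
theorem topCoeff_eq (hn : finrank ℝ V = n) (o : Orientation ℝ V (Fin n))
    (η : V [⋀^Fin n]→L[ℝ] ℝ) (b : OrthonormalBasis (Fin n) ℝ V) :
    topCoeff hn o η = η b * volForm hn o b := by
  have h1 := topForm_apply (onb hn) (Equiv.refl _) η b
  have h2 := topForm_apply (onb hn) (Equiv.refl _) (volForm hn o) b
  have h3 := volForm_mul_self hn o b
  have h4 := volForm_mul_self hn o (onb hn)
  simp only [Equiv.coe_refl, Function.comp_id, id_eq] at h1 h2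
  rw [topCoeff, h1]
  rw [h2] at h3 ⊢
  set d := (Matrix.of fun i j => ⟪onb hn i, b j⟫).det
  linear_combination (-(η (onb hn)) * volForm hn o (onb hn)) * h3 +
    η (onb hn) * volForm hn o (onb hn) * d * d * h4

/-- `topCoeff` as a linear map. -/
noncomputable def topCoeffₗ (hn : finrank ℝ V = n) (o : Orientation ℝ V (Fin n)) :
    (V [⋀^Fin n]→L[ℝ] ℝ) →ₗ[ℝ] ℝ where
  toFun := topCoeff hn o
  map_add' a b := by simp [topCoeff, add_mul]
  map_smul' c a := by simp [topCoeff, mul_assoc]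

@[simp] theorem topCoeffₗ_apply (hn : finrank ℝ V = n) (o : Orientation ℝ V (Fin n))
    (η : V [⋀^Fin n]→L[ℝ] ℝ) : topCoeffₗ hn o η = topCoeff hn o η := rfl

section Adapted

variable {m : ℕ} (h : k + m = n) (b : OrthonormalBasis (Fin k ⊕ Fin m) ℝ V)

/-- An orthonormal basis indexed by a sum, reindexed. -/
noncomputable def sumBasis : OrthonormalBasis (Fin n) ℝ V :=
  b.reindex (finSumFinEquiv.trans (finCongr h))

theorem wedgeForm_decForm_apply (c : Fin k → V) (d : Fin m → V) (u : Fin k → V) (w : Fin m → V) :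
    wedgeForm h (decForm c) (decForm d)
      (fun q => Sum.elim u w (finSumFinEquiv.symm (Fin.cast h.symm q))) =
    (Matrix.fromBlocks (Matrix.of fun i j => ⟪c i, u j⟫) (Matrix.of fun i j => ⟪c i, w j⟫)
      (Matrix.of fun i j => ⟪d i, u j⟫) (Matrix.of fun i j => ⟪d i, w j⟫)).det := by
  subst h
  rw [decForm_eq_prodForm, decForm_eq_prodForm, wedgeForm_prodForm, prodForm_apply,
    ← Matrix.det_submatrix_equiv_self finSumFinEquiv]
  congr 1
  ext i j
  rcases i with i | i <;> rcases j with j | j <;> simp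

theorem sumBasis_eq : ⇑(sumBasis h b) = fun q => Sum.elim (fun i => b (Sum.inl i))
    (fun i => b (Sum.inr i)) (finSumFinEquiv.symm (Fin.cast h.symm q)) := by
  ext q
  rw [sumBasis, OrthonormalBasis.reindex_apply]
  change b (finSumFinEquiv.symm (Fin.cast h.symm q)) = _
  generalize finSumFinEquiv.symm (Fin.cast h.symm q) = s
  rcases s with s | s <;> rfl

theorem inner_basis {ι : Type*} [Fintype ι] [DecidableEq ι] (b : OrthonormalBasis ι ℝ V) (i j : ι) :
    ⟪b i, b j⟫ = if i = j then 1 else 0 :=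
  (orthonormal_iff_ite.1 b.orthonormal) i j

/-- After expanding `η`, each term is a block triangular Gram determinant whose normal block is the
identity. Multiplying by all normal covectors therefore retains exactly the value of `η` on the
plane. -/
theorem wedgeForm_decForm_inr (η : V [⋀^Fin k]→L[ℝ] ℝ) :
    wedgeForm h η (decForm fun i => b (Sum.inr i)) (sumBasis h b) =
      η fun i => b (Sum.inl i) := by
  rw [eq_sum_decForm b η, ← wedgeFormₗ_apply]
  simp only [map_smul, map_sum, LinearMap.smul_apply, LinearMap.sum_apply, wedgeFormₗ_apply,
    ContinuousAlternatingMap.smul_apply, ContinuousAlternatingMap.sum_apply]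
  congr 1
  refine Finset.sum_congr rfl fun g _ => ?_
  congr 1
  rw [sumBasis_eq, wedgeForm_decForm_apply, decForm_apply]
  have h1 : (Matrix.of fun (i : Fin m) (j : Fin k) => ⟪b (Sum.inr i), b (Sum.inl j)⟫) = 0 := by
    ext i j; simp
  have h2 : (Matrix.of fun (i j : Fin m) => ⟪b (Sum.inr i), b (Sum.inr j)⟫) = 1 := by
    ext i j; simp [inner_basis, Matrix.one_apply]
  rw [h1, h2, Matrix.det_fromBlocks_zero₂₁, Matrix.det_one, mul_one]

theorem wedgeForm_decForm_inl (η : V [⋀^Fin m]→L[ℝ] ℝ) :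
    wedgeForm h (decForm fun i => b (Sum.inl i)) η (sumBasis h b) =
      η fun i => b (Sum.inr i) := by
  rw [eq_sum_decForm b η, ← wedgeFormₗ_apply]
  simp only [map_smul, map_sum, wedgeFormₗ_apply,
    ContinuousAlternatingMap.smul_apply, ContinuousAlternatingMap.sum_apply]
  congr 1
  refine Finset.sum_congr rfl fun g _ => ?_
  congr 1
  rw [sumBasis_eq, wedgeForm_decForm_apply, decForm_apply]
  have h1 : (Matrix.of fun (i : Fin k) (j : Fin m) => ⟪b (Sum.inl i), b (Sum.inr j)⟫) = 0 := by
    ext i j; simp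
  have h2 : (Matrix.of fun (i j : Fin k) => ⟪b (Sum.inl i), b (Sum.inl j)⟫) = 1 := by
    ext i j; simp [inner_basis, Matrix.one_apply]
  rw [h1, h2, Matrix.det_fromBlocks_zero₁₂, Matrix.det_one, one_mul]

/-- By `wedgeForm_decForm_inl`, the coefficients in the definition of the star are the values of the
test forms on the normal vectors, so the sum is the expansion of the normal decomposable form. The
factor is the orientation sign of the adapted basis. -/
theorem hodge_decForm (hn : finrank ℝ V = n) (o : Orientation ℝ V (Fin n)) :
    hodge hn o (pureForm (decForm fun i => b (Sum.inl i))) =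
      volForm hn o (sumBasis h b) • pureForm (decForm fun i => b (Sum.inr i)) := by
  ext1 q
  rw [hodge, Pi.smul_apply]
  by_cases hq : q = m
  · subst hq
    rw [pureForm_self, eq_sum_decForm (onb hn) (decForm fun i => b (Sum.inr i)), smul_comm]
    congr 1
    rw [Finset.smul_sum]
    refine Finset.sum_congr rfl fun g _ => ?_
    rw [smul_smul, pureForm_wedge_apply h, pureForm_self, topCoeff_eq hn o _ (sumBasis h b),
      wedgeForm_decForm_inl, mul_comm, decForm_comm]
  · rw [pureForm_of_ne hq, smul_zero, Finset.sum_eq_zero, smul_zero]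
    intro g _
    rw [wedge_pureForm_pureForm rfl, pureForm_of_ne (by omega), topCoeff]
    simp

/-- Multiplication by the normal covectors is an isometry on forms coming from the plane: the Gram
matrix of the products is block triangular with an identity block. -/
theorem inner_wedgeForm_decForm {ι : Type*} [Fintype ι] [DecidableEq ι]
    (e : OrthonormalBasis ι ℝ V) {q p : ℕ} (hp : q + m = p)
    (g g' : Fin q → Fin k) :
    (p.factorial : ℝ)⁻¹ * ∑ s : Fin p → ι,
      wedgeForm hp (decForm fun i => b (Sum.inl (g i))) (decForm fun i => b (Sum.inr i)) (e ∘ s) *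
      wedgeForm hp (decForm fun i => b (Sum.inl (g' i))) (decForm fun i => b (Sum.inr i)) (e ∘ s) =
    decForm (fun i => b (Sum.inl (g i))) fun i => b (Sum.inl (g' i)) := by
  have h0 : wedgeForm hp (decForm fun i => b (Sum.inl (g' i))) (decForm fun i => b (Sum.inr i)) =
      decForm fun r => Sum.elim (fun i => b (Sum.inl (g' i))) (fun i => b (Sum.inr i))
        (finSumFinEquiv.symm (Fin.cast hp.symm r)) := by
    rw [decForm_eq_prodForm, decForm_eq_prodForm, wedgeForm_prodForm, decForm_eq_prodForm]
    congr 1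
    ext r : 1
    generalize finSumFinEquiv.symm (Fin.cast hp.symm r) = s
    rcases s with s | s <;> rfl
  rw [h0, sum_apply_mul_decForm, wedgeForm_decForm_apply]
  have h1 : (Matrix.of fun (i : Fin m) (j : Fin q) => ⟪b (Sum.inr i), b (Sum.inl (g' j))⟫) = 0 := by
    ext i j; simp
  have h2 : (Matrix.of fun (i j : Fin m) => ⟪b (Sum.inr i), b (Sum.inr j)⟫) = 1 := by
    ext i j; simp [inner_basis, Matrix.one_apply]
  rw [h1, h2, Matrix.det_fromBlocks_zero₂₁, Matrix.det_one, mul_one, decForm_apply]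

end Adapted

/-! ### The pure spinor of an isotropic plane in an adapted basis. -/

namespace IsotropicPlane

variable (P : IsotropicPlane V k)

/-- An orthonormal basis adapted to an isotropic plane. -/
theorem exists_adapted (hn : finrank ℝ V = n) : ∃ (m : ℕ) (_ : k + m = n)
    (b : OrthonormalBasis (Fin k ⊕ Fin m) ℝ V), ∀ i, b (Sum.inl i) = onb P.finrank_eq i := by
  have hL := P.L.finrank_add_finrank_orthogonal
  rw [P.finrank_eq, hn] at hL
  let bP := stdOrthonormalBasis ℝ P.Lᗮ
  let v : Fin k ⊕ Fin (finrank ℝ P.Lᗮ) → V :=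
    Sum.elim (fun i => (onb P.finrank_eq i : V)) (fun i => (bP i : V))
  have hv : Orthonormal ℝ v := by
    rw [orthonormal_iff_ite]
    rintro (i | i) (j | j)
    · simpa [v] using (inner_basis (onb P.finrank_eq) i j)
    · simpa [v] using P.L.inner_right_of_mem_orthogonal (onb P.finrank_eq i).2 (bP j).2
    · simpa [v] using P.L.inner_left_of_mem_orthogonal (onb P.finrank_eq j).2 (bP i).2
    · simpa [v] using (inner_basis bP i j)
  have hc : Fintype.card (Fin k ⊕ Fin (finrank ℝ P.Lᗮ)) = finrank ℝ V := by
    simp [hL, hn]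
  refine ⟨finrank ℝ P.Lᗮ, hL, ?_⟩
  rcases isEmpty_or_nonempty (Fin k ⊕ Fin (finrank ℝ P.Lᗮ)) with he | he
  · have h0 : finrank ℝ V = 0 := by rw [← hc]; exact Fintype.card_eq_zero
    have := finrank_zero_iff.1 h0
    exact ⟨(Basis.empty V).toOrthonormalBasis (by
      rw [orthonormal_iff_ite]; exact fun i => (he.false i).elim),
      fun i => (he.false (Sum.inl i)).elim⟩
  · refine ⟨(basisOfOrthonormalOfCardEqFinrank hv hc).toOrthonormalBasis (by
      rw [coe_basisOfOrthonormalOfCardEqFinrank]; exact hv), fun i => ?_⟩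
    simp [v]

/-- The form `p_L^* F`. -/
noncomputable def projF : V [⋀^Fin 2]→L[ℝ] ℝ :=
  P.F.compContinuousLinearMap P.L.orthogonalProjectionOnto

variable {P} in
theorem vol_eq {m : ℕ} {b : OrthonormalBasis (Fin k ⊕ Fin m) ℝ V}
    (hb : ∀ i, b (Sum.inl i) = onb P.finrank_eq i) :
    P.vol = volForm P.finrank_eq P.orientation (onb P.finrank_eq) •
      decForm fun i => b (Sum.inl i) := by
  ext v
  change volForm P.finrank_eq P.orientation (P.L.orthogonalProjectionOnto ∘ v) = _
  rw [topForm_apply (onb P.finrank_eq) (Equiv.refl _), ContinuousAlternatingMap.smul_apply,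
    decForm_apply]
  simp only [Equiv.coe_refl, Function.comp_id, smul_eq_mul]
  congr 2
  ext i j
  simp [hb]

variable {P} in
-- Both orientations enter only through a scalar factor `±1`. This factor cancels in the product of
-- the pairing with the volume form and disappears in the norm.
theorem tau_eq {m : ℕ} (h : k + m = n) {b : OrthonormalBasis (Fin k ⊕ Fin m) ℝ V}
    (hb : ∀ i, b (Sum.inl i) = onb P.finrank_eq i) (hn : finrank ℝ V = n)
    (o : Orientation ℝ V (Fin n)) :
    P.tau hn o = (volForm P.finrank_eq P.orientation (onb P.finrank_eq) *
      volForm hn o (sumBasis h b)) • (expForm P.projF * hat (pureForm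
        (decForm fun i => b (Sum.inr i)))) := by
  have hh : hodge hn o (pureForm P.vol) = (volForm P.finrank_eq P.orientation (onb P.finrank_eq) *
      volForm hn o (sumBasis h b)) • pureForm (decForm fun i => b (Sum.inr i)) := by
    rw [mul_smul, ← hodge_decForm h b hn o, vol_eq hb]
    generalize volForm P.finrank_eq P.orientation (onb P.finrank_eq) = c
    ext1 q
    simp only [hodge, Pi.smul_apply]
    rw [smul_comm c, Finset.smul_sum (r := c)]
    congr 1
    refine Finset.sum_congr rfl fun g _ => ?_
    rw [smul_smul]
    congr 1
    rw [show pureForm (c • decForm fun i => b (Sum.inl i)) =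
        c • pureForm (decForm fun i => b (Sum.inl i)) from (pureFormₗ k).map_smul _ _]
    have h3 := congrFun (LinearMap.map_smul₂ wedgeₗ c
      (pureForm (decForm fun i => b (Sum.inl i))) (pureForm (decForm (onb hn ∘ g)))) n
    simp only [wedgeₗ_apply, Pi.smul_apply] at h3
    rw [h3, ← topCoeffₗ_apply, map_smul]
    rfl
  rw [tau, hh, ← hatₗ_apply, map_smul, wedge_eq_mul, mul_smul_comm]
  rfl

variable {P} in
theorem topForm_apply_of_mem (η : V [⋀^Fin k]→L[ℝ] ℝ) {m : ℕ}
    {b : OrthonormalBasis (Fin k ⊕ Fin m) ℝ V}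
    (hb : ∀ i, b (Sum.inl i) = onb P.finrank_eq i) (v : Fin k → V) (hv : ∀ i, v i ∈ P.L) :
    η v = η (fun i => b (Sum.inl i)) * decForm (fun i => b (Sum.inl i)) v := by
  have := topForm_apply (onb P.finrank_eq) (Equiv.refl _)
    (η.compContinuousLinearMap P.L.subtypeL) fun i => ⟨v i, hv i⟩
  rw [decForm_apply]
  simp only [hb]
  exact this

/-- The spinor pairing in terms of the restriction of `e^{-F} ∧ ρ` to the plane. -/
theorem pairing_tau_mul_vol (hn : finrank ℝ V = n) (o : Orientation ℝ V (Fin n))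
    (ρ : MixedForm V) (v : Fin k → V) (hv : ∀ i, v i ∈ P.L) :
    pairing hn o ρ (P.tau hn o) * P.vol v = (expForm (-P.projF) * ρ) k v := by
  obtain ⟨m, h, b, hb⟩ := P.exists_adapted hn
  have h1 := volForm_mul_self P.finrank_eq P.orientation (onb P.finrank_eq)
  have h2 := volForm_mul_self hn o (sumBasis h b)
  set s := volForm P.finrank_eq P.orientation (onb P.finrank_eq)
  set t := volForm hn o (sumBasis h b)
  rw [pairing, tau_eq h hb, ← hatₗ_apply, map_smul, hatₗ_apply, hat_expForm_mul, hat_hat,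
    wedge_eq_mul, mul_smul_comm, Pi.smul_apply, ← topCoeffₗ_apply, map_smul, ← mul_assoc,
    ← (commute_expForm (-P.projF) ρ).eq, topCoeffₗ_apply, ← wedge_eq_mul, wedge_pureForm_apply h,
    topCoeff_eq hn o _ (sumBasis h b), wedgeForm_decForm_inr, vol_eq hb,
    topForm_apply_of_mem ((expForm (-P.projF) * ρ) k) hb v hv]
  simp only [smul_eq_mul, ContinuousAlternatingMap.smul_apply]
  set A := (expForm (-P.projF) * ρ) k fun i => b (Sum.inl i)
  set B := (decForm fun i => b (Sum.inl i)) v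
  -- Each orientation sign occurs twice: `s` in the spinor and in the volume form of the plane, `t`
  -- in the spinor and in the top coefficient.
  linear_combination A * B * t * t * h1 + A * B * h2

/-- Multiplication by the normal covectors is isometric, and the orientation and `hat` signs square
to `1`. The norm thus depends only on the metric of the plane and on `F`, which makes it computable
in coordinates of the submanifold. -/
theorem formNorm_tau (hn : finrank ℝ V = n) (o : Orientation ℝ V (Fin n)) :
    formNorm hn (P.tau hn o) = formNorm P.finrank_eq (expForm P.F) := by
  obtain ⟨m, h, b, hb⟩ := P.exists_adapted hn
  have h1 := volForm_mul_self P.finrank_eq P.orientation (onb P.finrank_eq)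
  have h2 := volForm_mul_self hn o (sumBasis h b)
  rw [formNorm, formNorm, tau_eq h hb]
  congr 1
  set s := volForm P.finrank_eq P.orientation (onb P.finrank_eq) * volForm hn o (sumBasis h b)
  have hs : s * s = 1 := by
    simp only [s]
    linear_combination volForm hn o (sumBasis h b) * volForm hn o (sumBasis h b) * h1 + h2
  have hE (q : ℕ) : expForm P.projF q = (q.factorial : ℝ)⁻¹ • ∑ g : Fin q → Fin k,
      expForm P.F q (onb P.finrank_eq ∘ g) • decForm fun i => b (Sum.inl (g i)) := by
    rw [projF, ← pullLin_expForm, pullLin]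
    conv_lhs => rw [eq_sum_decForm (onb P.finrank_eq) (expForm P.F q)]
    ext v
    simp only [ContinuousAlternatingMap.compContinuousLinearMap_apply,
      ContinuousAlternatingMap.smul_apply, ContinuousAlternatingMap.sum_apply]
    congr 1
    refine Finset.sum_congr rfl fun g _ => ?_
    congr 1
    rw [decForm_apply, decForm_apply]
    congr 1
    ext i j
    simp [hb]
  -- Degree `p = q + m` of the spinor comes from degree `q` of `e^F`, the other `m` factors being
  -- normal covectors.
  have hτ (p q : ℕ) (hp : q + m = p) : (p.factorial : ℝ)⁻¹ * ∑ g : Fin p → Fin n,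
      (s • (expForm P.projF * hat (pureForm (decForm fun i => b (Sum.inr i))))) p (onb hn ∘ g) *
      (s • (expForm P.projF * hat (pureForm (decForm fun i => b (Sum.inr i))))) p (onb hn ∘ g) =
      (q.factorial : ℝ)⁻¹ * ∑ g : Fin q → Fin k,
        expForm P.F q (onb P.finrank_eq ∘ g) * expForm P.F q (onb P.finrank_eq ∘ g) := by
    have hhat : hat (pureForm (decForm fun i => b (Sum.inr i))) =
        ((-1 : ℝ) ^ (m * (m + 1) / 2)) • pureForm (decForm fun i => b (Sum.inr i)) := by
      ext1 r
      by_cases hr : r = m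
      · subst hr; rfl
      · rw [hat, Pi.smul_apply, pureForm_of_ne hr, smul_zero, smul_zero]
    set ε : ℝ := (-1 : ℝ) ^ (m * (m + 1) / 2)
    have hε : ε * ε = 1 := by simp only [ε, ← mul_pow]; simp
    have hW : (s • (expForm P.projF * hat (pureForm (decForm fun i => b (Sum.inr i))))) p =
        (s * ε) • (q.factorial : ℝ)⁻¹ • ∑ g : Fin q → Fin k,
          expForm P.F q (onb P.finrank_eq ∘ g) • wedgeForm hp (decForm fun i => b (Sum.inl (g i)))
            (decForm fun i => b (Sum.inr i)) := by
      rw [hhat, mul_smul_comm, smul_smul, Pi.smul_apply, ← wedge_eq_mul, wedge_pureForm_apply hp,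
        hE q, ← wedgeFormₗ_apply]
      simp only [map_smul, map_sum, LinearMap.smul_apply, LinearMap.sum_apply, wedgeFormₗ_apply]
    have hexp (c : Fin q → Fin k) := sum_apply_mul_decForm (onb P.finrank_eq) (expForm P.F q)
      (onb P.finrank_eq ∘ c)
    have hdec (g g' : Fin q → Fin k) : decForm (fun i => b (Sum.inl (g i)))
        (fun i => b (Sum.inl (g' i))) = decForm (onb P.finrank_eq ∘ g') (onb P.finrank_eq ∘ g) := by
      rw [decForm_comm, decForm_apply, decForm_apply]
      congr 1
      ext i j
      simp [hb]
    rw [hW]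
    simp only [ContinuousAlternatingMap.smul_apply, ContinuousAlternatingMap.sum_apply, smul_eq_mul]
    set Q : ℝ := (q.factorial : ℝ)⁻¹
    set E : (Fin q → Fin k) → ℝ := fun g => expForm P.F q (onb P.finrank_eq ∘ g)
    set w : (Fin q → Fin k) → (Fin p → Fin n) → ℝ := fun g r =>
      wedgeForm hp (decForm fun i => b (Sum.inl (g i))) (decForm fun i => b (Sum.inr i)) (onb hn ∘ r)
    have hw (g g') := inner_wedgeForm_decForm b (onb hn) hp g g'
    -- Expanding the square produces Gram determinants of vectors in the plane; the reproducing
    -- property `hexp` then removes one of the two sums.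
    calc (p.factorial : ℝ)⁻¹ * ∑ r, s * ε * (Q * ∑ g, E g * w g r) * (s * ε * (Q * ∑ g, E g * w g r))
        = (s * s) * (ε * ε) * Q * Q * ∑ g, ∑ g', E g * E g' *
            ((p.factorial : ℝ)⁻¹ * ∑ r, w g r * w g' r) := by
          have : ∀ r, s * ε * (Q * ∑ g, E g * w g r) * (s * ε * (Q * ∑ g, E g * w g r)) =
              (s * s) * (ε * ε) * Q * Q * ∑ g, ∑ g', E g * E g' * (w g r * w g' r) := fun r => by
            rw [show s * ε * (Q * ∑ g, E g * w g r) * (s * ε * (Q * ∑ g, E g * w g r)) =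
              (s * s) * (ε * ε) * Q * Q * ((∑ g, E g * w g r) * ∑ g, E g * w g r) by ring,
              Finset.sum_mul_sum]
            congr 1
            refine Finset.sum_congr rfl fun g _ => Finset.sum_congr rfl fun g' _ => by ring
          simp only [this, ← Finset.mul_sum]
          rw [mul_left_comm]
          congr 1
          rw [Finset.sum_comm, Finset.mul_sum]
          refine Finset.sum_congr rfl fun g _ => ?_
          rw [Finset.sum_comm, Finset.mul_sum]
          refine Finset.sum_congr rfl fun g' _ => ?_
          rw [← Finset.mul_sum]
          ring
      _ = Q * ∑ g, E g * (Q * ∑ g', E g' * decForm (onb P.finrank_eq ∘ g)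
            (onb P.finrank_eq ∘ g')) := by
          rw [hs, hε, one_mul, one_mul, mul_assoc]
          congr 1
          rw [Finset.mul_sum]
          refine Finset.sum_congr rfl fun g _ => ?_
          rw [Finset.mul_sum, Finset.mul_sum, Finset.mul_sum]
          refine Finset.sum_congr rfl fun g' _ => ?_
          rw [hw, hdec, decForm_comm (onb P.finrank_eq ∘ g')]
          ring
      _ = Q * ∑ g, E g * E g := by
          congr 1
          exact Finset.sum_congr rfl fun g _ => congrArg (E g * ·) (hexp g)
  have hlow (p : ℕ) (hp : p < m) :
      (s • (expForm P.projF * hat (pureForm (decForm fun i => b (Sum.inr i))))) p = 0 := by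
    have hhat : hat (pureForm (decForm fun i => b (Sum.inr i))) =
        pureForm (((-1 : ℝ) ^ (m * (m + 1) / 2)) • (decForm fun i => b (Sum.inr i))) := by
      ext1 r
      by_cases hr : r = m
      · subst hr; simp only [hat, pureForm_self]
      · rw [hat, pureForm_of_ne hr, pureForm_of_ne hr, smul_zero]
    rw [Pi.smul_apply, hhat, ← wedge_eq_mul, wedge_pureForm_apply_of_lt hp, smul_zero]
  -- The degrees below `m` contribute nothing, and the remaining `k + 1` degrees match those on the
  -- plane.
  rw [formInner, formInner, show n + 1 = m + (k + 1) by omega, Finset.sum_range_add,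
    Finset.sum_eq_zero, zero_add]
  · exact Finset.sum_congr rfl fun q _ => hτ (m + q) q (add_comm q m)
  · intro p hp
    simp only [hlow p (Finset.mem_range.1 hp)]
    simp

end IsotropicPlane

/-- The inner product of forms in terms of an arbitrary basis and the inverse of its Gram matrix. -/
theorem formInner_eq_gram (hn : finrank ℝ V = n) (w : Basis (Fin n) ℝ V) (α β : MixedForm V) :
    formInner hn α β = ∑ p ∈ Finset.range (n + 1), ((p.factorial : ℝ)⁻¹) *
      ∑ h : Fin p → Fin n, ∑ h' : Fin p → Fin n,
        (∏ i, (Matrix.of fun r s => ⟪w r, w s⟫)⁻¹ (h i) (h' i)) * (α p (w ∘ h) * β p (w ∘ h')) := by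
  set e := onb hn
  set A : Matrix (Fin n) (Fin n) ℝ := Matrix.of fun r a => ⟪e a, w r⟫
  set B : Matrix (Fin n) (Fin n) ℝ := Matrix.of fun a r => w.repr (e a) r
  have hBA : B * A = 1 := by
    ext a c
    rw [Matrix.mul_apply, Matrix.one_apply, ← inner_basis e a c, real_inner_comm]
    conv_rhs => rw [← w.sum_repr (e a), inner_sum]
    refine Finset.sum_congr rfl fun r _ => ?_
    rw [real_inner_smul_right]
    rfl
  have hG : (Matrix.of fun r s => ⟪w r, w s⟫) = A * A.transpose := by
    ext r s
    rw [Matrix.mul_apply, Matrix.of_apply, ← e.sum_inner_mul_inner]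
    refine Finset.sum_congr rfl fun a _ => ?_
    rw [real_inner_comm]
    rfl
  -- Since `B` inverts `A`, the factorisation `A Aᵀ` of the Gram matrix inverts to `Bᵀ B`, which is
  -- what appears when the orthonormal basis is expanded in `w` in both arguments.
  have hGi : (Matrix.of fun r s => ⟪w r, w s⟫)⁻¹ = B.transpose * B := by
    rw [hG, Matrix.mul_inv_rev, ← Matrix.transpose_nonsing_inv, Matrix.inv_eq_left_inv hBA]
  have hexp {p : ℕ} (α : V [⋀^Fin p]→L[ℝ] ℝ) (g : Fin p → Fin n) :
      α (e ∘ g) = ∑ h : Fin p → Fin n, (∏ i, B (g i) (h i)) * α (w ∘ h) := by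
    conv_lhs => rw [show e ∘ g = fun i => ∑ r, w.repr (e (g i)) r • w r from
      funext fun i => (w.sum_repr (e (g i))).symm]
    refine (α.toMultilinearMap.map_sum (fun i l => w.repr (e (g i)) l • w l)).trans ?_
    refine Finset.sum_congr rfl fun r _ => ?_
    exact α.toMultilinearMap.map_smul_univ _ _
  change ∑ p ∈ Finset.range (n + 1), ((p.factorial : ℝ)⁻¹) *
    ∑ h : Fin p → Fin n, α p (e ∘ h) * β p (e ∘ h) = _
  refine Finset.sum_congr rfl fun p _ => ?_
  congr 1
  simp only [hexp, Finset.sum_mul_sum]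
  rw [Finset.sum_comm]
  refine Finset.sum_congr rfl fun h _ => ?_
  rw [Finset.sum_comm]
  refine Finset.sum_congr rfl fun h' _ => ?_
  rw [hGi]
  simp only [Matrix.mul_apply, Matrix.transpose_apply]
  rw [Finset.prod_univ_sum, Fintype.piFinset_univ, Finset.sum_mul]
  refine Finset.sum_congr rfl fun g _ => ?_
  rw [Finset.prod_mul_distrib]
  ring

end EuclideanForms

/-! ### Smooth families of forms on a vector space and the derivative of `e^{-F} ∧ σ`. -/

section FormCalculus

variable {E G W : Type*} [NormedAddCommGroup E] [NormedSpace ℝ E] [FiniteDimensional ℝ E]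
  [NormedAddCommGroup W] [NormedSpace ℝ W] [FiniteDimensional ℝ W]
  [NormedAddCommGroup G] [NormedSpace ℝ G] {s : Set G} {x : G} {r : ℕ∞ω} {p : ℕ}

instance finiteDimensional_form (p : ℕ) : FiniteDimensional ℝ (E [⋀^Fin p]→L[ℝ] ℝ) := by
  let f : (E [⋀^Fin p]→L[ℝ] ℝ) →ₗ[ℝ] ((Fin p → Fin (finrank ℝ E)) → ℝ) :=
    { toFun := fun α h => α (finBasis ℝ E ∘ h)
      map_add' := fun _ _ => rfl
      map_smul' := fun _ _ => rfl }
  refine Module.Finite.of_injective f fun α β h => ?_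
  rw [eq_sum_prodForm (sum_coordL_smul (finBasis ℝ E)) α,
    eq_sum_prodForm (sum_coordL_smul (finBasis ℝ E)) β]
  congr 1
  exact Finset.sum_congr rfl fun g _ => by rw [show α _ = β _ from congrFun h g]

/-- A form is a fixed linear combination of its values on basis tuples, so smoothness can be tested
on scalar functions. -/
theorem contDiffWithinAt_form {η : G → E [⋀^Fin p]→L[ℝ] ℝ}
    (h : ∀ v, ContDiffWithinAt ℝ r (fun y => η y v) s x) : ContDiffWithinAt ℝ r η s x := by
  have : η = fun y => (p.factorial : ℝ)⁻¹ • ∑ g : Fin p → Fin (finrank ℝ E),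
      η y (finBasis ℝ E ∘ g) • prodForm (coordL (finBasis ℝ E) ∘ g) :=
    funext fun y => eq_sum_prodForm (sum_coordL_smul (finBasis ℝ E)) (η y)
  rw [this]
  refine ContDiffWithinAt.const_smul _ (ContDiffWithinAt.sum fun g _ => ?_)
  exact (h _).smul contDiffWithinAt_const

/-- Evaluation of forms as a continuous linear map. -/
noncomputable def evalForm (v : Fin p → E) : (E [⋀^Fin p]→L[ℝ] ℝ) →L[ℝ] ℝ :=
  LinearMap.toContinuousLinearMap
    { toFun := fun α => α v, map_add' := fun _ _ => rfl, map_smul' := fun _ _ => rfl }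

theorem form_apply_eq_sum (α : E [⋀^Fin p]→L[ℝ] ℝ) (w : Fin p → E) :
    α w = ∑ h : Fin p → Fin (finrank ℝ E),
      (∏ i, coordL (finBasis ℝ E) (h i) (w i)) * α (finBasis ℝ E ∘ h) := by
  conv_lhs => rw [show w = fun i => ∑ l, coordL (finBasis ℝ E) l (w i) • finBasis ℝ E l from
    funext fun i => (sum_coordL_smul (finBasis ℝ E) (w i)).symm]
  refine (α.toMultilinearMap.map_sum
    (fun i l => coordL (finBasis ℝ E) l (w i) • finBasis ℝ E l)).trans ?_
  refine Finset.sum_congr rfl fun r _ => ?_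
  exact α.toMultilinearMap.map_smul_univ _ _

theorem _root_.ContDiffWithinAt.form_apply {η : G → E [⋀^Fin p]→L[ℝ] ℝ} {v : G → Fin p → E}
    (hη : ContDiffWithinAt ℝ r η s x) (hv : ∀ i, ContDiffWithinAt ℝ r (fun y => v y i) s x) :
    ContDiffWithinAt ℝ r (fun y => η y (v y)) s x := by
  rw [show (fun y => η y (v y)) = _ from funext fun y => form_apply_eq_sum (η y) (v y)]
  refine ContDiffWithinAt.sum fun h _ => ContDiffWithinAt.mul ?_ ?_
  · exact contDiffWithinAt_prod fun i _ => (coordL _ _).contDiff.comp_contDiffWithinAt (hv i)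
  · exact (evalForm _).contDiff.comp_contDiffWithinAt hη

theorem _root_.ContDiffWithinAt.form_comp {η : G → E [⋀^Fin p]→L[ℝ] ℝ} {f : G → W →L[ℝ] E}
    (hη : ContDiffWithinAt ℝ r η s x) (hf : ContDiffWithinAt ℝ r f s x) :
    ContDiffWithinAt ℝ r (fun y => (η y).compContinuousLinearMap (f y)) s x :=
  contDiffWithinAt_form fun _ => hη.form_apply fun _ => hf.clm_apply contDiffWithinAt_const

/-- The wedge product as a continuous bilinear map. -/
noncomputable def wedgeFormL {i j p : ℕ} (h : i + j = p) :
    (E [⋀^Fin i]→L[ℝ] ℝ) →L[ℝ] (E [⋀^Fin j]→L[ℝ] ℝ) →L[ℝ] E [⋀^Fin p]→L[ℝ] ℝ :=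
  LinearMap.toContinuousBilinearMap (wedgeFormₗ h)

@[simp] theorem wedgeFormL_apply {i j p : ℕ} (h : i + j = p)
    (a : E [⋀^Fin i]→L[ℝ] ℝ) (b : E [⋀^Fin j]→L[ℝ] ℝ) :
    wedgeFormL h a b = wedgeForm h a b := rfl

theorem _root_.ContDiffWithinAt.wedgeForm {i j : ℕ} (h : i + j = p) {α : G → E [⋀^Fin i]→L[ℝ] ℝ}
    {β : G → E [⋀^Fin j]→L[ℝ] ℝ} (hα : ContDiffWithinAt ℝ r α s x)
    (hβ : ContDiffWithinAt ℝ r β s x) :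
    ContDiffWithinAt ℝ r (fun y => wedgeForm h (α y) (β y)) s x := by
  have hc : ContDiff ℝ r (wedgeFormL (E := E) h) := ContinuousLinearMap.contDiff
    (F := (E [⋀^Fin j]→L[ℝ] ℝ) →L[ℝ] E [⋀^Fin p]→L[ℝ] ℝ) _
  exact ContDiffWithinAt.clm_apply (f := fun y => wedgeFormL (E := E) h (α y))
    (hc.comp_contDiffWithinAt hα) hβ

/-- Smoothness of families of mixed forms. -/
def MixedContDiffWithinAt (r : ℕ∞ω) (f : G → MixedForm E) (s : Set G) (x : G) : Prop :=
  ∀ p, ContDiffWithinAt ℝ r (fun y => f y p) s x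

theorem MixedContDiffWithinAt.mul {f g : G → MixedForm E} (hf : MixedContDiffWithinAt r f s x)
    (hg : MixedContDiffWithinAt r g s x) : MixedContDiffWithinAt r (fun y => f y * g y) s x := by
  intro p
  simp only [← wedge_eq_mul, wedge]
  exact ContDiffWithinAt.sum fun i _ => (hf _).wedgeForm _ (hg _)

theorem MixedContDiffWithinAt.smul {f : G → MixedForm E} {c : G → ℝ}
    (hc : ContDiffWithinAt ℝ r c s x)
    (hf : MixedContDiffWithinAt r f s x) : MixedContDiffWithinAt r (fun y => c y • f y) s x :=
  fun p => hc.smul (hf p)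

theorem mixedContDiffWithinAt_const (α : MixedForm E) :
    MixedContDiffWithinAt r (fun _ : G => α) s x := fun _ => contDiffWithinAt_const

theorem MixedContDiffWithinAt.pow {f : G → MixedForm E} (hf : MixedContDiffWithinAt r f s x)
    (m : ℕ) : MixedContDiffWithinAt r (fun y => f y ^ m) s x := by
  induction m with
  | zero => simpa using mixedContDiffWithinAt_const 1
  | succ m ih => simpa only [pow_succ] using ih.mul hf

theorem mixedContDiffWithinAt_pureForm {α : G → E [⋀^Fin p]→L[ℝ] ℝ}
    (hα : ContDiffWithinAt ℝ r α s x) : MixedContDiffWithinAt r (fun y => pureForm (α y)) s x := by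
  intro q
  by_cases h : q = p
  · subst h; simpa only [pureForm_self] using hα
  · simpa only [pureForm_of_ne h] using contDiffWithinAt_const

theorem mixedContDiffWithinAt_expForm {F : G → E [⋀^Fin 2]→L[ℝ] ℝ}
    (hF : ContDiffWithinAt ℝ r F s x) : MixedContDiffWithinAt r (fun y => expForm (F y)) s x := by
  intro q
  simp only [expForm_eq_sum (Nat.lt_succ_self _), Finset.sum_apply, Pi.smul_apply]
  refine ContDiffWithinAt.sum fun m _ => ?_
  have h := (mixedContDiffWithinAt_pureForm hF).pow m q
  exact h.const_smul ((m.factorial : ℝ)⁻¹)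

theorem MixedContDiffWithinAt.pullLin {f : G → MixedForm E} {φ : G → W →L[ℝ] E}
    (hf : MixedContDiffWithinAt r f s x) (hφ : ContDiffWithinAt ℝ r φ s x) :
    MixedContDiffWithinAt r (fun y => pullLin (φ y) (f y)) s x := fun p => (hf p).form_comp hφ

/-! ### Directional derivatives and the exterior derivative -/

/-- Componentwise differentiability of families of mixed forms. -/
def MixedDifferentiableWithinAt (f : G → MixedForm E) (s : Set G) (x : G) : Prop :=
  ∀ p, DifferentiableWithinAt ℝ (fun y => f y p) s x

/-- The componentwise directional derivative. -/
noncomputable def mixedDeriv (f : G → MixedForm E) (s : Set G) (x v : G) : MixedForm E :=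
  fun p => fderivWithin ℝ (fun y => f y p) s x v

theorem mixedDeriv_pureForm {α : G → E [⋀^Fin p]→L[ℝ] ℝ} (v : G) :
    mixedDeriv (fun y => pureForm (α y)) s x v = pureForm (fderivWithin ℝ α s x v) := by
  ext1 q
  by_cases h : q = p
  · subst h; simp only [mixedDeriv, pureForm_self]
  · simp [mixedDeriv, pureForm_of_ne h]

theorem hasFDerivWithinAt_mul {f g : G → MixedForm E} (hf : MixedDifferentiableWithinAt f s x)
    (hg : MixedDifferentiableWithinAt g s x) (p : ℕ) :
    HasFDerivWithinAt (fun y => (f y * g y) p) (∑ i : Fin (p + 1),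
      (((wedgeFormL (show (i : ℕ) + (p - i) = p by omega)).precompR G (f x i))
        (fderivWithin ℝ (fun y => g y (p - i)) s x) +
      ((wedgeFormL (show (i : ℕ) + (p - i) = p by omega)).precompL G
        (fderivWithin ℝ (fun y => f y i) s x)) (g x (p - i)))) s x := by
  simp only [← wedge_eq_mul, wedge]
  refine HasFDerivWithinAt.fun_sum fun i _ => ?_
  exact (wedgeFormL _).hasFDerivWithinAt_of_bilinear (hf _).hasFDerivWithinAt
    (hg _).hasFDerivWithinAt

theorem MixedDifferentiableWithinAt.mul {f g : G → MixedForm E}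
    (hf : MixedDifferentiableWithinAt f s x) (hg : MixedDifferentiableWithinAt g s x) :
    MixedDifferentiableWithinAt (fun y => f y * g y) s x :=
  fun p => (hasFDerivWithinAt_mul hf hg p).differentiableWithinAt

theorem mixedDeriv_mul {f g : G → MixedForm E} (hf : MixedDifferentiableWithinAt f s x)
    (hg : MixedDifferentiableWithinAt g s x) (hs : UniqueDiffWithinAt ℝ s x) (v : G) :
    mixedDeriv (fun y => f y * g y) s x v =
      mixedDeriv f s x v * g x + f x * mixedDeriv g s x v := by
  ext1 p
  rw [mixedDeriv, (hasFDerivWithinAt_mul hf hg p).fderivWithin hs, Pi.add_apply]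
  simp only [← wedge_eq_mul, wedge, sum_apply, add_apply,
    ContinuousLinearMap.precompR_apply, ContinuousLinearMap.precompL_apply, wedgeFormL_apply,
    Finset.sum_add_distrib]
  rw [add_comm]
  rfl

theorem mixedDifferentiableWithinAt_const (α : MixedForm E) :
    MixedDifferentiableWithinAt (fun _ : G => α) s x := fun _ => differentiableWithinAt_const _

theorem MixedDifferentiableWithinAt.pow {f : G → MixedForm E}
    (hf : MixedDifferentiableWithinAt f s x) (m : ℕ) :
    MixedDifferentiableWithinAt (fun y => f y ^ m) s x := by
  induction m with
  | zero => simpa using mixedDifferentiableWithinAt_const 1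
  | succ m ih => simpa only [pow_succ] using ih.mul hf

theorem mixedDifferentiableWithinAt_pureForm {α : G → E [⋀^Fin p]→L[ℝ] ℝ}
    (hα : DifferentiableWithinAt ℝ α s x) :
    MixedDifferentiableWithinAt (fun y => pureForm (α y)) s x := by
  intro q
  by_cases h : q = p
  · subst h; simpa only [pureForm_self] using hα
  · simpa only [pureForm_of_ne h] using differentiableWithinAt_const _

/-- Two-forms are central, so the power rule holds as for commuting variables. -/
theorem mixedDeriv_pow_two {F : G → E [⋀^Fin 2]→L[ℝ] ℝ} (hF : DifferentiableWithinAt ℝ F s x)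
    (hs : UniqueDiffWithinAt ℝ s x) (v : G) (m : ℕ) :
    mixedDeriv (fun y => pureForm (F y) ^ (m + 1)) s x v =
      ((m + 1 : ℕ) : ℝ) • (pureForm (fderivWithin ℝ F s x v) * pureForm (F x) ^ m) := by
  induction m with
  | zero => simp [mixedDeriv_pureForm]
  | succ m ih =>
    simp only [pow_succ _ (m + 1)]
    rw [mixedDeriv_mul ((mixedDifferentiableWithinAt_pureForm hF).pow _)
      (mixedDifferentiableWithinAt_pureForm hF) hs, ih, mixedDeriv_pureForm,
      ← (commute_pureForm_two (fderivWithin ℝ F s x v) (pureForm (F x) ^ (m + 1))).eq,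
      smul_mul_assoc, mul_assoc, ← pow_succ]
    rw [show ((m + 1 + 1 : ℕ) : ℝ) = ((m + 1 : ℕ) : ℝ) + 1 by push_cast; ring, add_smul, one_smul]

theorem mixedDifferentiableWithinAt_expForm {F : G → E [⋀^Fin 2]→L[ℝ] ℝ}
    (hF : DifferentiableWithinAt ℝ F s x) :
    MixedDifferentiableWithinAt (fun y => expForm (F y)) s x := by
  intro q
  simp only [expForm_eq_sum (Nat.lt_succ_self _), Finset.sum_apply, Pi.smul_apply]
  refine DifferentiableWithinAt.fun_sum fun m _ => ?_
  have h := (mixedDifferentiableWithinAt_pureForm hF).pow m q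
  exact h.const_smul ((m.factorial : ℝ)⁻¹)

theorem mixedDeriv_expForm {F : G → E [⋀^Fin 2]→L[ℝ] ℝ} (hF : DifferentiableWithinAt ℝ F s x)
    (hs : UniqueDiffWithinAt ℝ s x) (v : G) :
    mixedDeriv (fun y => expForm (F y)) s x v =
      pureForm (fderivWithin ℝ F s x v) * expForm (F x) := by
  -- One term more than necessary: differentiation kills the constant term and shifts the index, and
  -- the remaining `finrank ℝ E + 1` terms are again the whole exponential.
  have h1 : mixedDeriv (fun y => expForm (F y)) s x v = ∑ m ∈ Finset.range (finrank ℝ E + 2),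
      ((m.factorial : ℝ)⁻¹) • mixedDeriv (fun y => pureForm (F y) ^ m) s x v := by
    ext1 q
    have hd (m : ℕ) : DifferentiableWithinAt ℝ (fun y => (pureForm (F y) ^ m) q) s x :=
      (mixedDifferentiableWithinAt_pureForm hF).pow m q
    have he : (fun y => expForm (F y) q) = fun y => ∑ m ∈ Finset.range (finrank ℝ E + 2),
        ((m.factorial : ℝ)⁻¹) • (pureForm (F y) ^ m) q := funext fun y => by
      rw [expForm_eq_sum (V := E) (N := finrank ℝ E + 2) (by omega), Finset.sum_apply]
      rfl
    have hsum := fderivWithin_fun_sum (u := Finset.range (finrank ℝ E + 2)) hs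
      fun m _ => (hd m).const_smul ((m.factorial : ℝ)⁻¹)
    simp only [Pi.smul_apply] at hsum
    rw [mixedDeriv, he]
    erw [hsum]
    rw [sum_apply, Finset.sum_apply]
    refine Finset.sum_congr rfl fun m _ => ?_
    rw [fderivWithin_const_smul hs (hd m)]
    rfl
  rw [h1, Finset.sum_range_succ', expForm_eq_sum (V := E) (N := finrank ℝ E + 1) (by omega), Finset.mul_sum]
  have h0 : mixedDeriv (fun y => pureForm (F y) ^ 0) s x v = 0 := by
    ext1 q
    simp [mixedDeriv]
  rw [h0, smul_zero, add_zero]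
  refine Finset.sum_congr rfl fun m _ => ?_
  rw [mixedDeriv_pow_two hF hs, smul_smul, mul_smul_comm, Nat.factorial_succ]
  congr 1
  have h3 : (m.factorial : ℝ) ≠ 0 := by positivity
  have h4 : ((m + 1 : ℕ) : ℝ) ≠ 0 := by positivity
  push_cast at h4 ⊢
  field_simp

/-- The exterior derivative of families of mixed forms. -/
noncomputable def mixedExtDeriv (f : E → MixedForm E) (s : Set E) (x : E) : MixedForm E
  | 0 => 0
  | q + 1 => extDerivWithin (fun y => f y q) s x

/-- Laplace expansion along the first row, once `β` is decomposed. It has the alternating shape of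
`extDerivWithin`. -/
theorem wedgeForm_covector_apply (h : 1 + p = p + 1) (θ : E →L[ℝ] ℝ) (β : E [⋀^Fin p]→L[ℝ] ℝ)
    (v : Fin (p + 1) → E) :
    wedgeForm h (prodForm fun _ : Fin 1 => θ) β v =
      ∑ j : Fin (p + 1), (-1 : ℝ) ^ (j : ℕ) * θ (v j) * β (j.removeNth v) := by
  rw [eq_sum_prodForm (sum_coordL_smul (finBasis ℝ E)) β, ← wedgeFormₗ_apply]
  simp only [map_smul, map_sum, ContinuousAlternatingMap.smul_apply, wedgeFormₗ_apply,
    ContinuousAlternatingMap.sum_apply, smul_eq_mul]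
  simp only [Finset.mul_sum]
  rw [Finset.sum_comm]
  refine Finset.sum_congr rfl fun g _ => ?_
  have h1 : wedgeForm h (prodForm fun _ : Fin 1 => θ)
      (prodForm (coordL (finBasis ℝ E) ∘ g)) = prodForm (Fin.cons θ (coordL (finBasis ℝ E) ∘ g)
        : Fin (p + 1) → E →L[ℝ] ℝ) := by
    have := congrFun (oneForm_mul_prodForm θ (coordL (finBasis ℝ E) ∘ g)) (p + 1)
    rwa [oneForm, ← wedge_eq_mul, pureForm_wedge_apply h, pureForm_self, pureForm_self] at this
  rw [h1, prodForm_apply, Matrix.det_succ_row_zero, Finset.mul_sum, Finset.mul_sum]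
  refine Finset.sum_congr rfl fun j _ => ?_
  rw [prodForm_apply]
  simp only [Matrix.of_apply, Fin.cons_zero]
  rw [show (Matrix.submatrix _ _ _ : Matrix (Fin p) (Fin p) ℝ) =
    Matrix.of fun i l => (coordL (finBasis ℝ E) ∘ g) i (j.removeNth v l) from ?_]
  · ring
  · ext i l
    rfl

/-- The formula `d = ∑ e^i ∧ ∂_i` reduces product rules for `d` to those for directional
derivatives, where no signs depend on the degree. -/
theorem mixedExtDeriv_eq_sum (f : E → MixedForm E) (s : Set E) (x : E) :
    mixedExtDeriv f s x = ∑ i, oneForm (coordL (finBasis ℝ E) i) *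
      mixedDeriv f s x (finBasis ℝ E i) := by
  ext1 q
  rw [Finset.sum_apply]
  match q with
  | 0 =>
    rw [mixedExtDeriv, Finset.sum_eq_zero]
    intro i _
    rw [oneForm, ← wedge_eq_mul, pureForm_wedge_apply_of_lt (by omega)]
  | q + 1 =>
    ext v
    rw [mixedExtDeriv, ContinuousAlternatingMap.sum_apply, extDerivWithin,
      ContinuousAlternatingMap.alternatizeUncurryFin_apply]
    simp only [oneForm, ← wedge_eq_mul, pureForm_wedge_apply (add_comm 1 q),
      wedgeForm_covector_apply]
    conv_rhs => rw [Finset.sum_comm]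
    refine Finset.sum_congr rfl fun j _ => ?_
    conv_lhs => rw [← sum_coordL_smul (finBasis ℝ E) (v j)]
    simp only [map_sum, map_smul, ContinuousAlternatingMap.sum_apply,
      ContinuousAlternatingMap.smul_apply, mixedDeriv, smul_eq_mul, zsmul_eq_mul,
      Int.cast_pow, Int.cast_neg, Int.cast_one, Finset.mul_sum]
    refine Finset.sum_congr rfl fun i _ => ?_
    simp [mul_assoc]

theorem pureForm_extDerivWithin {α : E → E [⋀^Fin p]→L[ℝ] ℝ} {s : Set E} {x : E} :
    pureForm (extDerivWithin α s x) = mixedExtDeriv (fun y => pureForm (α y)) s x := by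
  ext1 q
  by_cases h : q = p + 1
  · subst h; simp only [pureForm_self, mixedExtDeriv]
  · rw [pureForm_of_ne h]
    match q with
    | 0 => rfl
    | q + 1 =>
      simp only [mixedExtDeriv, pureForm_of_ne (show q ≠ p by omega)]
      ext v
      simp [extDerivWithin, ContinuousAlternatingMap.alternatizeUncurryFin_apply]

theorem mul_neg_mul_add_mul_of_commute {R : Type*} [Ring R] {X e A : R} (h1 : X * e = e * X)
    (h2 : X * A = A * X) (a d : R) : e * (-A * X * a + X * d) = X * (e * d - e * A * a) := by
  rw [neg_mul, ← h2, neg_mul, mul_add, mul_neg, mul_assoc X, ← mul_assoc e, ← h1, ← mul_assoc e X,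
    ← h1, mul_sub, mul_assoc, mul_assoc, mul_assoc]
  abel

/-- In each direction `e^{-F}` is differentiated as a commuting exponential, and being central it
can then be moved in front of the basis covector. With `dF = -H` the bracket becomes `d_H σ`. -/
theorem mixedExtDeriv_expForm_neg_mul {F : E → E [⋀^Fin 2]→L[ℝ] ℝ} {σ : E → MixedForm E}
    {s : Set E} {x : E} (hF : DifferentiableWithinAt ℝ F s x)
    (hσ : MixedDifferentiableWithinAt σ s x) (hs : UniqueDiffWithinAt ℝ s x) :
    mixedExtDeriv (fun y => expForm (-F y) * σ y) s x = expForm (-F x) *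
      (mixedExtDeriv σ s x - pureForm (extDerivWithin F s x) * σ x) := by
  rw [pureForm_extDerivWithin, mixedExtDeriv_eq_sum, mixedExtDeriv_eq_sum, mixedExtDeriv_eq_sum,
    Finset.sum_mul, ← Finset.sum_sub_distrib, Finset.mul_sum]
  refine Finset.sum_congr rfl fun i _ => ?_
  set e := oneForm (coordL (finBasis ℝ E) i)
  rw [mixedDeriv_mul (f := fun y => expForm (-F y))
      (mixedDifferentiableWithinAt_expForm hF.fun_neg) hσ hs,
    mixedDeriv_expForm hF.fun_neg hs, mixedDeriv_pureForm,
    show fderivWithin ℝ (fun y => -F y) s x = -fderivWithin ℝ F s x from fderivWithin_fun_neg hs,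
    show pureForm ((-fderivWithin ℝ F s x) (finBasis ℝ E i)) =
      -pureForm (fderivWithin ℝ F s x (finBasis ℝ E i)) from (pureFormₗ 2).map_neg _]
  set A := pureForm (fderivWithin ℝ F s x (finBasis ℝ E i))
  have h1 := (commute_expForm (-F x) e).eq
  have h2 := (commute_expForm (-F x) A).eq
  exact mul_neg_mul_add_mul_of_commute h1 h2 _ _

end FormCalculus

/-! ### Differential forms in charts: changes of chart, pull-back, naturality of `d`. -/

section ManifoldForms

variable {E H : Type*} [NormedAddCommGroup E] [NormedSpace ℝ E] [FiniteDimensional ℝ E]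
  [TopologicalSpace H]
  {I : ModelWithCorners ℝ E H} {X : Type*} [TopologicalSpace X] [ChartedSpace H X]
  [IsManifold I ∞ X]
  {E' H' : Type*} [NormedAddCommGroup E'] [NormedSpace ℝ E'] [FiniteDimensional ℝ E']
  [TopologicalSpace H']
  {I' : ModelWithCorners ℝ E' H'} {Y : Type*} [TopologicalSpace Y] [ChartedSpace H' Y]
  [IsManifold I' ∞ Y]

variable (I) in
/-- The differential of the inverse of a chart. -/
noncomputable def chartInv (c : X) (y : E) : E →L[ℝ] TangentSpace I ((extChartAt I c).symm y) :=
  mfderivWithin 𝓘(ℝ, E) I (extChartAt I c).symm (Set.range I) y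

variable (I) in
/-- The differential of a chart. -/
noncomputable def chartDeriv (c x : X) : TangentSpace I x →L[ℝ] E :=
  mfderiv I 𝓘(ℝ, E) (extChartAt I c) x

theorem DForm.inChart_def {p : ℕ} (η : DForm I X p) (c : X) (y : E) :
    η.inChart c y = (η ((extChartAt I c).symm y)).compContinuousLinearMap (chartInv I c y) := rfl

theorem DForm.inChart_apply {p : ℕ} (η : DForm I X p) (c : X) (y : E) (v : Fin p → E) :
    η.inChart c y v = η ((extChartAt I c).symm y) fun i => chartInv I c y (v i) := rfl

theorem chartInv_comp_chartDeriv {c : X} {y : E} (hy : y ∈ (extChartAt I c).target) :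
    (chartInv I c y).comp (chartDeriv I c ((extChartAt I c).symm y)) =
      ContinuousLinearMap.id ℝ (TangentSpace I ((extChartAt I c).symm y)) :=
  mfderivWithin_extChartAt_symm_comp_mfderiv_extChartAt hy

theorem chartDeriv_comp_chartInv {c : X} {y : E} (hy : y ∈ (extChartAt I c).target) :
    (chartDeriv I c ((extChartAt I c).symm y)).comp (chartInv I c y) =
      ContinuousLinearMap.id ℝ E :=
  mfderiv_extChartAt_comp_mfderivWithin_extChartAt_symm hy

theorem chartInv_chartDeriv_apply {c : X} {y : E} (hy : y ∈ (extChartAt I c).target)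
    (v : TangentSpace I ((extChartAt I c).symm y)) :
    chartInv I c y (chartDeriv I c ((extChartAt I c).symm y) v) = v :=
  congrArg (fun f => f v) (chartInv_comp_chartDeriv hy)

theorem chartDeriv_chartInv_apply {c : X} {y : E} (hy : y ∈ (extChartAt I c).target) (v : E) :
    chartDeriv I c ((extChartAt I c).symm y) (chartInv I c y v) = v :=
  congrArg (fun f => f v) (chartDeriv_comp_chartInv hy)

theorem eq_inChart_comp_chartDeriv_symm {p : ℕ} (η : DForm I X p) {c : X} {y : E}
    (hy : y ∈ (extChartAt I c).target) : η ((extChartAt I c).symm y) =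
      (η.inChart c y).compContinuousLinearMap (chartDeriv I c ((extChartAt I c).symm y)) := by
  ext v
  simp only [ContinuousAlternatingMap.compContinuousLinearMap_apply, DForm.inChart_apply]
  congr 1
  ext i
  exact (chartInv_chartDeriv_apply hy (v i)).symm

theorem eq_inChart_comp_chartDeriv {p : ℕ} (η : DForm I X p) {c x : X}
    (hx : x ∈ (extChartAt I c).source) : η x =
      (η.inChart c (extChartAt I c x)).compContinuousLinearMap (chartDeriv I c x) := by
  obtain ⟨y, hy, rfl⟩ : ∃ y ∈ (extChartAt I c).target, (extChartAt I c).symm y = x :=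
    ⟨_, (extChartAt I c).map_source hx, (extChartAt I c).left_inv hx⟩
  rw [(extChartAt I c).right_inv hy]
  exact eq_inChart_comp_chartDeriv_symm η hy

variable (I I') in
/-- A map in the coordinates of two charts. -/
noncomputable def written (f : X → Y) (c : X) (c' : Y) (y : E) : E' :=
  extChartAt I' c' (f ((extChartAt I c).symm y))

theorem hasFDerivWithinAt_written {f : X → Y} {c : X} {c' : Y} {y : E}
    (hy : y ∈ (extChartAt I c).target) (hf : MDifferentiableAt I I' f ((extChartAt I c).symm y))
    (hc' : f ((extChartAt I c).symm y) ∈ (extChartAt I' c').source) :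
    HasFDerivWithinAt (written I I' f c c') ((chartDeriv I' c' (f ((extChartAt I c).symm y))).comp
      ((mfderiv I I' f ((extChartAt I c).symm y)).comp (chartInv I c y))) (Set.range I) y := by
  have h1 := (mdifferentiableWithinAt_extChartAt_symm hy).hasMFDerivWithinAt
  have h2 := hf.hasMFDerivAt.comp_hasMFDerivWithinAt y h1
  have h3 := ((mdifferentiableAt_extChartAt (I := I') (by simpa using hc')).hasMFDerivAt).comp_hasMFDerivWithinAt y h2
  exact h3.hasFDerivWithinAt

theorem uniqueDiffWithinAt_range {c : X} {y : E} (hy : y ∈ (extChartAt I c).target) :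
    UniqueDiffWithinAt ℝ (Set.range I) y :=
  I.uniqueDiffOn y (extChartAt_target_subset_range c hy)

theorem fderivWithin_written {f : X → Y} {c : X} {c' : Y} {y : E}
    (hy : y ∈ (extChartAt I c).target) (hf : MDifferentiableAt I I' f ((extChartAt I c).symm y))
    (hc' : f ((extChartAt I c).symm y) ∈ (extChartAt I' c').source) :
    fderivWithin ℝ (written I I' f c c') (Set.range I) y =
      (chartDeriv I' c' (f ((extChartAt I c).symm y))).comp
      ((mfderiv I I' f ((extChartAt I c).symm y)).comp (chartInv I c y)) :=
  (hasFDerivWithinAt_written hy hf hc').fderivWithin (uniqueDiffWithinAt_range hy)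

theorem inChart_pull {p : ℕ} (η : DForm I' Y p) {f : X → Y} {c : X} {c' : Y} {y : E}
    (hy : y ∈ (extChartAt I c).target) (hf : MDifferentiableAt I I' f ((extChartAt I c).symm y))
    (hc' : f ((extChartAt I c).symm y) ∈ (extChartAt I' c').source) :
    (η.pull (I := I) f).inChart c y = (η.inChart c' (written I I' f c c' y)).compContinuousLinearMap
      (fderivWithin ℝ (written I I' f c c') (Set.range I) y) := by
  rw [fderivWithin_written hy hf hc']
  have h := eq_inChart_comp_chartDeriv η hc'
  ext v
  change η (f ((extChartAt I c).symm y)) _ = _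
  rw [h]
  rfl

/-- With this, a change of chart is the pull-back along `id` written in two charts, so the lemmas on
pull-backs also settle independence of the chart. -/
theorem pull_id {p : ℕ} (η : DForm I X p) : η.pull (I := I) id = η := by
  funext x
  ext v
  simp [DForm.pull]

theorem eventually_mem_target {f : X → Y} (hf : Continuous f) {c : X} {c' : Y} {y : E}
    (hy : y ∈ (extChartAt I c).target)
    (hc' : f ((extChartAt I c).symm y) ∈ (extChartAt I' c').source) :
    ∀ᶠ z in 𝓝[Set.range I] y, z ∈ (extChartAt I c).target ∧
      f ((extChartAt I c).symm z) ∈ (extChartAt I' c').source := by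
  refine Filter.Eventually.and (extChartAt_target_mem_nhdsWithin_of_mem hy) ?_
  have h1 : ContinuousWithinAt (fun z => f ((extChartAt I c).symm z)) (Set.range I) y :=
    hf.continuousAt.comp_continuousWithinAt
      ((continuousOn_extChartAt_symm c).continuousWithinAt hy |>.mono_of_mem_nhdsWithin
        (extChartAt_target_mem_nhdsWithin_of_mem hy))
  exact h1 ((isOpen_extChartAt_source c').mem_nhds hc')

theorem contDiffWithinAt_written {f : X → Y} (hf : ContMDiff I I' ∞ f) {c : X} {c' : Y} {y : E}
    (hy : y ∈ (extChartAt I c).target)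
    (hc' : f ((extChartAt I c).symm y) ∈ (extChartAt I' c').source) :
    ContDiffWithinAt ℝ ∞ (written I I' f c c') (Set.range I) y := by
  rw [← contMDiffWithinAt_iff_contDiffWithinAt]
  have h1 : ContMDiffWithinAt 𝓘(ℝ, E) I ∞ (extChartAt I c).symm (Set.range I) y :=
    contMDiffWithinAt_extChartAt_symm_range c hy
  have h2 := (hf ((extChartAt I c).symm y)).comp_contMDiffWithinAt y h1
  exact (contMDiffAt_extChartAt' (I := I') (n := ∞) (by simpa using hc')).comp_contMDiffWithinAt y h2

theorem eventuallyEq_inChart_pull {p : ℕ} (η : DForm I' Y p) {f : X → Y} (hf : ContMDiff I I' ∞ f)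
    {c : X} {c' : Y} {y : E} (hy : y ∈ (extChartAt I c).target)
    (hc' : f ((extChartAt I c).symm y) ∈ (extChartAt I' c').source) :
    (η.pull (I := I) f).inChart c =ᶠ[𝓝[Set.range I] y] fun z =>
      (η.inChart c' (written I I' f c c' z)).compContinuousLinearMap
      (fderivWithin ℝ (written I I' f c c') (Set.range I) z) := by
  filter_upwards [eventually_mem_target hf.continuous hy hc'] with z hz
  exact inChart_pull η hz.1 (hf.mdifferentiable (by simp) _) hz.2

theorem contDiffWithinAt_inChart_pull {p : ℕ} {η : DForm I' Y p} {f : X → Y}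
    (hf : ContMDiff I I' ∞ f)
    {c : X} {c' : Y} {y : E} (hy : y ∈ (extChartAt I c).target)
    (hc' : f ((extChartAt I c).symm y) ∈ (extChartAt I' c').source)
    (hη : ContDiffWithinAt ℝ ∞ (η.inChart c') (Set.range I') (written I I' f c c' y)) :
    ContDiffWithinAt ℝ ∞ ((η.pull (I := I) f).inChart c) (Set.range I) y := by
  have hw := contDiffWithinAt_written hf hy hc'
  refine ContDiffWithinAt.congr_of_eventuallyEq_of_mem ?_ (eventuallyEq_inChart_pull η hf hy hc')
    (extChartAt_target_subset_range c hy)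
  refine ContDiffWithinAt.form_comp ?_ (hw.fderivWithin_right I.uniqueDiffOn (by simp)
    (extChartAt_target_subset_range c hy))
  refine hη.comp_of_preimage_mem_nhdsWithin y hw ?_
  filter_upwards [eventually_mem_target hf.continuous hy hc'] with z hz
  exact extChartAt_target_subset_range c' ((extChartAt I' c').map_source hz.2)

/-- `SmoothAt` speaks only of the preferred chart at the point; pulling back along the identity
transfers smoothness to any chart around it. -/
theorem DForm.SmoothAt.contDiffWithinAt_inChart {p : ℕ} {η : DForm I X p} {c : X} {y : E}
    (hy : y ∈ (extChartAt I c).target) (hη : η.SmoothAt ((extChartAt I c).symm y)) :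
    ContDiffWithinAt ℝ ∞ (η.inChart c) (Set.range I) y := by
  rw [← pull_id η]
  refine contDiffWithinAt_inChart_pull contMDiff_id hy (c' := (extChartAt I c).symm y)
    (mem_extChartAt_source _) ?_
  exact hη

theorem DForm.Smooth.contDiffOn_inChart {p : ℕ} {η : DForm I X p} (hη : η.Smooth) (c : X) :
    ContDiffOn ℝ ∞ (η.inChart c) (extChartAt I c).target := fun _ hy =>
  ((hη _).contDiffWithinAt_inChart hy).mono (extChartAt_target_subset_range c)

theorem DForm.SmoothAt.pull {p : ℕ} {η : DForm I' Y p} {f : X → Y} (hf : ContMDiff I I' ∞ f) {x : X}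
    (hη : η.SmoothAt (f x)) : (η.pull (I := I) f).SmoothAt x := by
  refine contDiffWithinAt_inChart_pull hf (mem_extChartAt_target x) (c' := f x) ?_ ?_
  · rw [extChartAt_to_inv]
    exact mem_extChartAt_source _
  · rw [written, extChartAt_to_inv]
    exact hη

/-- Naturality of `d` holds for maps between sets in vector spaces; the written map is one, once
restricted to a neighbourhood `u` on which it stays in the second chart. -/
theorem extDerivWithin_inChart_pull {p : ℕ} {η : DForm I' Y p} {f : X → Y}
    (hf : ContMDiff I I' ∞ f)
    {c : X} {c' : Y} {y : E} (hy : y ∈ (extChartAt I c).target)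
    (hc' : f ((extChartAt I c).symm y) ∈ (extChartAt I' c').source)
    (hη : DifferentiableWithinAt ℝ (η.inChart c') (Set.range I') (written I I' f c c' y)) :
    extDerivWithin ((η.pull (I := I) f).inChart c) (Set.range I) y =
      (extDerivWithin (η.inChart c') (Set.range I')
        (written I I' f c c' y)).compContinuousLinearMap
      (fderivWithin ℝ (written I I' f c c') (Set.range I) y) := by
  have hyr := extChartAt_target_subset_range c hy
  rw [(eventuallyEq_inChart_pull η hf hy hc').extDerivWithin_eq_of_mem hyr]
  obtain ⟨u, hu, hyu, hus⟩ := mem_nhdsWithin.1 (eventually_mem_target hf.continuous hy hc')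
  have hun := hu.mem_nhds hyu
  have hs : UniqueDiffOn ℝ (Set.range I ∩ u) := I.uniqueDiffOn.inter hu
  have hxs : y ∈ Set.range I ∩ u := ⟨hyr, hyu⟩
  -- At boundary points, second derivatives are symmetric because the point is a limit of interior
  -- points.
  have hcl : y ∈ closure (interior (Set.range I ∩ u)) := by
    rw [interior_inter, hu.interior_eq, Set.inter_comm]
    exact hu.inter_closure ⟨hyu, I.range_subset_closure_interior hyr⟩
  have hT := (contDiffWithinAt_written hf hy hc').mono (Set.inter_subset_left (t := u))
  have key := extDerivWithin_pullback hη hT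
    (by simpa using (WithTop.coe_le_coe.2 le_top : ((2 : ℕ∞) : ℕ∞ω) ≤ ∞)) hs hcl hxs
    (fun z hz => extChartAt_target_subset_range c'
      ((extChartAt I' c').map_source (hus ⟨hz.2, hz.1⟩).2))
  rw [fderivWithin_inter hun] at key
  rw [← key, extDerivWithin, extDerivWithin, fderivWithin_inter hun]
  congr 1
  refine Filter.EventuallyEq.fderivWithin_eq_of_mem ?_ hyr
  filter_upwards [mem_nhdsWithin_of_mem_nhds hun, self_mem_nhdsWithin] with z hz hzr
  rw [fderivWithin_inter (hu.mem_nhds hz)]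

theorem chartDeriv_self (x : X) :
    chartDeriv I x x = ContinuousLinearMap.id ℝ (TangentSpace I x) := mfderiv_extChartAt_self

theorem DForm.d_eq {p : ℕ} (η : DForm I X p) (x : X) :
    η.d x = extDerivWithin (η.inChart x) (Set.range I) (extChartAt I x x) := by
  ext v
  change extDerivWithin (η.inChart x) (Set.range I) (extChartAt I x x)
    (fun i => chartDeriv I x x (v i)) = _
  rw [chartDeriv_self]
  rfl

theorem DForm.d_pull {p : ℕ} {η : DForm I' Y p} {f : X → Y} (hf : ContMDiff I I' ∞ f) {x : X}
    (hη : η.SmoothAt (f x)) : (η.pull (I := I) f).d x = (η.d).pull (I := I) f x := by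
  have h1 : f ((extChartAt I x).symm (extChartAt I x x)) = f x := by rw [extChartAt_to_inv]
  rw [DForm.d_eq, extDerivWithin_inChart_pull hf (mem_extChartAt_target x) (c' := f x)
    (by rw [h1]; exact mem_extChartAt_source _)
    (by rw [written, h1]; exact hη.differentiableWithinAt (by simp))]
  have h2 : mfderiv I I' f x =
      fderivWithin ℝ (written I I' f x (f x)) (Set.range I) (extChartAt I x x) :=
    (hf.mdifferentiable (by simp) x).mfderiv
  rw [DForm.pull, DForm.d_eq, h2, written, h1]
  rfl

/-- The definition of `d` uses a different chart at every point. Naturality under the identity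
allows a single chart on its whole target, as integration requires. -/
theorem DForm.inChart_d {p : ℕ} {η : DForm I X p} {c : X} {y : E}
    (hy : y ∈ (extChartAt I c).target) (hη : η.SmoothAt ((extChartAt I c).symm y)) :
    (η.d).inChart c y = extDerivWithin (η.inChart c) (Set.range I) y := by
  have h := extDerivWithin_inChart_pull (η := η) contMDiff_id hy (c' := (extChartAt I c).symm y)
    (mem_extChartAt_source _) (hη.differentiableWithinAt (by simp))
  have h' := fderivWithin_written (I' := I) (f := id) (c' := (extChartAt I c).symm y) hy
    mdifferentiableAt_id (mem_extChartAt_source _)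
  rw [pull_id, h'] at h
  rw [h, DForm.inChart_def, DForm.d_eq, mfderiv_id]
  ext v
  simp only [ContinuousAlternatingMap.compContinuousLinearMap_apply, written, id_eq,
    ContinuousLinearMap.comp_apply, Function.comp_def]
  rw [chartDeriv_self]
  rfl

/-! ### Mixed forms -/

/-- A mixed form in the coordinates of a chart. -/
noncomputable def MForm.inChart (α : MForm I X) (c : X) (y : E) : MixedForm E :=
  pullLin (chartInv I c y) (α ((extChartAt I c).symm y))

/-- Smooth mixed forms. -/
def MForm.Smooth (α : MForm I X) : Prop := ∀ p, DForm.Smooth (fun x => α x p)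

/-- The pull-back of a mixed form. -/
noncomputable def MForm.pull (f : X → Y) (α : MForm I' Y) : MForm I X := fun x =>
  pullLin (mfderiv I I' f x) (α (f x))

theorem MForm.Smooth.pull {α : MForm I' Y} (hα : α.Smooth) {f : X → Y} (hf : ContMDiff I I' ∞ f) :
    (α.pull (I := I) f).Smooth := fun p x => (hα p (f x)).pull hf

theorem MForm.d_pull {α : MForm I' Y} (hα : α.Smooth) {f : X → Y} (hf : ContMDiff I I' ∞ f) :
    (α.pull (I := I) f).d = (α.d).pull (I := I) f := by
  funext x p
  match p with
  | 0 => rfl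
  | q + 1 => exact DForm.d_pull hf (hα q (f x))

theorem MForm.inChart_d {α : MForm I X} (hα : α.Smooth) {c : X} {y : E}
    (hy : y ∈ (extChartAt I c).target) :
    (α.d).inChart c y = mixedExtDeriv (α.inChart c) (Set.range I) y := by
  ext1 p
  match p with
  | 0 => rfl
  | q + 1 => exact DForm.inChart_d hy (hα q _)

end ManifoldForms

/-! ### Integration of top forms: additivity and change of variables. -/

section IntegrationTheory

open MeasureTheory

/-- The standard frame. -/
noncomputable def stdFrame (k : ℕ) : Fin k → Euc k := fun i => EuclideanSpace.single i 1

theorem topForm_comp_stdFrame {k : ℕ} (α : Euc k [⋀^Fin k]→L[ℝ] ℝ) (f : Euc k →L[ℝ] Euc k) :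
    α (fun i => f (stdFrame k i)) = f.det * α (stdFrame k) := by
  let b := (EuclideanSpace.basisFun (Fin k) ℝ).toBasis
  have hb : ⇑b = stdFrame k := by
    ext i : 1
    simp [b, stdFrame]
  have h := congrArg (fun g => g (fun i => f (stdFrame k i))) (α.toAlternatingMap.eq_smul_basis_det b)
  simp only [AlternatingMap.smul_apply, smul_eq_mul] at h
  change α _ = α _ * _ at h
  rw [h, hb, mul_comm]
  congr 1
  have := b.det_comp (f : Euc k →ₗ[ℝ] Euc k) b
  rw [b.det_self, mul_one, hb] at this
  exact this

/-- Under a change of coordinates the orientation form and the integrand both acquire the Jacobian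
`d`, and `sign d * d = |d|` is the factor in the change of variables formula. -/
theorem sign_mul_mul (d a b : ℝ) : ((SignType.sign (d * a) : SignType) : ℝ) * (d * b) =
    |d| * ((SignType.sign a : SignType) * b) := by
  rw [sign_mul]
  push_cast
  rw [← sign_mul_self d]
  ring

variable {k : ℕ} {H : Type*} [TopologicalSpace H] {I : ModelWithCorners ℝ (Euc k) H}
  {X : Type*} [TopologicalSpace X] [ChartedSpace H X] [IsManifold I ∞ X]

/-- Continuity of differential forms. -/
def DForm.Cont {p : ℕ} (η : DForm I X p) : Prop :=
  ∀ c : X, ContinuousOn (η.inChart c) (extChartAt I c).target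

theorem DForm.Smooth.cont {p : ℕ} {η : DForm I X p} (h : η.Smooth) : η.Cont :=
  fun c => (h.contDiffOn_inChart c).continuousOn

theorem measurableSet_extChartAt_target (c : X) : MeasurableSet (extChartAt I c).target := by
  rw [extChartAt_target]
  exact ((I.continuous_symm.isOpen_preimage _ (chartAt H c).open_target).measurableSet).inter
    I.isClosed_range.measurableSet

theorem measurableSet_target_inter {U : Set X} (hU : IsOpen U) (c : X) :
    MeasurableSet ((extChartAt I c).target ∩ (extChartAt I c).symm ⁻¹' U) := by
  obtain ⟨u, hu, h⟩ := continuousOn_iff'.1 (continuousOn_extChartAt_symm (I := I) c) U hU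
  rw [Set.inter_comm, h]
  exact hu.measurableSet.inter (measurableSet_extChartAt_target c)

/-- The density of a top form with respect to an orientation, in a chart. -/
noncomputable def chartDensity (Ω : OrientationForm I X k) (η : DForm I X k) (c : X)
    (y : Euc k) : ℝ :=
  (SignType.sign (Ω.form.inChart c y (stdFrame k)) : ℝ) * η.inChart c y (stdFrame k)

theorem inChart_stdFrame_ne_zero (Ω : OrientationForm I X k) {c : X} {y : Euc k}
    (hy : y ∈ (extChartAt I c).target) : Ω.form.inChart c y (stdFrame k) ≠ 0 := by
  intro h
  apply Ω.ne_zero ((extChartAt I c).symm y)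
  rw [eq_inChart_comp_chartDeriv_symm Ω.form hy]
  let b := (EuclideanSpace.basisFun (Fin k) ℝ).toBasis
  have hb : ⇑b = stdFrame k := by
    ext i : 1
    simp [b, stdFrame]
  have h0 : (Ω.form.inChart c y).toAlternatingMap = 0 := by
    rw [(Ω.form.inChart c y).toAlternatingMap.eq_smul_basis_det b, hb]
    change Ω.form.inChart c y (stdFrame k) • _ = _
    rw [h, zero_smul]
  have h1 : Ω.form.inChart c y = 0 := ContinuousAlternatingMap.toAlternatingMap_injective h0
  rw [h1]
  rfl

theorem continuousOn_apply_const {p : ℕ} {s : Set (Euc k)} {β : Euc k → Euc k [⋀^Fin p]→L[ℝ] ℝ}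
    (h : ContinuousOn β s) (v : Fin p → Euc k) : ContinuousOn (fun y => β y v) s :=
  (evalForm v).continuous.comp_continuousOn h

theorem continuousOn_sign_orientation (Ω : OrientationForm I X k) (c : X) :
    ContinuousOn (fun y => SignType.sign (Ω.form.inChart c y (stdFrame k)))
      (extChartAt I c).target := fun y hy =>
  ContinuousAt.comp_continuousWithinAt (g := SignType.sign)
    (f := fun y => Ω.form.inChart c y (stdFrame k))
    (continuousAt_sign_of_ne_zero (inChart_stdFrame_ne_zero Ω hy))
    (continuousOn_apply_const (Ω.smooth.cont c) _ y hy)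

theorem continuousOn_chartDensity (Ω : OrientationForm I X k) {η : DForm I X k} (hη : η.Cont)
    (c : X) : ContinuousOn (chartDensity Ω η c) (extChartAt I c).target := by
  refine ContinuousOn.mul ?_ (continuousOn_apply_const (hη c) _)
  exact (continuous_of_discreteTopology (f := fun s : SignType => (s : ℝ))).comp_continuousOn
    (continuousOn_sign_orientation Ω c)

variable [T2Space X] [CompactSpace X]

variable (I X) in
theorem finite_partitionOfUnity : {c : X | (Function.support (partitionOfUnity I X c)).Nonempty}.Finite :=
  (partitionOfUnity I X).locallyFinite.finite_nonempty_of_compact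

variable (I X) in
/-- The finitely many charts which contribute to integrals. -/
noncomputable def chartSet : Finset X := (finite_partitionOfUnity I X).toFinset

theorem partitionOfUnity_eq_zero_of_notMem {c : X} (hc : c ∉ chartSet I X) (x : X) :
    partitionOfUnity I X c x = 0 := by
  by_contra h
  exact hc ((finite_partitionOfUnity I X).mem_toFinset.2 ⟨x, h⟩)

variable (I X) in
theorem sum_partitionOfUnity (x : X) : ∑ c ∈ chartSet I X, partitionOfUnity I X c x = 1 := by
  rw [← (partitionOfUnity I X).sum_eq_one (Set.mem_univ x), finsum_eq_sum_of_support_subset]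
  intro c hc
  by_contra h
  exact hc (partitionOfUnity_eq_zero_of_notMem h x)

variable (I) in
theorem tsupport_partitionOfUnity_subset (c : X) :
    tsupport (partitionOfUnity I X c) ⊆ (extChartAt I c).source := by
  rw [extChartAt_source]
  exact (SmoothPartitionOfUnity.exists_isSubordinate_chartAt_source I X).choose_spec c

theorem partitionOfUnity_eq_zero {c x : X} (hx : x ∉ (extChartAt I c).source) :
    partitionOfUnity I X c x = 0 :=
  image_eq_zero_of_notMem_tsupport fun h => hx (tsupport_partitionOfUnity_subset I c h)

variable (I) in
/-- The support of a member of the partition of unity, in its chart. -/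
noncomputable def chartSupport (c : X) : Set (Euc k) :=
  extChartAt I c '' tsupport (partitionOfUnity I X c)

theorem isCompact_chartSupport (c : X) : IsCompact (chartSupport I c) :=
  (isClosed_tsupport _).isCompact.image_of_continuousOn
    ((continuousOn_extChartAt c).mono (tsupport_partitionOfUnity_subset I c))

theorem chartSupport_subset (c : X) : chartSupport I c ⊆ (extChartAt I c).target := by
  rintro _ ⟨x, hx, rfl⟩
  exact (extChartAt I c).map_source (tsupport_partitionOfUnity_subset I c hx)

theorem partitionOfUnity_symm_eq_zero {c : X} {y : Euc k} (hy : y ∈ (extChartAt I c).target)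
    (h : y ∉ chartSupport I c) : partitionOfUnity I X c ((extChartAt I c).symm y) = 0 := by
  refine image_eq_zero_of_notMem_tsupport fun hx => h ⟨_, hx, (extChartAt I c).right_inv hy⟩

/-- The integrand is continuous and vanishes outside a compact subset of the chart target, the image
of the support of the partition function. -/
theorem integrableOn_chart (Ω : OrientationForm I X k) {η : DForm I X k} (hη : η.Cont)
    (c : X) : IntegrableOn (fun y => partitionOfUnity I X c ((extChartAt I c).symm y) *
      chartDensity Ω η c y) (extChartAt I c).target := by
  have hc : ContinuousOn (fun y => partitionOfUnity I X c ((extChartAt I c).symm y) *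
      chartDensity Ω η c y) (extChartAt I c).target :=
    ContinuousOn.mul ((partitionOfUnity I X c).contMDiff.continuous.comp_continuousOn
      (continuousOn_extChartAt_symm c)) (continuousOn_chartDensity Ω hη c)
  refine ((hc.mono (chartSupport_subset c)).integrableOn_compact
    (isCompact_chartSupport c)).of_forall_sdiff_eq_zero (measurableSet_extChartAt_target c) ?_
  intro y hy
  rw [partitionOfUnity_symm_eq_zero hy.1 hy.2, zero_mul]

/-- The integral of a top form over a subset. -/
noncomputable def integralOn (Ω : OrientationForm I X k) (U : Set X) (η : DForm I X k) : ℝ :=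
  ∑ c ∈ chartSet I X, ∫ y in (extChartAt I c).target ∩ (extChartAt I c).symm ⁻¹' U,
    partitionOfUnity I X c ((extChartAt I c).symm y) * chartDensity Ω η c y

theorem integral_eq_sum (Ω : OrientationForm I X k) (η : DForm I X k) :
    integral Ω η = ∑ c ∈ chartSet I X, ∫ y in (extChartAt I c).target,
      partitionOfUnity I X c ((extChartAt I c).symm y) * chartDensity Ω η c y := by
  rw [integral, finsum_eq_sum_of_support_subset (s := chartSet I X)]
  · simp only [chartDensity, mul_assoc]
    rfl
  · intro c hc
    by_contra h
    apply hc
    simp [partitionOfUnity_eq_zero_of_notMem h]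

theorem integral_sum {ι : Type*} (s : Finset ι) (Ω : OrientationForm I X k) (η : ι → DForm I X k)
    (hη : ∀ j ∈ s, (η j).Cont) :
    integral Ω (fun x => ∑ j ∈ s, η j x) = ∑ j ∈ s, integral Ω (η j) := by
  simp only [integral_eq_sum]
  rw [Finset.sum_comm]
  refine Finset.sum_congr rfl fun c _ => ?_
  rw [← integral_finsetSum s fun j hj => integrableOn_chart Ω (hη j hj) c]
  congr 1
  ext y
  rw [← Finset.mul_sum]
  congr 1
  simp only [chartDensity, DForm.inChart_apply, ContinuousAlternatingMap.sum_apply, Finset.mul_sum]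

theorem integral_sub (Ω : OrientationForm I X k) {η η' : DForm I X k}
    (hη : η.Cont) (hη' : η'.Cont) :
    integral Ω (fun x => η x - η' x) = integral Ω η - integral Ω η' := by
  simp only [integral_eq_sum]
  rw [← Finset.sum_sub_distrib]
  refine Finset.sum_congr rfl fun c _ => ?_
  rw [← MeasureTheory.integral_sub (integrableOn_chart Ω hη c) (integrableOn_chart Ω hη' c)]
  congr 1
  ext y
  rw [← mul_sub]
  congr 1
  simp only [chartDensity, DForm.inChart_apply, ContinuousAlternatingMap.sub_apply, mul_sub]

theorem integral_nonneg (Ω : OrientationForm I X k) {η : DForm I X k}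
    (h : ∀ x v, 0 ≤ ((SignType.sign (Ω.form x v) : SignType) : ℝ) * η x v) :
    0 ≤ integral Ω η := by
  rw [integral_eq_sum]
  refine Finset.sum_nonneg fun c _ => MeasureTheory.integral_nonneg fun y => ?_
  exact mul_nonneg ((partitionOfUnity I X).nonneg c _) (h _ _)

/-- Only almost every point where `η` lives has to be covered, so boundaries of pieces may be left
out. -/
theorem integral_eq_sum_integralOn {ι : Type*} [Fintype ι] (Ω : OrientationForm I X k)
    {η : DForm I X k} (hη : η.Cont) (U : ι → Set X)
    (hU : ∀ l c, MeasurableSet ((extChartAt I c).target ∩ (extChartAt I c).symm ⁻¹' (U l)))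
    (hd : Pairwise fun l l' => Disjoint (U l) (U l'))
    (h0 : ∀ c : X, ∀ᵐ y, y ∈ (extChartAt I c).target →
      (∀ l, (extChartAt I c).symm y ∉ U l) → η ((extChartAt I c).symm y) = 0) :
    integral Ω η = ∑ l, integralOn Ω (U l) η := by
  rw [integral_eq_sum]
  simp only [integralOn]
  rw [Finset.sum_comm]
  refine Finset.sum_congr rfl fun c _ => ?_
  have hdd : Pairwise (Function.onFun Disjoint fun l =>
      (extChartAt I c).target ∩ (extChartAt I c).symm ⁻¹' (U l)) := fun l l' hl =>
    ((hd hl).preimage _).mono Set.inter_subset_right Set.inter_subset_right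
  rw [← MeasureTheory.integral_iUnion_fintype (fun l => hU l c) hdd fun l =>
    (integrableOn_chart Ω hη c).mono_set Set.inter_subset_left]
  refine setIntegral_eq_of_subset_of_ae_sdiff_eq_zero
    (measurableSet_extChartAt_target c).nullMeasurableSet
    (Set.iUnion_subset fun l => Set.inter_subset_left) ?_
  filter_upwards [h0 c] with y hy hyd
  have := hy hyd.1 fun l hl => hyd.2 (Set.mem_iUnion.2 ⟨l, hyd.1, hl⟩)
  have h1 : chartDensity Ω η c y = 0 := by
    have h2 : η.inChart c y = 0 := by
      rw [DForm.inChart_def, this]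
      rfl
    rw [chartDensity, h2]
    exact mul_zero _
  rw [h1, mul_zero]

/-- Integration in a parametrisation. -/
theorem integralOn_eq_of_parametrisation (Ω : OrientationForm I X k) {η : DForm I X k}
    (hη : η.Cont) {U : Set X}
    (hU : ∀ c, MeasurableSet ((extChartAt I c).target ∩ (extChartAt I c).symm ⁻¹' U))
    {ψ : X → Euc k} (hψ : Set.InjOn ψ U) {f' : X → Euc k → Euc k →L[ℝ] Euc k}
    (hf' : ∀ c, ∀ y ∈ (extChartAt I c).target ∩ (extChartAt I c).symm ⁻¹' U,
      HasFDerivWithinAt (fun z => ψ ((extChartAt I c).symm z)) (f' c y)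
        ((extChartAt I c).target ∩ (extChartAt I c).symm ⁻¹' U) y)
    {g : Euc k → ℝ}
    (hg : ∀ c, ∀ y ∈ (extChartAt I c).target ∩ (extChartAt I c).symm ⁻¹' U,
      chartDensity Ω η c y = |(f' c y).det| * g (ψ ((extChartAt I c).symm y))) :
    integralOn Ω U η = ∫ z in ψ '' U, g z ∧ IntegrableOn g (ψ '' U) ∧ MeasurableSet (ψ '' U) := by
  -- The inverse `Function.invFunOn` used below needs a nonempty `X`.
  rcases isEmpty_or_nonempty X with hX | hX
  · have : U = ∅ := Set.eq_empty_of_isEmpty U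
    subst this
    have h2 : chartSet I X = ∅ := Finset.eq_empty_of_forall_notMem fun c => (hX.false c).elim
    simp [integralOn, h2]
  set V : X → Set (Euc k) := fun c => (extChartAt I c).target ∩ (extChartAt I c).symm ⁻¹' U
  set F : X → Euc k → Euc k := fun c z => ψ ((extChartAt I c).symm z)
  -- `G c` is the share of `g` belonging to the chart at `c`: the partition of unity is carried to
  -- `ψ '' U` by the inverse of `ψ`, and the shares add up to `g`. Each share is compared with its
  -- chart integral by the change of variables formula.
  set G : X → Euc k → ℝ := fun c z => partitionOfUnity I X c (Function.invFunOn ψ U z) * g z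
  have hinv : ∀ x ∈ U, Function.invFunOn ψ U (ψ x) = x := fun x hx =>
    hψ.leftInvOn_invFunOn hx
  have himg (c : X) : F c '' V c = ψ '' (U ∩ (extChartAt I c).source) := by
    ext z
    constructor
    · rintro ⟨y, hy, rfl⟩
      exact ⟨_, ⟨hy.2, (extChartAt I c).map_target hy.1⟩, rfl⟩
    · rintro ⟨x, hx, rfl⟩
      refine ⟨extChartAt I c x, ⟨(extChartAt I c).map_source hx.2, ?_⟩, ?_⟩
      · change (extChartAt I c).symm (extChartAt I c x) ∈ U
        rw [(extChartAt I c).left_inv hx.2]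
        exact hx.1
      · simp only [F, (extChartAt I c).left_inv hx.2]
  have hinj (c : X) : Set.InjOn (F c) (V c) := fun y hy y' hy' h =>
    (extChartAt I c).symm.injOn hy.1 hy'.1 (hψ hy.2 hy'.2 h)
  have hmeas (c : X) : MeasurableSet (F c '' V c) :=
    measurable_image_of_fderivWithin (hU c) (hf' c) (hinj c)
  have hUn : ψ '' U = ⋃ c ∈ chartSet I X, F c '' V c := by
    simp only [himg]
    ext z
    simp only [Set.mem_iUnion]
    constructor
    · rintro ⟨x, hx, rfl⟩
      have h1 := sum_partitionOfUnity I X x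
      obtain ⟨c, hc, hc0⟩ := Finset.exists_ne_zero_of_sum_ne_zero (h1.trans_ne one_ne_zero)
      refine ⟨c, hc, x, ⟨hx, ?_⟩, rfl⟩
      by_contra h
      exact hc0 (partitionOfUnity_eq_zero h)
    · rintro ⟨c, _, x, hx, rfl⟩
      exact ⟨x, hx.1, rfl⟩
  have hUm : MeasurableSet (ψ '' U) := by
    rw [hUn]
    exact Finset.measurableSet_biUnion _ fun c _ => hmeas c
  have heq (c : X) : ∀ y ∈ V c, partitionOfUnity I X c ((extChartAt I c).symm y) *
      chartDensity Ω η c y = |(f' c y).det| • G c (F c y) := by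
    intro y hy
    simp only [G, F, hinv _ hy.2, hg c y hy, smul_eq_mul]
    ring
  have hGint (c : X) : IntegrableOn (G c) (F c '' V c) := by
    rw [integrableOn_image_iff_integrableOn_abs_det_fderiv_smul volume (hU c) (hf' c) (hinj c)]
    exact ((integrableOn_chart Ω hη c).mono_set Set.inter_subset_left).congr_fun (heq c) (hU c)
  have hzero (c : X) : ∀ z ∈ ψ '' U \ F c '' V c, G c z = 0 := by
    rintro z ⟨⟨x, hx, rfl⟩, hz⟩
    simp only [G, hinv x hx]
    rw [partitionOfUnity_eq_zero, zero_mul]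
    intro h
    rw [himg] at hz
    exact hz ⟨x, ⟨hx, h⟩, rfl⟩
  have hsub (c : X) : F c '' V c ⊆ ψ '' U := by
    rw [himg]
    exact Set.image_mono Set.inter_subset_left
  have hGint' (c : X) : IntegrableOn (G c) (ψ '' U) :=
    (hGint c).of_forall_sdiff_eq_zero hUm (hzero c)
  have hsum : ∀ z ∈ ψ '' U, ∑ c ∈ chartSet I X, G c z = g z := by
    intro z _
    simp only [G, ← Finset.sum_mul, sum_partitionOfUnity, one_mul]
  refine ⟨?_, ?_, hUm⟩
  · rw [← setIntegral_congr_fun hUm hsum, integral_finsetSum _ fun c _ => hGint' c, integralOn]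
    refine Finset.sum_congr rfl fun c _ => ?_
    rw [setIntegral_congr_fun (hU c) (heq c),
      ← integral_image_eq_integral_abs_det_fderiv_smul volume (hU c) (hf' c) (hinj c) (G c)]
    exact (setIntegral_eq_of_subset_of_forall_sdiff_eq_zero hUm (hsub c) (hzero c)).symm
  · exact (integrable_finsetSum _ fun c _ => hGint' c).congr
      ((ae_restrict_iff' hUm).2 (Filter.Eventually.of_forall hsum))

/-- The integral of a form supported in the domain of a chart. -/
theorem integral_eq_chart (Ω : OrientationForm I X k) {η : DForm I X k} (hη : η.Cont) {c : X}
    (h0 : ∀ x ∉ (extChartAt I c).source, η x = 0) :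
    integral Ω η = ∫ y in (extChartAt I c).target, chartDensity Ω η c y := by
  have hU (b : X) : MeasurableSet ((extChartAt I b).target ∩
      (extChartAt I b).symm ⁻¹' (extChartAt I c).source) :=
    measurableSet_target_inter (isOpen_extChartAt_source c) b
  have h1 := integral_eq_sum_integralOn (ι := Unit) Ω hη (fun _ => (extChartAt I c).source)
    (fun _ => hU) (fun _ _ h => (h rfl).elim)
    (fun b => Filter.Eventually.of_forall fun y _ hy => h0 _ (hy ()))
  rw [Fintype.sum_unique] at h1
  -- The parametrisation is the chart at `c` itself, so the derivatives are those of transition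
  -- maps.
  have h2 := integralOn_eq_of_parametrisation Ω hη hU (extChartAt I c).injOn
    (f' := fun b y => fderivWithin ℝ (written I I id b c) (Set.range I) y)
    (g := chartDensity Ω η c) ?_ ?_
  · rw [h1, h2.1, (extChartAt I c).image_source_eq_target]
  · rintro b y ⟨hy, hyc⟩
    have := hasFDerivWithinAt_written (I' := I) (f := id) (c' := c) hy mdifferentiableAt_id hyc
    rw [← this.fderivWithin (uniqueDiffWithinAt_range hy)] at this
    exact this.mono (Set.inter_subset_left.trans (extChartAt_target_subset_range b))
  · rintro b y ⟨hy, hyc⟩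
    have h3 (α : DForm I X k) := inChart_pull α (I := I) (f := id) (c' := c) hy
      mdifferentiableAt_id hyc
    simp only [pull_id] at h3
    rw [chartDensity, h3 Ω.form, h3 η, ContinuousAlternatingMap.compContinuousLinearMap_apply,
      ContinuousAlternatingMap.compContinuousLinearMap_apply]
    simp only [Function.comp_def]
    rw [topForm_comp_stdFrame, topForm_comp_stdFrame, sign_mul_mul]
    rfl

end IntegrationTheory

/-! ### Stokes' theorem on the model quadrant. -/

section Quadrant

open MeasureTheory

/-- The inclusion of the `l`-th coordinate hyperplane. -/
noncomputable def faceIncl {k : ℕ} (l : Fin (k + 1)) : Euc k →L[ℝ] Euc (k + 1) :=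
  LinearMap.toContinuousLinearMap
    { toFun := fun z => WithLp.toLp 2 (l.insertNth (0 : ℝ) z.ofLp)
      map_add' := fun x y => by
        ext i
        refine Fin.succAboveCases l ?_ (fun j => ?_) i <;> simp
      map_smul' := fun c y => by
        ext i
        refine Fin.succAboveCases l ?_ (fun j => ?_) i <;> simp }

/-- The projection which omits the `l`-th coordinate. -/
noncomputable def faceProj {k : ℕ} (l : Fin (k + 1)) : Euc (k + 1) →L[ℝ] Euc k :=
  LinearMap.toContinuousLinearMap
    { toFun := fun y => WithLp.toLp 2 fun j => y (l.succAbove j)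
      map_add' := fun _ _ => rfl
      map_smul' := fun _ _ => rfl }

variable {k : ℕ}

@[simp]
theorem faceIncl_self (l : Fin (k + 1)) (z : Euc k) : faceIncl l z l = 0 := by
  change (WithLp.toLp 2 (l.insertNth (0 : ℝ) z.ofLp) : Euc (k + 1)) l = 0
  simp

@[simp]
theorem faceIncl_succAbove (l : Fin (k + 1)) (z : Euc k) (j : Fin k) :
    faceIncl l z (l.succAbove j) = z j := by
  change (WithLp.toLp 2 (l.insertNth (0 : ℝ) z.ofLp) : Euc (k + 1)) (l.succAbove j) = z j
  simp

@[simp]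
theorem faceProj_apply (l : Fin (k + 1)) (y : Euc (k + 1)) (j : Fin k) :
    faceProj l y j = y (l.succAbove j) := rfl

theorem faceIncl_faceProj {l : Fin (k + 1)} {y : Euc (k + 1)} (hy : y l = 0) :
    faceIncl l (faceProj l y) = y := by
  ext i
  refine Fin.succAboveCases l ?_ (fun j => ?_) i <;> simp [hy]

theorem faceProj_faceIncl (l : Fin (k + 1)) (z : Euc k) : faceProj l (faceIncl l z) = z := by
  ext j
  simp

theorem faceIncl_stdFrame (l : Fin (k + 1)) (j : Fin k) :
    faceIncl l (stdFrame k j) = stdFrame (k + 1) (l.succAbove j) := by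
  ext i
  refine Fin.succAboveCases l ?_ (fun j' => ?_) i
  · simp [stdFrame, (Fin.succAbove_ne l j).symm]
  · simp [stdFrame]

theorem range_corner (k : ℕ) : Set.range (Corner k) = {y : Euc k | ∀ i, 0 ≤ y i} :=
  range_euclideanQuadrant k

theorem interior_range_corner (k : ℕ) :
    interior (Set.range (Corner k)) = {y : Euc k | ∀ i, 0 < y i} := by
  rw [range_corner, interior_euclideanQuadrant]

theorem faceIncl_mem_range {l : Fin (k + 1)} {z : Euc k} :
    faceIncl l z ∈ Set.range (Corner (k + 1)) ↔ z ∈ Set.range (Corner k) := by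
  simp only [range_corner, Set.mem_ofPred_eq]
  rw [Fin.forall_iff_succAbove l]
  simp

/-- The divergence theorem is applied on boxes of functions `Fin m → ℝ`; for compact support the
quadrant may be cut off to such a box. -/
theorem setIntegral_corner_eq_box {m : ℕ} {K : Set (Euc m)} {R : ℝ}
    (hR : ∀ y ∈ K, ∀ i, y i < R) {f : Euc m → ℝ}
    (hf : ∀ y ∈ Set.range (Corner m), y ∉ K → f y = 0) :
    ∫ y in Set.range (Corner m), f y =
      ∫ x in Set.Icc (fun _ : Fin m => (0 : ℝ)) (fun _ => R), f (WithLp.toLp 2 x) := by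
  have h1 := (PiLp.volume_preserving_toLp (Fin m)).setIntegral_preimage_emb
    (MeasurableEquiv.toLp 2 (Fin m → ℝ)).measurableEmbedding f
    (Set.range (Corner m))
  have h1' : ∫ y in Set.range (Corner m), f y =
    ∫ x in (WithLp.toLp 2 ⁻¹' (Set.range (Corner m)) : Set (Fin m → ℝ)), f (WithLp.toLp 2 x) := h1.symm
  rw [h1']
  refine setIntegral_eq_of_subset_of_forall_sdiff_eq_zero ?_ ?_ ?_
  · exact (Corner m).isClosed_range.measurableSet.preimage
      (MeasurableEquiv.toLp 2 (Fin m → ℝ)).measurable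
  · intro x hx
    rw [Set.mem_preimage, range_corner]
    exact fun i => hx.1 i
  · rintro x ⟨hx, hx'⟩
    refine hf _ hx fun hK => hx' ⟨?_, fun i => (hR _ hK i).le⟩
    rw [Set.mem_preimage, range_corner] at hx
    exact fun i => hx i

/-- Stokes' theorem on the quadrant. -/
theorem integral_extDerivWithin_corner {β : Euc (k + 1) → Euc (k + 1) [⋀^Fin k]→L[ℝ] ℝ}
    (hβ : ContDiffOn ℝ ∞ β (Set.range (Corner (k + 1)))) {K : Set (Euc (k + 1))}
    (hK : IsCompact K) (h0 : ∀ y ∈ Set.range (Corner (k + 1)), y ∉ K → β y = 0) :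
    ∫ y in Set.range (Corner (k + 1)),
        extDerivWithin β (Set.range (Corner (k + 1))) y (stdFrame (k + 1)) =
      ∑ l : Fin (k + 1), -((-1) ^ (l : ℕ) * ∫ z in Set.range (Corner k),
        β (faceIncl l z) fun j => stdFrame (k + 1) (l.succAbove j)) := by
  set Q := Set.range (Corner (k + 1)) with hQ
  obtain ⟨R, hR0, hR⟩ : ∃ R : ℝ, 0 < R ∧ ∀ y ∈ K, ∀ i, y i < R := by
    obtain ⟨r, hr⟩ := hK.isBounded.exists_norm_le
    -- Positive even when `K` is empty, and strictly larger than every coordinate on `K`, so that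
    -- the far faces of the box miss `K`.
    refine ⟨max r 0 + 1, by positivity, fun y hy i => ?_⟩
    have h1 := hr y hy
    have h2 := (le_abs_self _).trans (PiLp.norm_apply_le y i)
    have h3 := le_max_left r 0
    linarith
  have hud : UniqueDiffOn ℝ Q := (Corner (k + 1)).uniqueDiffOn
  have hd : ∀ y ∈ Q, y ∉ K → extDerivWithin β Q y = 0 := by
    intro y hy hyK
    have h1 : β =ᶠ[𝓝[Q] y] fun _ => 0 := by
      filter_upwards [self_mem_nhdsWithin, mem_nhdsWithin_of_mem_nhds
        (hK.isClosed.isOpen_compl.mem_nhds hyK)] with z hz hz'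
      exact h0 z hz hz'
    rw [h1.extDerivWithin_eq_of_mem hy]
    ext v
    rw [extDerivWithin_apply (differentiableWithinAt_const _) (hud y hy)]
    simp
  set box : Set (Fin (k + 1) → ℝ) := Set.Icc (fun _ => 0) (fun _ => R)
  have hbox : ∀ x ∈ box, WithLp.toLp 2 x ∈ Q := fun x hx => by
    rw [hQ, range_corner]
    exact fun i => hx.1 i
  have hto : Continuous (WithLp.toLp 2 : (Fin (k + 1) → ℝ) → Euc (k + 1)) :=
    PiLp.continuous_toLp 2 _
  set ev : Fin (k + 1) → Fin k → Euc (k + 1) := fun l j => stdFrame (k + 1) (l.succAbove j)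
  -- The vector field whose divergence is `dβ` on the standard frame: its `l`-th component is
  -- `(-1)^l` times `β` with the `l`-th frame vector omitted.
  set f : (Fin (k + 1) → ℝ) → Fin (k + 1) → ℝ := fun x l => (-1) ^ (l : ℕ) *
    β (WithLp.toLp 2 x) (ev l)
  set L : (Fin (k + 1) → ℝ) →L[ℝ] Euc (k + 1) :=
    (PiLp.continuousLinearEquiv 2 ℝ (fun _ : Fin (k + 1) => ℝ)).symm.toContinuousLinearMap
  set f' : (Fin (k + 1) → ℝ) → (Fin (k + 1) → ℝ) →L[ℝ] Fin (k + 1) → ℝ := fun x =>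
    ContinuousLinearMap.pi fun l => ((-1 : ℝ) ^ (l : ℕ)) •
      (fderivWithin ℝ (fun y => β y (ev l)) Q (WithLp.toLp 2 x)).comp L
  have hLs (l : Fin (k + 1)) : L (Pi.single l 1) = stdFrame (k + 1) l := by
    ext i
    simp [L, stdFrame]
  have hdiv : ∀ x ∈ box, ∑ l, f' x (Pi.single l 1) l =
      extDerivWithin β Q (WithLp.toLp 2 x) (stdFrame (k + 1)) := by
    intro x hx
    rw [extDerivWithin_apply ((hβ.differentiableOn (by simp)) _ (hbox x hx)) (hud _ (hbox x hx))]
    refine Finset.sum_congr rfl fun l _ => ?_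
    change (-1 : ℝ) ^ (l : ℕ) • fderivWithin ℝ (fun y => β y (ev l)) Q (WithLp.toLp 2 x)
      (L (Pi.single l 1)) = _
    rw [hLs, ← Int.cast_smul_eq_zsmul ℝ]
    push_cast
    rfl
  have hevd (l : Fin (k + 1)) : ContDiffOn ℝ ∞ (fun y => β y (ev l)) Q := fun y hy =>
    (hβ y hy).form_apply fun _ => contDiffWithinAt_const
  have h := integral_divergence_of_hasFDerivAt_off_countable (fun _ => 0) (fun _ => R)
    (fun _ => hR0.le) f f' ∅ Set.countable_empty ?_ ?_ ?_
  · rw [setIntegral_corner_eq_box hR (fun y hy hyK => by rw [hd y hy hyK]; rfl),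
      ← setIntegral_congr_fun measurableSet_Icc hdiv]
    refine h.trans (Finset.sum_congr rfl fun l _ => ?_)
    have hR' : ∀ z ∈ faceIncl l ⁻¹' K, ∀ i, z i < R := fun z hz i => by
      simpa using hR _ hz (l.succAbove i)
    rw [setIntegral_corner_eq_box hR' (fun z hz hzK => by
      rw [h0 _ (faceIncl_mem_range.2 hz) hzK]; rfl), ← MeasureTheory.integral_const_mul]
    -- Only the near faces `x_l = 0` contribute; as lower limits they carry the minus sign.
    have h2 : ∀ x ∈ Set.Icc ((fun _ => 0 : Fin (k + 1) → ℝ) ∘ l.succAbove)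
        ((fun _ => R) ∘ l.succAbove), f (l.insertNth R x) l = 0 := by
      intro x hx
      have h3 : WithLp.toLp 2 (l.insertNth R x : Fin (k + 1) → ℝ) ∉ K := fun hK' => by
        simpa using hR _ hK' l
      have h4 : WithLp.toLp 2 (l.insertNth R x : Fin (k + 1) → ℝ) ∈ Q := by
        rw [hQ, range_corner]
        intro i
        refine Fin.succAboveCases l ?_ (fun j => ?_) i
        · simpa using hR0.le
        · simpa using hx.1 j
      simp only [f]
      rw [h0 _ h4 h3]
      exact mul_zero _
    rw [setIntegral_congr_fun measurableSet_Icc h2, MeasureTheory.integral_zero, zero_sub]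
    rfl
  · refine continuousOn_pi.2 fun l => ContinuousOn.mul continuousOn_const ?_
    exact (hevd l).continuousOn.comp hto.continuousOn hbox
  · rintro x ⟨hx, -⟩
    have hxQ : WithLp.toLp 2 x ∈ interior Q := by
      rw [hQ, interior_range_corner]
      exact fun i => (hx i (Set.mem_univ i)).1
    refine hasFDerivAt_pi.2 fun l => ?_
    have h1 := ((hevd l).differentiableOn (by simp) _ (interior_subset hxQ)).hasFDerivWithinAt.hasFDerivAt
      (mem_interior_iff_mem_nhds.1 hxQ)
    have h2 : HasFDerivAt (WithLp.toLp 2 : (Fin (k + 1) → ℝ) → Euc (k + 1)) L x := L.hasFDerivAt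
    have h3 := (h1.comp x h2).const_mul ((-1 : ℝ) ^ (l : ℕ))
    exact h3
  · refine ContinuousOn.integrableOn_Icc ?_
    have : ContinuousOn (fun x : Fin (k + 1) → ℝ => ∑ l : Fin (k + 1), (-1 : ℝ) ^ (l : ℕ) *
        fderivWithin ℝ (fun y => β y (ev l)) Q (WithLp.toLp 2 x) (stdFrame (k + 1) l)) box := by
      refine continuousOn_finsetSum _ fun l _ => continuousOn_const.mul ?_
      exact (((hevd l).continuousOn_fderivWithin hud (by simp)).comp hto.continuousOn
        hbox).clm_apply continuousOn_const
    refine this.congr fun x hx => Finset.sum_congr rfl fun l _ => ?_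
    change (-1 : ℝ) ^ (l : ℕ) • fderivWithin ℝ (fun y => β y (ev l)) Q (WithLp.toLp 2 x)
      (L (Pi.single l 1)) = _
    rw [hLs]
    rfl

end Quadrant

/-! ### Outward vectors and maps into the boundary of a manifold with corners. -/

section BoundaryGeometry

theorem nonneg_of_isLocalMinOn {m : ℕ} {f : Euc m → ℝ} {f' : Euc m →L[ℝ] ℝ} {s : Set (Euc m)}
    (hs : Convex ℝ s) {p v : Euc m} (hp : p ∈ s) (hmin : IsLocalMinOn f s p)
    (hf : HasFDerivWithinAt f f' s p) {t : ℝ} (ht : 0 < t) (hv : p + t • v ∈ s) : 0 ≤ f' v := by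
  have h := hmin.hasFDerivWithinAt_nonneg hf
    (mem_posTangentConeAt_of_segment_subset (hs.segment_subset hp hv))
  rw [map_smul, smul_eq_mul] at h
  exact nonneg_of_mul_nonneg_right h ht

section Interior

variable {m : ℕ} {H : Type*} [TopologicalSpace H] {I : ModelWithCorners ℝ (Euc m) H}
  {X : Type*} [TopologicalSpace X] [ChartedSpace H X] [IsManifold I ∞ X]

theorem isInteriorPoint_iff_mem_interior_range {c x : X} (hx : x ∈ (extChartAt I c).source) :
    I.IsInteriorPoint x ↔ extChartAt I c x ∈ interior (Set.range I) := by
  rw [ModelWithCorners.isInteriorPoint_iff_of_mem_atlas (n := ∞) (by simp)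
    (chart_mem_atlas H c) (by simpa using hx)]
  constructor
  · exact fun h => interior_mono (extChartAt_target_subset_range c) h
  · intro h
    exact OpenPartialHomeomorph.mem_interior_extend_target _
      ((chartAt H c).map_source (by simpa using hx)) h

end Interior

variable {k : ℕ} {Y : Type*} [TopologicalSpace Y] [ChartedSpace (EuclideanQuadrant (k + 1)) Y]
  [IsManifold (Corner (k + 1)) ∞ Y]
  {X : Type*} [TopologicalSpace X] [ChartedSpace (EuclideanQuadrant k) X]
  [IsManifold (Corner k) ∞ X]

theorem nonneg_of_mem_target {m : ℕ} {X : Type*} [TopologicalSpace X]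
    [ChartedSpace (EuclideanQuadrant m) X] {c : X} {y : Euc m}
    (hy : y ∈ (extChartAt (Corner m) c).target) (l : Fin m) : 0 ≤ y l := by
  have := extChartAt_target_subset_range c hy
  rw [range_corner] at this
  exact this l

theorem exists_eq_zero_of_boundary {m : ℕ} {X : Type*} [TopologicalSpace X]
    [ChartedSpace (EuclideanQuadrant m) X] [IsManifold (Corner m) ∞ X] {c x : X}
    (hx : x ∈ (extChartAt (Corner m) c).source) (hb : x ∈ (Corner m).boundary X) :
    ∃ l, extChartAt (Corner m) c x l = 0 := by
  by_contra! h
  have hi : x ∈ (Corner m).interior X := by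
    refine (isInteriorPoint_iff_mem_interior_range hx).2 ?_
    rw [interior_range_corner]
    exact fun l => (nonneg_of_mem_target ((extChartAt (Corner m) c).map_source hx) l).lt_of_ne
      (h l).symm
  rw [← ModelWithCorners.compl_interior] at hb
  exact hb hi

theorem notMem_interior_iff {m : ℕ} {X : Type*} [TopologicalSpace X]
    [ChartedSpace (EuclideanQuadrant m) X] [IsManifold (Corner m) ∞ X] {c x : X}
    (hx : x ∈ (extChartAt (Corner m) c).source) :
    x ∉ (Corner m).interior X ↔ ∃ l, extChartAt (Corner m) c x l = 0 := by
  refine ⟨fun h => exists_eq_zero_of_boundary hx ?_, ?_⟩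
  · rw [← ModelWithCorners.compl_interior]
    exact h
  · rintro ⟨l, hl⟩ h
    have h1 := (isInteriorPoint_iff_mem_interior_range hx).1 h
    rw [interior_range_corner] at h1
    exact (h1 l).ne' hl

/-- A vector which points into the quadrant through the only face containing the point. -/
theorem exists_add_smul_mem_range {l : Fin (k + 1)} {p v : Euc (k + 1)}
    (hp : ∀ m, m ≠ l → 0 < p m) (hpl : p l = 0) (hv : 0 ≤ v l) :
    ∃ t : ℝ, 0 < t ∧ p + t • v ∈ Set.range (Corner (k + 1)) := by
  have h : ∀ m, ∀ᶠ t in 𝓝[>] (0 : ℝ), 0 ≤ p m + t * v m := by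
    intro m
    rcases eq_or_ne m l with rfl | hm
    · filter_upwards [self_mem_nhdsWithin] with t ht
      rw [hpl, zero_add]
      exact mul_nonneg (le_of_lt ht) hv
    · have h1 : Filter.Tendsto (fun t : ℝ => p m + t * v m) (𝓝[>] 0) (𝓝 (p m + 0 * v m)) :=
        (Continuous.tendsto (by fun_prop) 0).mono_left nhdsWithin_le_nhds
      have h2 : 0 < p m + 0 * v m := by simpa using hp m hm
      exact (h1.eventually_const_lt h2).mono fun t ht => le_of_lt ht
  obtain ⟨t, ht, ht0⟩ := ((Filter.eventually_all.2 h).and self_mem_nhdsWithin).exists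
  refine ⟨t, ht0, ?_⟩
  rw [range_corner]
  exact ht

/-- `IsOutward` is read in the chart at `q`, while `-e_l` is given in the chart at `c`. Every
coordinate of the new chart which vanishes at `q` is minimal there, so the derivative `D` of the
transition is nonnegative in that coordinate on vectors pointing into the face; surjectivity of `D`
makes it strictly positive on `e_l`. A small step along `D e_l` hence leads into the open quadrant.
-/
theorem isOutward_of_face {c q : Y} (hq : q ∈ (extChartAt (Corner (k + 1)) c).source)
    {l : Fin (k + 1)} (hl : extChartAt (Corner (k + 1)) c q l = 0)
    (hl' : ∀ m, m ≠ l → extChartAt (Corner (k + 1)) c q m ≠ 0)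
    {ν : TangentSpace (Corner (k + 1)) q}
    (hν : chartDeriv (Corner (k + 1)) c q ν = -stdFrame (k + 1) l) : IsOutward q ν := by
  set p := extChartAt (Corner (k + 1)) c q with hp
  have hpt : p ∈ (extChartAt (Corner (k + 1)) c).target := (extChartAt (Corner (k + 1)) c).map_source hq
  have hqp : (extChartAt (Corner (k + 1)) c).symm p = q := (extChartAt (Corner (k + 1)) c).left_inv hq
  have hpos : ∀ m, m ≠ l → 0 < p m := fun m hm => (nonneg_of_mem_target hpt m).lt_of_ne (hl' m hm).symm
  -- `A` inverts the differential of the chart at `c`. The preferred chart at `q` has identity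
  -- differential there, so `A` is also the derivative of the transition.
  obtain ⟨A, hA, hAinv⟩ : ∃ A : Euc (k + 1) →L[ℝ] TangentSpace (Corner (k + 1)) q,
      (∀ v, A (chartDeriv (Corner (k + 1)) c q v) = v) ∧
      HasFDerivWithinAt (written (Corner (k + 1)) (Corner (k + 1)) id c q)
        ((chartDeriv (Corner (k + 1)) q q).comp A) (Set.range (Corner (k + 1))) p := by
    have h1 := hasFDerivWithinAt_written (I' := Corner (k + 1)) (f := id) (c' := q) hpt
      mdifferentiableAt_id (by rw [hqp]; exact mem_extChartAt_source q)
    rw [mfderiv_id] at h1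
    have h2 := fun v => chartInv_chartDeriv_apply hpt v
    clear_value p
    subst hqp
    exact ⟨_, h2, h1⟩
  have hAv : ∀ v, chartDeriv (Corner (k + 1)) q q v = v := fun v => by rw [chartDeriv_self]; rfl
  have hA' : Function.Injective (chartDeriv (Corner (k + 1)) c q) :=
    Function.LeftInverse.injective hA
  have hAs : Function.Surjective A := fun v => ⟨_, hA v⟩
  set p' := extChartAt (Corner (k + 1)) q q with hp'
  have hp't : p' ∈ (extChartAt (Corner (k + 1)) q).target := mem_extChartAt_target q
  have hwp : written (Corner (k + 1)) (Corner (k + 1)) id c q p = p' := by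
    rw [written, hqp]
    rfl
  set D : Euc (k + 1) →L[ℝ] Euc (k + 1) := A with hD
  have hDs : Function.Surjective D := hAs
  have hνD : (show Euc (k + 1) from mfderiv (Corner (k + 1)) 𝓘(ℝ, Euc (k + 1))
      (extChartAt (Corner (k + 1)) q) q ν) = -D (stdFrame (k + 1) l) := by
    change chartDeriv (Corner (k + 1)) q q ν = _
    rw [hAv]
    have : A (chartDeriv (Corner (k + 1)) c q ν) = ν := hA ν
    rw [← this, hν]
    exact map_neg D _
  have hderiv : HasFDerivWithinAt (written (Corner (k + 1)) (Corner (k + 1)) id c q) D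
      (Set.range (Corner (k + 1))) p := by
    have e : (chartDeriv (Corner (k + 1)) q q).comp A = D := ContinuousLinearMap.ext fun v => hAv _
    rw [e] at hAinv
    exact hAinv
  -- the components of `D` which belong to vanishing coordinates
  have hnn : ∀ m, p' m = 0 → ∀ v : Euc (k + 1), 0 ≤ v l → 0 ≤ D v m := by
    intro m hm v hv
    obtain ⟨t, ht, htv⟩ := exists_add_smul_mem_range hpos hl hv
    have hmin : IsLocalMinOn (fun y => written (Corner (k + 1)) (Corner (k + 1)) id c q y m)
        (Set.range (Corner (k + 1))) p := by
      filter_upwards [eventually_mem_target (I' := Corner (k + 1)) continuous_id hpt (c' := q)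
        (by rw [hqp]; exact mem_extChartAt_source q)] with z hz
      rw [hwp, hm]
      exact nonneg_of_mem_target ((extChartAt (Corner (k + 1)) q).map_source hz.2) m
    have hd : HasFDerivWithinAt (fun y => written (Corner (k + 1)) (Corner (k + 1)) id c q y m)
        ((EuclideanSpace.proj m).comp D) (Set.range (Corner (k + 1))) p :=
      (EuclideanSpace.proj m : Euc (k + 1) →L[ℝ] ℝ).hasFDerivAt.comp_hasFDerivWithinAt p hderiv
    exact nonneg_of_isLocalMinOn (Corner (k + 1)).convex_range
      (extChartAt_target_subset_range c hpt) hmin hd ht htv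
  have hpos' : ∀ m, p' m = 0 → 0 < D (stdFrame (k + 1) l) m := by
    intro m hm
    -- On the hyperplane `u l = 0` both `u` and `-u` are admissible, so the `m`-th component of `D`
    -- vanishes there. Were it also zero on `e_l`, it would vanish identically, against
    -- surjectivity.
    refine (hnn m hm _ (by simp [stdFrame])).lt_of_ne fun h0 => ?_
    obtain ⟨v, hv⟩ := hDs (stdFrame (k + 1) m)
    have h1 : D v m = v l * D (stdFrame (k + 1) l) m := by
      have h2 : ∀ u : Euc (k + 1), u l = 0 → D u m = 0 := fun u hu => by
        have h3 := hnn m hm u hu.ge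
        have h4 := hnn m hm (-u) (by simp [hu])
        rw [map_neg] at h4
        have h5 : (-D u) m = -(D u m) := rfl
        rw [h5] at h4
        linarith
      have h6 := h2 (v - v l • stdFrame (k + 1) l) (by simp [stdFrame])
      rw [map_sub, map_smul] at h6
      have h7 : (D v - v l • D (stdFrame (k + 1) l)) m = D v m - v l * D (stdFrame (k + 1) l) m := rfl
      rw [h7] at h6
      linarith
    rw [← h0, mul_zero, hv] at h1
    simp [stdFrame] at h1
  have hev : ∀ m, ∀ᶠ t in 𝓝[>] (0 : ℝ), 0 < p' m + t * D (stdFrame (k + 1) l) m := by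
    intro m
    rcases (nonneg_of_mem_target hp't m).eq_or_lt with h0 | h0
    · filter_upwards [self_mem_nhdsWithin] with t ht
      rw [← h0, zero_add]
      exact mul_pos ht (hpos' m h0.symm)
    · have h1 : Filter.Tendsto (fun t : ℝ => p' m + t * D (stdFrame (k + 1) l) m) (𝓝[>] 0)
          (𝓝 (p' m + 0 * D (stdFrame (k + 1) l) m)) :=
        (Continuous.tendsto (by fun_prop) 0).mono_left nhdsWithin_le_nhds
      exact h1.eventually_const_lt (by simpa using h0)
  obtain ⟨δ, hδ, hδ'⟩ := mem_nhdsGT_iff_exists_Ioo_subset.1 (Filter.eventually_all.2 hev)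
  refine ⟨δ, hδ, fun t ht => ?_⟩
  rw [hνD, interior_range_corner]
  intro m
  rw [smul_neg, sub_neg_eq_add]
  exact hδ' ht m

/-- A face of the oriented boundary of a manifold with corners, up to the sign `s`. -/
structure IsFace (ΩX : OrientationForm (Corner k) X k)
    (ΩY : OrientationForm (Corner (k + 1)) Y (k + 1)) (s : ℝ) (i : X → Y) : Prop where
  smooth : ContMDiff (Corner k) (Corner (k + 1)) ∞ i
  boundary : ∀ x, i x ∈ (Corner (k + 1)).boundary Y
  injective : Function.Injective i
  immersive : ∀ x, Function.Injective (mfderiv (Corner k) (Corner (k + 1)) i x)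
  orientation : ∀ x ∈ (Corner k).interior X, ∀ ν : TangentSpace (Corner (k + 1)) (i x),
    IsOutward (i x) ν → ∀ v : Fin k → TangentSpace (Corner k) x, ΩX.form x v ≠ 0 →
      0 < s * ΩX.form x v * ΩY.form (i x)
        (Matrix.vecCons ν fun l => mfderiv (Corner k) (Corner (k + 1)) i x (v l))

variable {ΩX : OrientationForm (Corner k) X k} {ΩY : OrientationForm (Corner (k + 1)) Y (k + 1)}
  {s : ℝ} {i : X → Y}

/-- The differential of a map between manifolds with corners, in charts. -/
noncomputable def writtenDeriv (i : X → Y) (b : X) (c : Y) (y : Euc k) : Euc k →L[ℝ] Euc (k + 1) :=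
  fderivWithin ℝ (written (Corner k) (Corner (k + 1)) i b c) (Set.range (Corner k)) y

theorem IsFace.writtenDeriv_eq (h : IsFace ΩX ΩY s i) {b : X} {c : Y} {y : Euc k}
    (hy : y ∈ (extChartAt (Corner k) b).target)
    (hc : i ((extChartAt (Corner k) b).symm y) ∈ (extChartAt (Corner (k + 1)) c).source) :
    writtenDeriv i b c y = (chartDeriv (Corner (k + 1)) c (i ((extChartAt (Corner k) b).symm y))).comp
      ((mfderiv (Corner k) (Corner (k + 1)) i ((extChartAt (Corner k) b).symm y)).comp
        (chartInv (Corner k) b y)) :=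
  fderivWithin_written hy (h.smooth.mdifferentiable (by simp) _) hc

theorem IsFace.hasFDerivWithinAt (h : IsFace ΩX ΩY s i) {b : X} {c : Y} {y : Euc k}
    (hy : y ∈ (extChartAt (Corner k) b).target)
    (hc : i ((extChartAt (Corner k) b).symm y) ∈ (extChartAt (Corner (k + 1)) c).source) :
    HasFDerivWithinAt (written (Corner k) (Corner (k + 1)) i b c) (writtenDeriv i b c y)
      (Set.range (Corner k)) y := by
  rw [h.writtenDeriv_eq hy hc]
  exact hasFDerivWithinAt_written hy (h.smooth.mdifferentiable (by simp) _) hc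

theorem chartDeriv_injective {c x : Y} (hx : x ∈ (extChartAt (Corner (k + 1)) c).source) :
    Function.Injective (chartDeriv (Corner (k + 1)) c x) := by
  obtain ⟨y, hy, rfl⟩ : ∃ y ∈ (extChartAt (Corner (k + 1)) c).target,
      (extChartAt (Corner (k + 1)) c).symm y = x :=
    ⟨_, (extChartAt (Corner (k + 1)) c).map_source hx, (extChartAt (Corner (k + 1)) c).left_inv hx⟩
  exact Function.LeftInverse.injective (chartInv_chartDeriv_apply hy)

theorem IsFace.writtenDeriv_injective (h : IsFace ΩX ΩY s i) {b : X} {c : Y} {y : Euc k}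
    (hy : y ∈ (extChartAt (Corner k) b).target)
    (hc : i ((extChartAt (Corner k) b).symm y) ∈ (extChartAt (Corner (k + 1)) c).source) :
    Function.Injective (writtenDeriv i b c y) := by
  rw [h.writtenDeriv_eq hy hc]
  exact ((chartDeriv_injective hc).comp (h.immersive _)).comp
    (Function.LeftInverse.injective (chartDeriv_chartInv_apply hy))

/-- The `l`-th coordinate of the map is nonnegative and attains the value zero at an interior point;
this is a minimum, so its derivative vanishes. -/
theorem IsFace.writtenDeriv_apply_eq_zero (h : IsFace ΩX ΩY s i) {b : X} {c : Y} {y : Euc k}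
    (hy : y ∈ (extChartAt (Corner k) b).target) (hyi : y ∈ interior (Set.range (Corner k)))
    (hc : i ((extChartAt (Corner k) b).symm y) ∈ (extChartAt (Corner (k + 1)) c).source)
    {l : Fin (k + 1)} (hl : written (Corner k) (Corner (k + 1)) i b c y l = 0) (v : Euc k) :
    writtenDeriv i b c y v l = 0 := by
  have hr : Set.range (Corner k) ∈ 𝓝 y := mem_interior_iff_mem_nhds.1 hyi
  have hd : HasFDerivAt (fun z => written (Corner k) (Corner (k + 1)) i b c z l)
      ((EuclideanSpace.proj l).comp (writtenDeriv i b c y)) y :=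
    (EuclideanSpace.proj l : Euc (k + 1) →L[ℝ] ℝ).hasFDerivAt.comp y
      ((h.hasFDerivWithinAt hy hc).hasFDerivAt hr)
  have hmin : IsLocalMin (fun z => written (Corner k) (Corner (k + 1)) i b c z l) y := by
    have h1 := eventually_mem_target (I' := Corner (k + 1)) h.smooth.continuous hy hc
    rw [nhdsWithin_eq_nhds.2 hr] at h1
    filter_upwards [h1] with z hz
    rw [hl]
    exact nonneg_of_mem_target ((extChartAt (Corner (k + 1)) c).map_source hz.2) l
  have := hmin.hasFDerivAt_eq_zero hd
  exact congrArg (fun f => f v) this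

/-- If two coordinates vanished, the injective derivative would map `ℝ^k` into a subspace of
codimension two in `ℝ^(k+1)`. Interior points of a piece thus avoid the corners. -/
theorem IsFace.eq_of_eq_zero (h : IsFace ΩX ΩY s i) {b : X} {c : Y} {y : Euc k}
    (hy : y ∈ (extChartAt (Corner k) b).target) (hyi : y ∈ interior (Set.range (Corner k)))
    (hc : i ((extChartAt (Corner k) b).symm y) ∈ (extChartAt (Corner (k + 1)) c).source)
    {l m : Fin (k + 1)} (hl : written (Corner k) (Corner (k + 1)) i b c y l = 0)
    (hm : written (Corner k) (Corner (k + 1)) i b c y m = 0) : m = l := by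
  by_contra hml
  obtain ⟨j, rfl⟩ := Fin.exists_succAbove_eq hml
  have hz := fun v => h.writtenDeriv_apply_eq_zero hy hyi hc hl v
  have hz' := fun v => h.writtenDeriv_apply_eq_zero hy hyi hc hm v
  set f : Euc k →ₗ[ℝ] Euc k := ((faceProj l).comp (writtenDeriv i b c y)).toLinearMap
  have hf : Function.Injective f := by
    intro v w hvw
    apply h.writtenDeriv_injective hy hc
    rw [← faceIncl_faceProj (hz v), ← faceIncl_faceProj (hz w)]
    exact congrArg (faceIncl l) hvw
  obtain ⟨v, hv⟩ := LinearMap.injective_iff_surjective.1 hf (stdFrame k j)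
  have h1 : f v j = 0 := hz' v
  rw [hv] at h1
  simp [stdFrame] at h1

end BoundaryGeometry

/-! ### Integrals over boundary pieces in the face coordinates of a chart. -/

section FaceIntegrals

open MeasureTheory

variable {k : ℕ} {Y : Type*} [TopologicalSpace Y] [ChartedSpace (EuclideanQuadrant (k + 1)) Y]
  [IsManifold (Corner (k + 1)) ∞ Y]
  {X : Type*} [TopologicalSpace X] [ChartedSpace (EuclideanQuadrant k) X]
  [IsManifold (Corner k) ∞ X]
  {ΩX : OrientationForm (Corner k) X k} {ΩY : OrientationForm (Corner (k + 1)) Y (k + 1)}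
  {s : ℝ} {i : X → Y}

/-- The interior points which are mapped to the `l`-th face in the chart at `c`. -/
def faceSet (i : X → Y) (c : Y) (l : Fin (k + 1)) : Set X :=
  {x | x ∈ (Corner k).interior X ∧ i x ∈ (extChartAt (Corner (k + 1)) c).source ∧
    extChartAt (Corner (k + 1)) c (i x) l = 0}

/-- The coordinates which the chart at `c` induces on its `l`-th face. -/
noncomputable def faceCoord (i : X → Y) (c : Y) (l : Fin (k + 1)) (x : X) : Euc k :=
  faceProj l (extChartAt (Corner (k + 1)) c (i x))

/-- The density which a form of codimension one induces on the `l`-th face of a chart. -/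
noncomputable def faceDensity (ΩY : OrientationForm (Corner (k + 1)) Y (k + 1))
    (η : DForm (Corner (k + 1)) Y k) (c : Y) (l : Fin (k + 1)) (z : Euc k) : ℝ :=
  -((-1) ^ (l : ℕ) *
    (((SignType.sign (ΩY.form.inChart c (faceIncl l z) (stdFrame (k + 1))) : SignType) : ℝ) *
      η.inChart c (faceIncl l z) fun j => stdFrame (k + 1) (l.succAbove j)))

theorem faceIncl_faceCoord {c : Y} {l : Fin (k + 1)} {x : X} (hx : x ∈ faceSet i c l) :
    faceIncl l (faceCoord i c l x) = extChartAt (Corner (k + 1)) c (i x) :=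
  faceIncl_faceProj hx.2.2

/-- Moving `e_l` from the first to the `l`-th position costs `(-1)^l`; the minus sign is that of the
outward vector `-e_l`. -/
theorem topForm_vecCons_face (α : Euc (k + 1) [⋀^Fin (k + 1)]→L[ℝ] ℝ) (l : Fin (k + 1))
    (T : Euc k →L[ℝ] Euc k) :
    α (Matrix.vecCons (-stdFrame (k + 1) l) fun j => faceIncl l (T (stdFrame k j))) =
      -((-1) ^ (l : ℕ) * (T.det * α (stdFrame (k + 1)))) := by
  have h1 := topForm_comp_stdFrame
    ((α.curryLeft (-stdFrame (k + 1) l)).compContinuousLinearMap (faceIncl l)) T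
  change α (Matrix.vecCons (-stdFrame (k + 1) l) fun j => faceIncl l (T (stdFrame k j))) =
    T.det * (α.curryLeft (-stdFrame (k + 1) l)) (fun j => faceIncl l (stdFrame k j)) at h1
  rw [h1, map_neg]
  simp only [faceIncl_stdFrame]
  have h2 : (α.curryLeft (stdFrame (k + 1) l)) (fun j => stdFrame (k + 1) (l.succAbove j)) =
      (-1) ^ (l : ℕ) * α (stdFrame (k + 1)) := by
    have h3 := α.toAlternatingMap.neg_one_pow_smul_map_insertNth l (stdFrame (k + 1) l)
      fun j => stdFrame (k + 1) (l.succAbove j)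
    have h4 : l.insertNth (stdFrame (k + 1) l) (fun j => stdFrame (k + 1) (l.succAbove j)) =
        stdFrame (k + 1) := Fin.insertNth_self_removeNth l (stdFrame (k + 1))
    rw [h4, ← Int.cast_smul_eq_zsmul ℝ] at h3
    push_cast at h3
    exact h3.symm
  change T.det * (-(α.curryLeft (stdFrame (k + 1) l)) _) = _
  rw [h2]
  ring

/-- The hypothesis says that the signs of `a`, `d` and `e` multiply to `u`. It will be the outward
normal rule, with `d` the Jacobian and `a`, `e` the two orientation forms. -/
theorem sign_mul_eq_of_pos {a d e u : ℝ} (hu : u = 1 ∨ u = -1) (h : 0 < u * a * (d * e)) :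
    ((SignType.sign a : SignType) : ℝ) * d = |d| * (u * ((SignType.sign e : SignType) : ℝ)) := by
  have ha : a ≠ 0 := by rintro rfl; simp at h
  have he : e ≠ 0 := by rintro rfl; simp at h
  have h1 : |a| * |d| * |e| = u * a * (d * e) := by
    rw [← abs_of_pos h]
    rcases hu with rfl | rfl <;> simp [abs_mul, mul_assoc]
  have hu2 : u * u = 1 := by rcases hu with rfl | rfl <;> norm_num
  have h2 := sign_mul_abs a
  have h3 := sign_mul_abs e
  have h4 : |e| * |e| = e * e := abs_mul_abs_self e
  refine mul_right_cancel₀ (mul_ne_zero (abs_ne_zero.2 ha) (mul_ne_zero (abs_ne_zero.2 he)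
    (abs_ne_zero.2 he))) ?_
  calc _ = ((SignType.sign a : SignType) : ℝ) * |a| * d * (|e| * |e|) := by ring
    _ = (u * u) * a * d * e * e := by rw [h2, h4, hu2]; ring
    _ = (|a| * |d| * |e|) * u * e := by rw [h1]; ring
    _ = (|a| * |d| * |e|) * u * (((SignType.sign e : SignType) : ℝ) * |e|) := by rw [h3]
    _ = _ := by ring

/-- The derivative of `i` is tangent to the face and so factors through `faceIncl l`, with `T` the
Jacobian of `faceCoord`. Testing the boundary orientation on the outward vector `-e_l` fixes the
sign of `T.det`; what remains is the absolute Jacobian needed to integrate in face coordinates. -/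
theorem IsFace.chartDensity_pull (h : IsFace ΩX ΩY s i) (hs : s = 1 ∨ s = -1)
    (η : DForm (Corner (k + 1)) Y k) {b : X} {c : Y} {l : Fin (k + 1)} {y : Euc k}
    (hy : y ∈ (extChartAt (Corner k) b).target)
    (hx : (extChartAt (Corner k) b).symm y ∈ faceSet i c l) :
    chartDensity ΩX (η.pull (I := Corner k) i) b y =
      |((faceProj l).comp (writtenDeriv i b c y)).det| *
        (s * faceDensity ΩY η c l (faceCoord i c l ((extChartAt (Corner k) b).symm y))) := by
  have hyi : y ∈ interior (Set.range (Corner k)) := by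
    have := (isInteriorPoint_iff_mem_interior_range ((extChartAt (Corner k) b).map_target hy)).1 hx.1
    rwa [(extChartAt (Corner k) b).right_inv hy] at this
  set T := (faceProj l).comp (writtenDeriv i b c y) with hT
  have hD (v : Euc k) : writtenDeriv i b c y v = faceIncl l (T v) :=
    (faceIncl_faceProj (h.writtenDeriv_apply_eq_zero hy hyi hx.2.1 hx.2.2 v)).symm
  set x := (extChartAt (Corner k) b).symm y with hxy
  set p := extChartAt (Corner (k + 1)) c (i x) with hp
  have hpt : p ∈ (extChartAt (Corner (k + 1)) c).target :=
    (extChartAt (Corner (k + 1)) c).map_source hx.2.1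
  have h1 : (η.pull (I := Corner k) i).inChart b y (stdFrame k) =
      T.det * η.inChart c p fun j => stdFrame (k + 1) (l.succAbove j) := by
    rw [inChart_pull η hy (h.smooth.mdifferentiable (by simp) _) hx.2.1]
    change η.inChart c p (fun j => writtenDeriv i b c y (stdFrame k j)) = _
    simp only [hD]
    have := topForm_comp_stdFrame ((η.inChart c p).compContinuousLinearMap (faceIncl l)) T
    refine this.trans ?_
    change _ * η.inChart c p (fun j => faceIncl l (stdFrame k j)) = _
    simp only [faceIncl_stdFrame]
  obtain ⟨ν, hν⟩ : ∃ ν : TangentSpace (Corner (k + 1)) (i x),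
      chartDeriv (Corner (k + 1)) c (i x) ν = -stdFrame (k + 1) l := by
    have h2 := chartDeriv_chartInv_apply hpt (-stdFrame (k + 1) l)
    have h3 : (extChartAt (Corner (k + 1)) c).symm p = i x :=
      (extChartAt (Corner (k + 1)) c).left_inv hx.2.1
    rw [← h3]
    exact ⟨_, h2⟩
  have hout : IsOutward (i x) ν := by
    refine isOutward_of_face hx.2.1 hx.2.2 (fun m hm hm0 => hm ?_) hν
    exact h.eq_of_eq_zero hy hyi hx.2.1 hx.2.2 hm0
  have ha := inChart_stdFrame_ne_zero ΩX hy
  have h4 := h.orientation x hx.1 ν hout (fun j => chartInv (Corner k) b y (stdFrame k j)) ha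
  have h5 : ΩY.form (i x) (Matrix.vecCons ν fun j => mfderiv (Corner k) (Corner (k + 1)) i x
      (chartInv (Corner k) b y (stdFrame k j))) =
      -((-1) ^ (l : ℕ) * (T.det * ΩY.form.inChart c p (stdFrame (k + 1)))) := by
    rw [← topForm_vecCons_face, eq_inChart_comp_chartDeriv ΩY.form hx.2.1]
    rw [ContinuousAlternatingMap.compContinuousLinearMap_apply]
    congr 1
    ext1 j
    refine Fin.cases hν (fun j => ?_) j
    have h6 := hD (stdFrame k j)
    rw [h.writtenDeriv_eq hy hx.2.1] at h6
    exact h6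
  rw [h5] at h4
  have hu : -(s * (-1) ^ (l : ℕ)) = 1 ∨ -(s * (-1) ^ (l : ℕ)) = -1 := by
    rcases hs with rfl | rfl <;> rcases neg_one_pow_eq_or ℝ (l : ℕ) with h6 | h6 <;> simp [h6]
  have h7 := sign_mul_eq_of_pos hu (a := ΩX.form.inChart b y (stdFrame k)) (d := T.det)
    (e := ΩY.form.inChart c p (stdFrame (k + 1))) (lt_of_lt_of_eq h4 (by
      change s * ΩX.form.inChart b y (stdFrame k) * _ = _
      ring))
  rw [chartDensity, h1, ← mul_assoc, h7, faceDensity, faceIncl_faceCoord hx]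
  ring

theorem IsFace.measurableSet_faceSet (h : IsFace ΩX ΩY s i) (b : X) (c : Y) (l : Fin (k + 1)) :
    MeasurableSet ((extChartAt (Corner k) b).target ∩
      (extChartAt (Corner k) b).symm ⁻¹' (faceSet i c l)) := by
  set A := ((extChartAt (Corner k) b).target ∩ (extChartAt (Corner k) b).symm ⁻¹'
    (i ⁻¹' (extChartAt (Corner (k + 1)) c).source)) ∩ interior (Set.range (Corner k)) with hA
  have hAm : MeasurableSet A := (measurableSet_target_inter
    ((isOpen_extChartAt_source c).preimage h.smooth.continuous) b).inter isOpen_interior.measurableSet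
  have hc : ContinuousOn (fun y => written (Corner k) (Corner (k + 1)) i b c y l) A := by
    intro y hy
    have h1 := (contDiffWithinAt_written h.smooth hy.1.1 hy.1.2).continuousWithinAt
    exact ((EuclideanSpace.proj l : Euc (k + 1) →L[ℝ] ℝ).continuous.continuousAt.comp_continuousWithinAt
      h1).mono (Set.inter_subset_right.trans interior_subset)
  obtain ⟨u, hu, hu'⟩ := continuousOn_iff_isClosed.1 hc {0} isClosed_singleton
  have h2 : (extChartAt (Corner k) b).target ∩
      (extChartAt (Corner k) b).symm ⁻¹' (faceSet i c l) = u ∩ A := by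
    rw [← hu']
    ext y
    constructor
    · rintro ⟨hy, hx⟩
      have := (isInteriorPoint_iff_mem_interior_range ((extChartAt (Corner k) b).map_target hy)).1 hx.1
      rw [(extChartAt (Corner k) b).right_inv hy] at this
      exact ⟨hx.2.2, ⟨hy, hx.2.1⟩, this⟩
    · rintro ⟨hy0, ⟨hy, hyc⟩, hyi⟩
      refine ⟨hy, ?_, hyc, hy0⟩
      refine (isInteriorPoint_iff_mem_interior_range ((extChartAt (Corner k) b).map_target hy)).2 ?_
      rwa [(extChartAt (Corner k) b).right_inv hy]
  rw [h2]
  exact hu.measurableSet.inter hAm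

theorem IsFace.injOn_faceCoord (h : IsFace ΩX ΩY s i) (c : Y) (l : Fin (k + 1)) :
    Set.InjOn (faceCoord i c l) (faceSet i c l) := by
  intro x hx x' hx' hxx
  have h1 := congrArg (faceIncl l) hxx
  rw [faceIncl_faceCoord hx, faceIncl_faceCoord hx'] at h1
  exact h.injective ((extChartAt (Corner (k + 1)) c).injOn hx.2.1 hx'.2.1 h1)

theorem ae_apply_ne_zero (k : ℕ) : ∀ᵐ y : Euc k, ∀ j, y j ≠ 0 := by
  refine ae_all_iff.2 fun j => ?_
  have h1 : LinearMap.ker (EuclideanSpace.proj j : Euc k →L[ℝ] ℝ).toLinearMap ≠ ⊤ := by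
    intro h
    have h2 : stdFrame k j ∈ LinearMap.ker (EuclideanSpace.proj j : Euc k →L[ℝ] ℝ).toLinearMap := by
      rw [h]
      trivial
    rw [LinearMap.mem_ker] at h2
    simp [stdFrame] at h2
  rw [ae_iff]
  refine measure_mono_null (fun y hy => ?_) (Measure.addHaar_submodule volume _ h1)
  have h3 : y j = 0 := not_not.1 hy
  exact h3

theorem ae_symm_mem_interior {m : ℕ} {X : Type*} [TopologicalSpace X]
    [ChartedSpace (EuclideanQuadrant m) X] [IsManifold (Corner m) ∞ X] (b : X) :
    ∀ᵐ y : Euc m, y ∈ (extChartAt (Corner m) b).target →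
      (extChartAt (Corner m) b).symm y ∈ (Corner m).interior X := by
  filter_upwards [ae_apply_ne_zero m] with y hy hyt
  by_contra h
  obtain ⟨l, hl⟩ := (notMem_interior_iff ((extChartAt (Corner m) b).map_target hyt)).1 h
  rw [(extChartAt (Corner m) b).right_inv hyt] at hl
  exact hy l hl

variable [T2Space X] [CompactSpace X]

theorem IsFace.integralOn_faceSet (h : IsFace ΩX ΩY s i) (hs : s = 1 ∨ s = -1)
    {η : DForm (Corner (k + 1)) Y k} (hη : η.Smooth) (c : Y) (l : Fin (k + 1)) :
    integralOn ΩX (faceSet i c l) (η.pull (I := Corner k) i) =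
        s * ∫ z in faceCoord i c l '' faceSet i c l, faceDensity ΩY η c l z ∧
      IntegrableOn (faceDensity ΩY η c l) (faceCoord i c l '' faceSet i c l) ∧
      MeasurableSet (faceCoord i c l '' faceSet i c l) := by
  have hc : (η.pull (I := Corner k) i).Cont := DForm.Smooth.cont fun x => (hη (i x)).pull h.smooth
  obtain ⟨h1, h2, h3⟩ := integralOn_eq_of_parametrisation ΩX hc
    (fun b => h.measurableSet_faceSet b c l) (h.injOn_faceCoord c l)
    (f' := fun b y => (faceProj l).comp (writtenDeriv i b c y))
    (g := fun z => s * faceDensity ΩY η c l z)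
    (fun b y hy => (((faceProj l).hasFDerivAt).comp_hasFDerivWithinAt y
      (h.hasFDerivWithinAt hy.1 hy.2.2.1)).mono
        (Set.inter_subset_left.trans (extChartAt_target_subset_range b)))
    (fun b y hy => h.chartDensity_pull hs η hy.1 hy.2)
  refine ⟨h1.trans (MeasureTheory.integral_const_mul _ _), ?_, h3⟩
  have h4 : faceDensity ΩY η c l = fun z => s * (s * faceDensity ΩY η c l z) := by
    ext z
    rcases hs with rfl | rfl <;> ring
  rw [h4]
  exact Integrable.const_mul h2 s

/-- An interior point of `X` mapped into the chart lies on a unique face by `IsFace.eq_of_eq_zero`,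
and elsewhere the form vanishes; the boundary of `X` is null. -/
theorem IsFace.integral_pull (h : IsFace ΩX ΩY s i) (hs : s = 1 ∨ s = -1)
    {η : DForm (Corner (k + 1)) Y k} (hη : η.Smooth) {c : Y}
    (h0 : ∀ q ∉ (extChartAt (Corner (k + 1)) c).source, η q = 0) :
    integral ΩX (η.pull (I := Corner k) i) =
      ∑ l, s * ∫ z in faceCoord i c l '' faceSet i c l, faceDensity ΩY η c l z := by
  have hc : (η.pull (I := Corner k) i).Cont := DForm.Smooth.cont fun x => (hη (i x)).pull h.smooth
  rw [integral_eq_sum_integralOn ΩX hc (fun l => faceSet i c l)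
    (fun l b => h.measurableSet_faceSet b c l)]
  · exact Finset.sum_congr rfl fun l _ => (h.integralOn_faceSet hs hη c l).1
  · intro l l' hl
    refine Set.disjoint_left.2 fun x hx hx' => hl ?_
    have hs := mem_extChartAt_source (I := Corner k) x
    have h1 := extChartAt_to_inv (I := Corner k) x
    refine h.eq_of_eq_zero (b := x) (c := c) (mem_extChartAt_target x)
      ((isInteriorPoint_iff_mem_interior_range hs).1 hx.1) ?_ ?_ ?_
    · rw [h1]
      exact hx.2.1
    · rw [written, h1]
      exact hx'.2.2
    · rw [written, h1]
      exact hx.2.2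
  · intro b
    filter_upwards [ae_symm_mem_interior b] with y hy hyt hyU
    by_cases hyc : i ((extChartAt (Corner k) b).symm y) ∈ (extChartAt (Corner (k + 1)) c).source
    · obtain ⟨l, hl⟩ := exists_eq_zero_of_boundary hyc (h.boundary _)
      exact (hyU l ⟨hy hyt, hyc, hl⟩).elim
    · rw [DForm.pull, h0 _ hyc]
      rfl

/-- The boundary of `X` is null in finitely many charts covering `X`, and differentiable maps
between spaces of equal dimension preserve null sets. Points of a face reached only from the
boundary of a piece are therefore negligible. -/
theorem IsFace.ae_notMem_image (h : IsFace ΩX ΩY s i) (c : Y) (l : Fin (k + 1)) :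
    ∀ᵐ z : Euc k, ∀ x, i x ∈ (extChartAt (Corner (k + 1)) c).source → faceCoord i c l x = z →
      x ∈ (Corner k).interior X := by
  set V : X → Set (Euc k) := fun b => (extChartAt (Corner k) b).target ∩
    (extChartAt (Corner k) b).symm ⁻¹' (i ⁻¹' (extChartAt (Corner (k + 1)) c).source) ∩
      {y | ∃ j, y j = 0} with hV
  have hnull (b : X) : volume ((fun y => faceCoord i c l ((extChartAt (Corner k) b).symm y)) ''
      V b) = 0 := by
    refine addHaar_image_eq_zero_of_differentiableOn_of_addHaar_eq_zero volume ?_ ?_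
    · intro y hy
      exact ((((faceProj l).hasFDerivAt).comp_hasFDerivWithinAt y
        (h.hasFDerivWithinAt hy.1.1 hy.1.2)).mono ((Set.inter_subset_left.trans
          Set.inter_subset_left).trans (extChartAt_target_subset_range b))).differentiableWithinAt
    · refine measure_mono_null (Set.inter_subset_right) ?_
      have := ae_iff.1 (ae_apply_ne_zero k)
      simpa only [not_forall, not_not, ne_eq] using this
  have h1 : ∀ᵐ z : Euc k, ∀ b ∈ chartSet (Corner k) X,
      z ∉ (fun y => faceCoord i c l ((extChartAt (Corner k) b).symm y)) '' V b :=
    (Filter.eventually_all_finset _).2 fun b _ => measure_eq_zero_iff_ae_notMem.1 (hnull b)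
  filter_upwards [h1] with z hz x hx hxz
  by_contra hi
  obtain ⟨b, hb, hb0⟩ := Finset.exists_ne_zero_of_sum_ne_zero
    ((sum_partitionOfUnity (Corner k) X x).trans_ne one_ne_zero)
  have hxb : x ∈ (extChartAt (Corner k) b).source := by
    by_contra hn
    exact hb0 (partitionOfUnity_eq_zero hn)
  obtain ⟨j, hj⟩ := (notMem_interior_iff hxb).1 hi
  refine hz b hb ⟨extChartAt (Corner k) b x, ⟨⟨(extChartAt (Corner k) b).map_source hxb, ?_⟩, j, hj⟩, ?_⟩
  · change i ((extChartAt (Corner k) b).symm (extChartAt (Corner k) b x)) ∈ (extChartAt (Corner (k + 1)) c).source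
    rw [(extChartAt (Corner k) b).left_inv hxb]
    exact hx
  · change faceCoord i c l ((extChartAt (Corner k) b).symm (extChartAt (Corner k) b x)) = z
    rw [(extChartAt (Corner k) b).left_inv hxb]
    exact hxz

end FaceIntegrals

/-! ### Linearity and locality of the exterior derivative. -/

section ExteriorDerivative

variable {E H : Type*} [NormedAddCommGroup E] [NormedSpace ℝ E] [FiniteDimensional ℝ E]
  [TopologicalSpace H]
  {I : ModelWithCorners ℝ E H} {X : Type*} [TopologicalSpace X] [ChartedSpace H X]
  [IsManifold I ∞ X]

theorem DForm.d_sum {ι : Type*} (t : Finset ι) {p : ℕ} {η : ι → DForm I X p}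
    (hη : ∀ j ∈ t, (η j).Smooth) (x : X) :
    DForm.d (fun y => ∑ j ∈ t, η j y) x = ∑ j ∈ t, (η j).d x := by
  simp only [DForm.d_eq]
  have h1 : DForm.inChart (fun y => ∑ j ∈ t, η j y) x = fun y => ∑ j ∈ t, (η j).inChart x y := by
    ext y v
    simp only [DForm.inChart_apply, ContinuousAlternatingMap.sum_apply]
  rw [h1, extDerivWithin, fderivWithin_fun_sum]
  · exact map_sum (ContinuousAlternatingMap.alternatizeUncurryFinCLM ℝ E ℝ) _ _
  · exact uniqueDiffWithinAt_range (mem_extChartAt_target x)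
  · exact fun j hj => (hη j hj x).differentiableWithinAt (by simp)

theorem DForm.Smooth.contDiffWithinAt_inChart {p : ℕ} {η : DForm I X p} (hη : η.Smooth) {c : X}
    {y : E} (hy : y ∈ (extChartAt I c).target) :
    ContDiffWithinAt ℝ ∞ (η.inChart c) (Set.range I) y := (hη _).contDiffWithinAt_inChart hy

theorem DForm.Smooth.smul {p : ℕ} {η : DForm I X p} (hη : η.Smooth) {f : X → ℝ}
    (hf : ContMDiff I 𝓘(ℝ, ℝ) ∞ f) : DForm.Smooth (fun x => f x • η x) := by
  intro x
  have h1 : DForm.inChart (fun x => f x • η x) x =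
      fun y => f ((extChartAt I x).symm y) • η.inChart x y := by
    ext y v
    rfl
  rw [DForm.SmoothAt, h1]
  have h2 : ContMDiffWithinAt 𝓘(ℝ, E) 𝓘(ℝ, ℝ) ∞ (fun y => f ((extChartAt I x).symm y))
      (Set.range I) (extChartAt I x x) :=
    (hf _).comp_contMDiffWithinAt _
      (contMDiffWithinAt_extChartAt_symm_range x (mem_extChartAt_target x))
  exact (contMDiffWithinAt_iff_contDiffWithinAt.1 h2).smul (hη x)

theorem DForm.d_eq_zero_of_eventually {p : ℕ} {η : DForm I X p} {x : X}
    (h : ∀ᶠ y in 𝓝 x, η y = 0) : η.d x = 0 := by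
  rw [DForm.d_eq]
  have h1 : η.inChart x =ᶠ[𝓝[Set.range I] extChartAt I x x] fun _ => 0 := by
    have h2 := (continuousAt_extChartAt_symm (I := I) x)
    rw [ContinuousAt, extChartAt_to_inv] at h2
    filter_upwards [mem_nhdsWithin_of_mem_nhds (h2 h)] with y hy
    rw [DForm.inChart_def, show η ((extChartAt I x).symm y) = 0 from hy]
    rfl
  rw [h1.extDerivWithin_eq_of_mem (extChartAt_target_subset_range x (mem_extChartAt_target x))]
  ext v
  rw [extDerivWithin_apply (differentiableWithinAt_const _)
    (uniqueDiffWithinAt_range (mem_extChartAt_target x))]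
  simp
  rfl

end ExteriorDerivative

/-! ### Stokes' theorem for two boundary pieces. -/

section Stokes

open MeasureTheory

theorem DForm.Smooth.cont_d {m p : ℕ} {H : Type*} [TopologicalSpace H]
    {I : ModelWithCorners ℝ (Euc m) H} {X : Type*} [TopologicalSpace X] [ChartedSpace H X]
    [IsManifold I ∞ X] {η : DForm I X p} (hη : η.Smooth) : η.d.Cont := by
  intro c y hy
  have h1 : ContinuousWithinAt (extDerivWithin (η.inChart c) (Set.range I)) (Set.range I) y := by
    have h2 := ((hη.contDiffWithinAt_inChart hy).fderivWithin_right (m := 0) I.uniqueDiffOn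
      (by simp) (extChartAt_target_subset_range c hy)).continuousWithinAt
    exact (ContinuousAlternatingMap.alternatizeUncurryFinCLM ℝ (Euc m) ℝ).continuous.continuousAt.comp_continuousWithinAt h2
  exact (h1.mono (extChartAt_target_subset_range c)).congr
    (fun z hz => DForm.inChart_d hz (hη _)) (DForm.inChart_d hy (hη _))

variable {k : ℕ} {Y : Type*} [TopologicalSpace Y] [ChartedSpace (EuclideanQuadrant (k + 1)) Y]
  [IsManifold (Corner (k + 1)) ∞ Y] [T2Space Y] [CompactSpace Y]
  {X : Type*} [TopologicalSpace X] [ChartedSpace (EuclideanQuadrant k) X]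
  [IsManifold (Corner k) ∞ X] [T2Space X] [CompactSpace X]
  {X' : Type*} [TopologicalSpace X'] [ChartedSpace (EuclideanQuadrant k) X']
  [IsManifold (Corner k) ∞ X'] [T2Space X'] [CompactSpace X']
  {ΩX : OrientationForm (Corner k) X k} {ΩX' : OrientationForm (Corner k) X' k}
  {ΩY : OrientationForm (Corner (k + 1)) Y (k + 1)}
  {i : X → Y} {i' : X' → Y}

/-- For a form supported inside one chart, extension by zero leads to the quadrant, where Stokes'
theorem is the divergence theorem. -/
theorem integral_d_eq_sum_faces (ΩY : OrientationForm (Corner (k + 1)) Y (k + 1))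
    {η : DForm (Corner (k + 1)) Y k} (hη : η.Smooth) {c : Y} {K : Set Y} (hK : IsClosed K)
    (hKc : K ⊆ (extChartAt (Corner (k + 1)) c).source) (h0 : ∀ q ∉ K, η q = 0) :
    integral ΩY η.d = ∑ l : Fin (k + 1),
      ∫ z in faceIncl l ⁻¹' (extChartAt (Corner (k + 1)) c).target, faceDensity ΩY η c l z := by
  classical
  set Q := Set.range (Corner (k + 1)) with hQ
  set tg := (extChartAt (Corner (k + 1)) c).target with htg
  have htm : MeasurableSet tg := measurableSet_extChartAt_target c
  have htQ : tg ⊆ Q := extChartAt_target_subset_range c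
  set sg : Euc (k + 1) → ℝ := fun y =>
    ((SignType.sign (ΩY.form.inChart c y (stdFrame (k + 1))) : SignType) : ℝ) with hsg
  -- The orientation sign can be put inside the form because it is locally constant and commutes
  -- with `d`. The extension by zero stays smooth since the support is compact in the chart target.
  set β : Euc (k + 1) → Euc (k + 1) [⋀^Fin k]→L[ℝ] ℝ := fun y =>
    if y ∈ tg then sg y • η.inChart c y else 0 with hβ
  set KE : Set (Euc (k + 1)) := extChartAt (Corner (k + 1)) c '' K with hKE
  have hKEc : IsCompact KE := hK.isCompact.image_of_continuousOn
    ((continuousOn_extChartAt c).mono hKc)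
  have hη0 : ∀ y ∈ tg, y ∉ KE → η.inChart c y = 0 := by
    intro y hy hyK
    rw [DForm.inChart_def, h0 _ fun h => hyK ⟨_, h, (extChartAt (Corner (k + 1)) c).right_inv hy⟩]
    rfl
  have hβ0 : ∀ y ∉ KE, β y = 0 := by
    intro y hyK
    by_cases hy : y ∈ tg
    · simp only [hβ, if_pos hy, hη0 y hy hyK, smul_zero]
    · simp only [hβ, if_neg hy]
  have hloc : ∀ y ∈ tg, β =ᶠ[𝓝[Q] y] fun z => sg y • η.inChart c z := by
    intro y hy
    have hct : ContinuousWithinAt (fun z => SignType.sign (ΩY.form.inChart c z (stdFrame (k + 1))))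
        Q y := ((continuousOn_sign_orientation ΩY c) y hy).mono_of_mem_nhdsWithin
          (extChartAt_target_mem_nhdsWithin_of_mem hy)
    have h1 := hct.eventually (isOpen_discrete {SignType.sign (ΩY.form.inChart c y (stdFrame (k + 1)))} |>.mem_nhds rfl)
    filter_upwards [h1, extChartAt_target_mem_nhdsWithin_of_mem hy] with z hz hzt
    have hz' : SignType.sign (ΩY.form.inChart c z (stdFrame (k + 1))) =
      SignType.sign (ΩY.form.inChart c y (stdFrame (k + 1))) := hz
    simp only [hβ, htg, if_pos hzt, hsg, hz']
  have hβs : ContDiffOn ℝ ∞ β Q := by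
    intro y hyQ
    by_cases hy : y ∈ tg
    · exact ((hη.contDiffWithinAt_inChart hy).const_smul (sg y)).congr_of_eventuallyEq_of_mem
        (hloc y hy) hyQ
    · have hyK : y ∉ KE := by
        rintro ⟨x, hx, rfl⟩
        exact hy ((extChartAt (Corner (k + 1)) c).map_source (hKc hx))
      refine (contDiffWithinAt_const (c := (0 : Euc (k + 1) [⋀^Fin k]→L[ℝ] ℝ))).congr_of_eventuallyEq_of_mem ?_ hyQ
      filter_upwards [mem_nhdsWithin_of_mem_nhds (hKEc.isClosed.isOpen_compl.mem_nhds hyK)] with z hz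
      exact hβ0 z hz
  have hd : ∀ y ∈ tg, chartDensity ΩY η.d c y = extDerivWithin β Q y (stdFrame (k + 1)) := by
    intro y hy
    rw [(hloc y hy).extDerivWithin_eq_of_mem (htQ hy),
      extDerivWithin_fun_smul _ _ (uniqueDiffWithinAt_range hy), chartDensity,
      DForm.inChart_d hy (hη _)]
    rfl
  have hd0 : ∀ y ∈ Q \ tg, extDerivWithin β Q y (stdFrame (k + 1)) = 0 := by
    rintro y ⟨hyQ, hy⟩
    have hyK : y ∉ KE := by
      rintro ⟨x, hx, rfl⟩
      exact hy ((extChartAt (Corner (k + 1)) c).map_source (hKc hx))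
    have h1 : β =ᶠ[𝓝[Q] y] fun _ => 0 := by
      filter_upwards [mem_nhdsWithin_of_mem_nhds (hKEc.isClosed.isOpen_compl.mem_nhds hyK)] with z hz
      exact hβ0 z hz
    rw [h1.extDerivWithin_eq_of_mem hyQ, extDerivWithin_apply (differentiableWithinAt_const _)
      ((Corner (k + 1)).uniqueDiffOn y hyQ)]
    simp
  have hsupp : ∀ q ∉ (extChartAt (Corner (k + 1)) c).source, η.d q = 0 := fun q hq =>
    DForm.d_eq_zero_of_eventually (Filter.mem_of_superset (hK.isOpen_compl.mem_nhds fun h => hq (hKc h)) h0)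
  rw [integral_eq_chart ΩY hη.cont_d hsupp, setIntegral_congr_fun htm hd,
    ← setIntegral_eq_of_subset_of_forall_sdiff_eq_zero (Corner (k + 1)).isClosed_range.measurableSet htQ hd0,
    integral_extDerivWithin_corner hβs hKEc fun y _ hy => hβ0 y hy]
  refine Finset.sum_congr rfl fun l _ => ?_
  have hpm : MeasurableSet (faceIncl l ⁻¹' tg) := htm.preimage (faceIncl l).continuous.measurable
  have hsub : faceIncl l ⁻¹' tg ⊆ Set.range (Corner k) := fun z hz =>
    faceIncl_mem_range.1 (htQ hz)
  rw [setIntegral_eq_of_subset_of_forall_sdiff_eq_zero (Corner k).isClosed_range.measurableSet hsub,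
    ← MeasureTheory.integral_const_mul, ← MeasureTheory.integral_neg]
  · refine setIntegral_congr_fun hpm fun z hz => ?_
    have hz' : faceIncl l z ∈ tg := hz
    simp only [hβ, if_pos hz']
    rfl
  · rintro z ⟨_, hz⟩
    have hz' : faceIncl l z ∉ tg := hz
    simp only [hβ, if_neg hz']
    rfl

/-- Up to a null set, every face of the chart is the union of the images of the interiors of `X` and
`X'`: the ranges exhaust the boundary, and boundary points of the pieces are negligible. The union
is disjoint by `hdisj`, and the signs `1` and `-1` give the difference. -/
theorem sum_faces_eq (h : IsFace ΩX ΩY 1 i) (h' : IsFace ΩX' ΩY (-1) i')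
    (hbd : (Corner (k + 1)).boundary Y = Set.range i ∪ Set.range i')
    (hdisj : ∀ x ∈ (Corner k).interior X, ∀ x' ∈ (Corner k).interior X', i x ≠ i' x')
    {η : DForm (Corner (k + 1)) Y k} (hη : η.Smooth) {c : Y}
    (h0 : ∀ q ∉ (extChartAt (Corner (k + 1)) c).source, η q = 0) :
    ∑ l : Fin (k + 1),
        ∫ z in faceIncl l ⁻¹' (extChartAt (Corner (k + 1)) c).target, faceDensity ΩY η c l z =
      integral ΩX (η.pull (I := Corner k) i) - integral ΩX' (η.pull (I := Corner k) i') := by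
  rw [h.integral_pull (Or.inl rfl) hη h0, h'.integral_pull (Or.inr rfl) hη h0,
    ← Finset.sum_sub_distrib]
  refine Finset.sum_congr rfl fun l _ => ?_
  obtain ⟨-, hi, hm⟩ := h.integralOn_faceSet (Or.inl rfl) hη c l
  obtain ⟨-, hi', hm'⟩ := h'.integralOn_faceSet (Or.inr rfl) hη c l
  have htm : MeasurableSet (extChartAt (Corner (k + 1)) c).target := measurableSet_extChartAt_target c
  have hpm : MeasurableSet (faceIncl l ⁻¹' (extChartAt (Corner (k + 1)) c).target) :=
    htm.preimage (faceIncl l).continuous.measurable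
  have hd : Disjoint (faceCoord i c l '' faceSet i c l) (faceCoord i' c l '' faceSet i' c l) := by
    refine Set.disjoint_left.2 ?_
    rintro _ ⟨x, hx, rfl⟩ ⟨x', hx', hxx⟩
    have h1 := congrArg (faceIncl l) hxx
    rw [faceIncl_faceCoord hx, faceIncl_faceCoord hx'] at h1
    exact hdisj x hx.1 x' hx'.1
      ((extChartAt (Corner (k + 1)) c).injOn hx.2.1 hx'.2.1 h1.symm)
  have h3 := setIntegral_union hd hm' hi hi'
  have h4 : ∫ z in faceIncl l ⁻¹' (extChartAt (Corner (k + 1)) c).target, faceDensity ΩY η c l z =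
      ∫ z in faceCoord i c l '' faceSet i c l ∪ faceCoord i' c l '' faceSet i' c l,
        faceDensity ΩY η c l z := by
    refine setIntegral_eq_of_subset_of_ae_sdiff_eq_zero hpm.nullMeasurableSet ?_ ?_
    · rintro _ (⟨x, hx, rfl⟩ | ⟨x, hx, rfl⟩) <;>
      · rw [Set.mem_preimage, faceIncl_faceCoord hx]
        exact (extChartAt (Corner (k + 1)) c).map_source hx.2.1
    · filter_upwards [h.ae_notMem_image c l, h'.ae_notMem_image c l] with z hz hz' hzd
      exfalso
      have hzt : faceIncl l z ∈ (extChartAt (Corner (k + 1)) c).target := hzd.1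
      have hs := (extChartAt (Corner (k + 1)) c).map_target hzt
      have hr := (extChartAt (Corner (k + 1)) c).right_inv hzt
      have hb : (extChartAt (Corner (k + 1)) c).symm (faceIncl l z) ∈
          (Corner (k + 1)).boundary Y := by
        rw [← ModelWithCorners.compl_interior]
        refine (notMem_interior_iff hs).2 ⟨l, ?_⟩
        rw [hr]
        simp
      rw [hbd] at hb
      rcases hb with ⟨x, hx⟩ | ⟨x, hx⟩
      · have hzx : faceCoord i c l x = z := by
          rw [faceCoord, hx, hr, faceProj_faceIncl]
        refine hzd.2 (Or.inl ⟨x, ⟨hz x (hx ▸ hs) hzx, hx ▸ hs, ?_⟩, hzx⟩)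
        rw [hx, hr]
        simp
      · have hzx : faceCoord i' c l x = z := by
          rw [faceCoord, hx, hr, faceProj_faceIncl]
        refine hzd.2 (Or.inr ⟨x, ⟨hz' x (hx ▸ hs) hzx, hx ▸ hs, ?_⟩, hzx⟩)
        rw [hx, hr]
        simp
  rw [h4, h3]
  ring

/-- Stokes' theorem for closed forms. -/
theorem integral_pull_eq_of_closed (h : IsFace ΩX ΩY 1 i) (h' : IsFace ΩX' ΩY (-1) i')
    (hbd : (Corner (k + 1)).boundary Y = Set.range i ∪ Set.range i')
    (hdisj : ∀ x ∈ (Corner k).interior X, ∀ x' ∈ (Corner k).interior X', i x ≠ i' x')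
    {η : DForm (Corner (k + 1)) Y k} (hη : η.Smooth) (hd : ∀ q, η.d q = 0) :
    integral ΩX (η.pull (I := Corner k) i) = integral ΩX' (η.pull (I := Corner k) i') := by
  set part : Y → DForm (Corner (k + 1)) Y k := fun c q => partitionOfUnity (Corner (k + 1)) Y c q • η q with hpart
  have hps (c : Y) : (part c).Smooth := hη.smul (partitionOfUnity (Corner (k + 1)) Y c).contMDiff
  have hsum : (fun q => ∑ c ∈ chartSet (Corner (k + 1)) Y, part c q) = η := by
    funext q
    simp only [hpart, ← Finset.sum_smul, sum_partitionOfUnity, one_smul]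
  have hK (c q : Y) (hq : q ∉ tsupport (partitionOfUnity (Corner (k + 1)) Y c)) : part c q = 0 := by
    simp only [hpart, image_eq_zero_of_notMem_tsupport hq, zero_smul]
  have hpull (c : Y) : integral ΩY (part c).d =
      integral ΩX ((part c).pull (I := Corner k) i) -
        integral ΩX' ((part c).pull (I := Corner k) i') := by
    rw [integral_d_eq_sum_faces ΩY (hps c) (isClosed_tsupport _)
      (tsupport_partitionOfUnity_subset (Corner (k + 1)) c) (hK c)]
    exact sum_faces_eq h h' hbd hdisj (hps c) fun q hq => hK c q fun hq' =>
      hq (tsupport_partitionOfUnity_subset (Corner (k + 1)) c hq')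
  -- The localised forms are not closed separately, but their exterior derivatives add up to `dη =
  -- 0`.
  have h1 : ∑ c ∈ chartSet (Corner (k + 1)) Y, integral ΩY (part c).d = 0 := by
    rw [← integral_sum _ ΩY _ fun c _ => (hps c).cont_d]
    have h2 : (fun q => ∑ c ∈ chartSet (Corner (k + 1)) Y, (part c).d q) = fun _ => 0 := by
      funext q
      rw [← DForm.d_sum _ (fun c _ => hps c), hsum, hd]
    rw [h2, integral_eq_sum]
    refine Finset.sum_eq_zero fun c _ => ?_
    refine MeasureTheory.integral_eq_zero_of_ae (Filter.Eventually.of_forall fun y => ?_)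
    change _ * (_ * (0 : ℝ)) = 0
    rw [mul_zero, mul_zero]
  have hX : integral ΩX (η.pull (I := Corner k) i) =
      ∑ c ∈ chartSet (Corner (k + 1)) Y, integral ΩX ((part c).pull (I := Corner k) i) := by
    rw [← integral_sum _ ΩX _ fun c _ => DForm.Smooth.cont fun x => (hps c (i x)).pull h.smooth]
    congr 1
    funext x
    ext v
    rw [ContinuousAlternatingMap.sum_apply]
    have := congrFun hsum (i x)
    change η (i x) _ = ∑ c ∈ chartSet (Corner (k + 1)) Y, part c (i x) _
    rw [← this, ContinuousAlternatingMap.sum_apply]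
  have hX' : integral ΩX' (η.pull (I := Corner k) i') =
      ∑ c ∈ chartSet (Corner (k + 1)) Y, integral ΩX' ((part c).pull (I := Corner k) i') := by
    rw [← integral_sum _ ΩX' _ fun c _ => DForm.Smooth.cont fun x => (hps c (i' x)).pull h'.smooth]
    congr 1
    funext x
    ext v
    rw [ContinuousAlternatingMap.sum_apply]
    have := congrFun hsum (i' x)
    change η (i' x) _ = ∑ c ∈ chartSet (Corner (k + 1)) Y, part c (i' x) _
    rw [← this, ContinuousAlternatingMap.sum_apply]
  rw [hX, hX', ← sub_eq_zero, ← Finset.sum_sub_distrib, ← h1]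
  exact Finset.sum_congr rfl fun c _ => (hpull c).symm

end Stokes

/-! ### Differentials of charts in the maximal atlas. -/

section Charts

variable {n : ℕ} {M : Type u} [TopologicalSpace M] [ChartedSpace (Euc n) M]
  [IsManifold (𝓡 n) ∞ M]

theorem mdifferentiable_of_mem_maximalAtlas {c : OpenPartialHomeomorph M (Euc n)}
    (hc : c ∈ IsManifold.maximalAtlas (𝓡 n) ∞ M) : c.MDifferentiable (𝓡 n) (𝓡 n) :=
  ⟨(contMDiffOn_of_mem_maximalAtlas hc).mdifferentiableOn (by simp),
    (contMDiffOn_symm_of_mem_maximalAtlas hc).mdifferentiableOn (by simp)⟩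

/-- `coordInv` uses `ContinuousLinearMap.inverse`, whose default value is zero; on the chart domain
the differential of the inverse chart shows that it is a true inverse. -/
theorem coordInv_eq {c : OpenPartialHomeomorph M (Euc n)}
    (hc : c ∈ IsManifold.maximalAtlas (𝓡 n) ∞ M) {z : Euc n} (hz : z ∈ c.target) :
    coordInv c (c.symm z) = mfderiv (𝓡 n) (𝓡 n) c.symm z := by
  have h := mdifferentiable_of_mem_maximalAtlas hc
  have h1 := h.comp_symm_deriv hz
  have h2 := h.symm_comp_deriv (c.map_target hz)
  rw [c.right_inv hz] at h2
  exact ContinuousLinearMap.inverse_eq h1 h2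

theorem coordDeriv_coordInv {c : OpenPartialHomeomorph M (Euc n)}
    (hc : c ∈ IsManifold.maximalAtlas (𝓡 n) ∞ M) {x : M} (hx : x ∈ c.source) (v : Euc n) :
    coordDeriv c x (coordInv c x v) = v := by
  obtain ⟨z, hz, rfl⟩ : ∃ z ∈ c.target, c.symm z = x := ⟨_, c.map_source hx, c.left_inv hx⟩
  rw [coordInv_eq hc hz]
  exact congrArg (fun f => f v) ((mdifferentiable_of_mem_maximalAtlas hc).comp_symm_deriv hz)

theorem coordInv_coordDeriv {c : OpenPartialHomeomorph M (Euc n)}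
    (hc : c ∈ IsManifold.maximalAtlas (𝓡 n) ∞ M) {x : M} (hx : x ∈ c.source)
    (v : TangentSpace (𝓡 n) x) : coordInv c x (coordDeriv c x v) = v := by
  obtain ⟨z, hz, rfl⟩ : ∃ z ∈ c.target, c.symm z = x := ⟨_, c.map_source hx, c.left_inv hx⟩
  have h2 := (mdifferentiable_of_mem_maximalAtlas hc).symm_comp_deriv (c.map_target hz)
  rw [c.right_inv hz] at h2
  rw [coordInv_eq hc hz]
  exact congrArg (fun f => f v) h2

theorem transition_eq {c c' : OpenPartialHomeomorph M (Euc n)}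
    (hc : c ∈ IsManifold.maximalAtlas (𝓡 n) ∞ M) (hc' : c' ∈ IsManifold.maximalAtlas (𝓡 n) ∞ M)
    {x : M} (hx : x ∈ c.source) (hx' : x ∈ c'.source) :
    transition c c' x = (coordDeriv c x).comp (coordInv c' x) := by
  obtain ⟨z, hz, rfl⟩ : ∃ z ∈ c'.target, c'.symm z = x := ⟨_, c'.map_source hx', c'.left_inv hx'⟩
  rw [transition, c'.right_inv hz, coordInv_eq hc' hz, ← mfderiv_eq_fderiv]
  have h1 := (mdifferentiable_of_mem_maximalAtlas hc).mdifferentiableAt hx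
  have h2 := (mdifferentiable_of_mem_maximalAtlas hc').mdifferentiableAt_symm hz
  exact mfderiv_comp z h1 h2

theorem fderiv_extChartAt_comp_symm {c : OpenPartialHomeomorph M (Euc n)}
    (hc : c ∈ IsManifold.maximalAtlas (𝓡 n) ∞ M) {q : M} {z : Euc n} (hz : z ∈ c.target)
    (hq : c.symm z ∈ (chartAt (Euc n) q).source) (v : Euc n) :
    fderiv ℝ (fun z => extChartAt (𝓡 n) q (c.symm z)) z v =
      chartDeriv (𝓡 n) q (c.symm z) (coordInv c (c.symm z) v) := by
  have h4 := (mdifferentiable_of_mem_maximalAtlas hc).mdifferentiableAt_symm hz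
  have h5 : HasFDerivAt (fun z => extChartAt (𝓡 n) q (c.symm z))
      ((chartDeriv (𝓡 n) q (c.symm z)).comp (mfderiv (𝓡 n) (𝓡 n) c.symm z) : Euc n →L[ℝ] Euc n) z :=
    ((mdifferentiableAt_extChartAt (I := 𝓡 n) hq).hasMFDerivAt.comp z h4.hasMFDerivAt).hasFDerivAt
  rw [coordInv_eq hc hz, h5.fderiv]
  rfl

theorem fderivWithin_comp_extChartAt_symm {c : OpenPartialHomeomorph M (Euc n)}
    (hc : c ∈ IsManifold.maximalAtlas (𝓡 n) ∞ M) {q : M} {y : Euc n}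
    (hy : y ∈ (extChartAt (𝓡 n) q).target) (hyc : (extChartAt (𝓡 n) q).symm y ∈ c.source) :
    fderivWithin ℝ (fun y => c ((extChartAt (𝓡 n) q).symm y)) (Set.range (𝓡 n)) y =
      (coordDeriv c ((extChartAt (𝓡 n) q).symm y)).comp (chartInv (𝓡 n) q y) := by
  have h1 := (mdifferentiableWithinAt_extChartAt_symm hy).hasMFDerivWithinAt
  have h2 : HasFDerivWithinAt (fun y => c ((extChartAt (𝓡 n) q).symm y))
      ((coordDeriv c ((extChartAt (𝓡 n) q).symm y)).comp (chartInv (𝓡 n) q y) : Euc n →L[ℝ] Euc n)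
      (Set.range (𝓡 n)) y :=
    (((mdifferentiable_of_mem_maximalAtlas hc).mdifferentiableAt
      hyc).hasMFDerivAt.comp_hasMFDerivWithinAt y h1).hasFDerivWithinAt
  exact h2.fderivWithin (uniqueDiffWithinAt_range hy)

end Charts

/-! ### Gram determinants. -/

section Gram

variable {n : ℕ} {V : Type*} [NormedAddCommGroup V] [InnerProductSpace ℝ V]

theorem linearIndependent_stdFrame (n : ℕ) : LinearIndependent ℝ (stdFrame n) := by
  let b := (EuclideanSpace.basisFun (Fin n) ℝ).toBasis
  have hb : ⇑b = stdFrame n := by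
    ext i : 1
    simp [b, stdFrame]
  rw [← hb]
  exact b.linearIndependent

/-- The Gram determinant. -/
noncomputable def gramDet (v : Fin n → V) : ℝ := (Matrix.gram ℝ v).det

theorem gramDet_pos {v : Fin n → V} (hv : LinearIndependent ℝ v) : 0 < gramDet v :=
  (Matrix.posDef_gram_of_linearIndependent hv).det_pos

/-- The Gram matrix transforms as `Sᵀ G S`, which gives the square of the determinant. -/
theorem gramDet_comp (A : Euc n →ₗ[ℝ] V) (D : Euc n →L[ℝ] Euc n) :
    gramDet (fun i => A (D (stdFrame n i))) = D.det ^ 2 * gramDet fun i => A (stdFrame n i) := by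
  let b := (EuclideanSpace.basisFun (Fin n) ℝ).toBasis
  have hb : ⇑b = stdFrame n := by
    ext i : 1
    simp [b, stdFrame]
  set S := LinearMap.toMatrix b b (D : Euc n →ₗ[ℝ] Euc n) with hS
  have hD : D.det = S.det := (LinearMap.det_toMatrix b _).symm
  have hsum (i : Fin n) : D (stdFrame n i) = ∑ r, S r i • stdFrame n r := by
    rw [← hb]
    conv_lhs => rw [← b.sum_repr (D (b i))]
    simp only [hS, LinearMap.toMatrix_apply]
    rfl
  have h1 : Matrix.gram ℝ (fun i => A (D (stdFrame n i))) =
      S.transpose * Matrix.gram ℝ (fun i => A (stdFrame n i)) * S := by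
    ext i l
    simp only [Matrix.gram_apply, hsum, map_sum, map_smul, Matrix.mul_apply, Matrix.transpose_apply,
      sum_inner, inner_sum, inner_smul_left, inner_smul_right, Finset.sum_mul]
    refine Finset.sum_congr rfl fun r _ => ?_
    rw [Finset.mul_sum]
    refine Finset.sum_congr rfl fun t _ => ?_
    simp only [conj_trivial]
    ring
  rw [gramDet, gramDet, h1, Matrix.det_mul, Matrix.det_mul, Matrix.det_transpose, hD]
  ring

end Gram

/-! ### Smoothness of the metric in coordinates. -/

section Metric

variable {n : ℕ} {M : Type u} [TopologicalSpace M] [ChartedSpace (Euc n) M]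
  [IsManifold (𝓡 n) ∞ M] [RiemannianBundle (fun x : M => TangentSpace (𝓡 n) x)]

theorem metricDet_eq (c : OpenPartialHomeomorph M (Euc n)) (x : M) :
    metricDet c x = gramDet fun i => coordInv c x (stdFrame n i) := rfl

theorem metricDet_pos {c : OpenPartialHomeomorph M (Euc n)}
    (hc : c ∈ IsManifold.maximalAtlas (𝓡 n) ∞ M) {x : M} (hx : x ∈ c.source) :
    0 < metricDet c x := by
  rw [metricDet_eq]
  exact gramDet_pos ((linearIndependent_stdFrame n).map' (coordInv c x).toLinearMap
    (LinearMap.ker_eq_bot.2 (Function.LeftInverse.injective (coordDeriv_coordInv hc hx))))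

variable [IsContMDiffRiemannianBundle (𝓡 n) ∞ (Euc n) (fun x : M => TangentSpace (𝓡 n) x)]

/-- The local trivialisation of the tangent bundle is the differential of the chart, so smooth
components in the chart at `f z₀` give smooth sections along `f`, to which smoothness of the metric
applies. -/
theorem contDiffWithinAt_inner {G : Type*} [NormedAddCommGroup G] [NormedSpace ℝ G] {s : Set G}
    {z₀ : G} {f : G → M} (hf : ContMDiffWithinAt 𝓘(ℝ, G) (𝓡 n) ∞ f s z₀)
    {v w : (z : G) → TangentSpace (𝓡 n) (f z)}
    (hv : ContDiffWithinAt ℝ ∞ (fun z => chartDeriv (𝓡 n) (f z₀) (f z) (v z)) s z₀)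
    (hw : ContDiffWithinAt ℝ ∞ (fun z => chartDeriv (𝓡 n) (f z₀) (f z) (w z)) s z₀)
    (hz₀ : z₀ ∈ s) : ContDiffWithinAt ℝ ∞ (fun z => inner ℝ (v z) (w z)) s z₀ := by
  have key : ∀ {v : (z : G) → TangentSpace (𝓡 n) (f z)},
      ContDiffWithinAt ℝ ∞ (fun z => chartDeriv (𝓡 n) (f z₀) (f z) (v z)) s z₀ →
      ContMDiffWithinAt 𝓘(ℝ, G) ((𝓡 n).prod 𝓘(ℝ, Euc n)) ∞
        (fun z => (⟨f z, v z⟩ : TotalSpace (Euc n) fun x : M => TangentSpace (𝓡 n) x)) s z₀ := by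
    intro v hv
    refine contMDiffWithinAt_totalSpace.2 ⟨hf, ?_⟩
    refine (contMDiffWithinAt_iff_contDiffWithinAt.2 hv).congr_of_eventuallyEq_of_mem ?_ hz₀
    have h1 : ∀ᶠ z in 𝓝[s] z₀, f z ∈ (chartAt (Euc n) (f z₀)).source :=
      hf.continuousWithinAt.eventually ((chartAt (Euc n) (f z₀)).open_source.mem_nhds
        (mem_chart_source _ _))
    filter_upwards [h1] with z hz
    rw [chartDeriv, ← TangentBundle.continuousLinearMapAt_trivializationAt hz,
      Trivialization.continuousLinearMapAt_apply, Trivialization.linearMapAt_apply, if_pos]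
    simpa using hz
  exact contMDiffWithinAt_iff_contDiffWithinAt.1 ((key hv).inner_bundle (key hw))

theorem contDiffWithinAt_gramDet {G : Type*} [NormedAddCommGroup G] [NormedSpace ℝ G] {s : Set G}
    {z₀ : G} {m : ℕ} {f : G → M} (hf : ContMDiffWithinAt 𝓘(ℝ, G) (𝓡 n) ∞ f s z₀)
    {v : (z : G) → Fin m → TangentSpace (𝓡 n) (f z)}
    (hv : ∀ i, ContDiffWithinAt ℝ ∞ (fun z => chartDeriv (𝓡 n) (f z₀) (f z) (v z i)) s z₀)
    (hz₀ : z₀ ∈ s) : ContDiffWithinAt ℝ ∞ (fun z => gramDet (v z)) s z₀ := by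
  simp only [gramDet, Matrix.det_apply]
  refine ContDiffWithinAt.sum fun σ _ => ContDiffWithinAt.const_smul _ ?_
  exact contDiffWithinAt_prod fun i _ => contDiffWithinAt_inner hf (hv _) (hv _) hz₀

theorem contDiffAt_metricDet {c : OpenPartialHomeomorph M (Euc n)}
    (hc : c ∈ IsManifold.maximalAtlas (𝓡 n) ∞ M) {z₀ : Euc n} (hz₀ : z₀ ∈ c.target) :
    ContDiffAt ℝ ∞ (fun z => metricDet c (c.symm z)) z₀ := by
  have hcs : ContMDiffAt (𝓡 n) (𝓡 n) ∞ c.symm z₀ :=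
    (contMDiffOn_symm_of_mem_maximalAtlas hc).contMDiffAt (c.open_target.mem_nhds hz₀)
  rw [← contDiffWithinAt_univ]
  refine contDiffWithinAt_gramDet (contMDiffWithinAt_univ.2 hcs) (fun i => ?_) (Set.mem_univ _)
  rw [contDiffWithinAt_univ]
  set ψ : Euc n → Euc n := fun z => extChartAt (𝓡 n) (c.symm z₀) (c.symm z) with hψ
  have h1 : ContDiffAt ℝ ∞ ψ z₀ := by
    rw [← contMDiffAt_iff_contDiffAt]
    exact ContMDiffAt.comp z₀ (contMDiffAt_extChartAt (n := ∞)) hcs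
  have h2 : ContDiffAt ℝ ∞ (fun z => fderiv ℝ ψ z (stdFrame n i)) z₀ :=
    (h1.fderiv_right (m := ∞) (by simp)).clm_apply contDiffAt_const
  refine h2.congr_of_eventuallyEq ?_
  have h3 : ∀ᶠ z in 𝓝 z₀, c.symm z ∈ (chartAt (Euc n) (c.symm z₀)).source :=
    hcs.continuousAt.eventually ((chartAt (Euc n) (c.symm z₀)).open_source.mem_nhds
      (mem_chart_source _ _))
  filter_upwards [h3, c.open_target.mem_nhds hz₀] with z hz hzt
  exact (fderiv_extChartAt_comp_symm hc hzt hz _).symm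

end Metric

/-! ### The form of a spinor field: independence of the trivialisation and smoothness. -/

section Spinors

variable {n : ℕ} {M : Type u} [TopologicalSpace M] [ChartedSpace (Euc n) M]
  [IsManifold (𝓡 n) ∞ M] [RiemannianBundle (fun x : M => TangentSpace (𝓡 n) x)]
  {Ω : OrientationForm (𝓡 n) M n} {H : DForm (𝓡 n) M 3} {T : Trivialisation Ω H} {ε : ZMod 2}

/-- The form which a spinor field determines on a coordinate neighbourhood. -/
noncomputable def SpinorField.formOn (ρ : SpinorField T ε) (a : T.index) : MForm (𝓡 n) M :=
  fun x => expForm (-(T.B a x)) * ((metricDet (T.chart a) x ^ (1 / 4 : ℝ)) •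
    pullLin (coordDeriv (T.chart a) x) (ρ.toFun a x))

theorem SpinorField.toForm_eq (ρ : SpinorField T ε) (x : M) :
    ρ.toForm x = ρ.formOn (T.around x) x := rfl

variable {a b : T.index} {x : M}

theorem coordInv_eq_transition (ha : x ∈ (T.chart a).source) (hb : x ∈ (T.chart b).source)
    (v : Euc n) : coordInv (T.chart b) x v =
      coordInv (T.chart a) x (transition (T.chart a) (T.chart b) x v) := by
  rw [transition_eq (T.chart_mem a) (T.chart_mem b) ha hb]
  exact (coordInv_coordDeriv (T.chart_mem a) ha _).symm

theorem det_transition_pos (ha : x ∈ (T.chart a).source) (hb : x ∈ (T.chart b).source) :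
    0 < (transition (T.chart a) (T.chart b) x).det := by
  have h1 := T.oriented b x hb
  have h2 := T.oriented a x ha
  have h3 := topForm_comp_stdFrame ((Ω.form x).compContinuousLinearMap (coordInv (T.chart a) x))
    (transition (T.chart a) (T.chart b) x)
  have h4 : 0 < (transition (T.chart a) (T.chart b) x).det *
      Ω.form x fun i => coordInv (T.chart a) x (stdFrame n i) := by
    refine lt_of_lt_of_eq ?_ h3
    change 0 < Ω.form x fun i => coordInv (T.chart a) x
      (transition (T.chart a) (T.chart b) x (stdFrame n i))
    simp only [← coordInv_eq_transition ha hb]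
    exact h1
  exact pos_of_mul_pos_left h4 h2.le

/-- The metric determinant changes by the square of the Jacobian, which is positive for oriented
charts; hence its fourth root changes by the square root of the Jacobian, as spinors do. -/
theorem rpow_metricDet_eq (ha : x ∈ (T.chart a).source) (hb : x ∈ (T.chart b).source) :
    metricDet (T.chart b) x ^ (1 / 4 : ℝ) = metricDet (T.chart a) x ^ (1 / 4 : ℝ) *
      Real.sqrt (transition (T.chart a) (T.chart b) x).det := by
  have hd := det_transition_pos ha hb
  have h1 : metricDet (T.chart b) x =
      (transition (T.chart a) (T.chart b) x).det ^ 2 * metricDet (T.chart a) x := by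
    rw [metricDet_eq, metricDet_eq]
    simp only [coordInv_eq_transition ha hb]
    exact gramDet_comp (coordInv (T.chart a) x).toLinearMap _
  rw [h1, Real.mul_rpow (by positivity) (metricDet_pos (T.chart_mem a) ha).le, mul_comm,
    Real.sqrt_eq_rpow, ← Real.rpow_natCast, ← Real.rpow_mul hd.le]
  norm_num

/-- Three transition rules cancel: `e^{-B_a} e^{B_a - B_b} = e^{-B_b}`, the half-density factor is
absorbed by the metric determinant, and the Jacobian turns one coordinate differential into the
other. -/
theorem SpinorField.formOn_eq (ρ : SpinorField T ε) (ha : x ∈ (T.chart a).source)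
    (hb : x ∈ (T.chart b).source) : ρ.formOn a x = ρ.formOn b x := by
  have h1 : ((T.B a x - T.B b x).compContinuousLinearMap (coordInv (T.chart a) x)).compContinuousLinearMap
      (coordDeriv (T.chart a) x) = T.B a x - T.B b x := by
    ext v
    simp only [ContinuousAlternatingMap.compContinuousLinearMap_apply, Function.comp_def,
      coordInv_coordDeriv (T.chart_mem a) ha]
  have h2 : (transition (T.chart b) (T.chart a) x).comp (coordDeriv (T.chart a) x) =
      coordDeriv (T.chart b) x := by
    ext1 v
    rw [transition_eq (T.chart_mem b) (T.chart_mem a) hb ha]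
    change coordDeriv (T.chart b) x (coordInv (T.chart a) x (coordDeriv (T.chart a) x v)) = _
    rw [coordInv_coordDeriv (T.chart_mem a) ha]
  have h3 : pullLin (coordDeriv (T.chart a) x) (ρ.toFun a x) = expForm (T.B a x - T.B b x) *
      (Real.sqrt (transition (T.chart a) (T.chart b) x).det •
        pullLin (coordDeriv (T.chart b) x) (ρ.toFun b x)) := by
    rw [ρ.compatible a b x ⟨ha, hb⟩, wedge_eq_mul, pullLin_mul, pullLin_expForm, h1]
    congr 1
    rw [← pullLinₗ_apply, map_smul, pullLinₗ_apply, pullLin_pullLin, h2]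
  have h4 : expForm (-(T.B a x)) * expForm (T.B a x - T.B b x) = expForm (-(T.B b x)) := by
    rw [← expForm_add]
    congr 1
    abel
  rw [SpinorField.formOn, SpinorField.formOn, h3, rpow_metricDet_eq ha hb, ← h4]
  simp only [mul_smul_comm, smul_smul, mul_assoc]

variable [IsContMDiffRiemannianBundle (𝓡 n) ∞ (Euc n) (fun x : M => TangentSpace (𝓡 n) x)]

/-- `toForm` uses the index `T.around x`, which may jump with `x`. Near `q` the fixed index
`T.around q` gives the same form by `formOn_eq`, and every factor is then smooth. -/
theorem SpinorField.toForm_smooth (ρ : SpinorField T ε) : ρ.toForm.Smooth := by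
  have key : ∀ q : M, MixedContDiffWithinAt ∞ (ρ.toForm.inChart q) (Set.range (𝓡 n))
      (extChartAt (𝓡 n) q q) := by
    intro q
    set a := T.around q
    have hq : q ∈ (T.chart a).source := T.mem_around q
    set c := T.chart a
    have hc : c ∈ IsManifold.maximalAtlas (𝓡 n) ∞ M := T.chart_mem a
    set w : Euc n → Euc n := fun y => c ((extChartAt (𝓡 n) q).symm y) with hw
    have hy₀ := mem_extChartAt_target (I := 𝓡 n) q
    have hqq := extChartAt_to_inv (I := 𝓡 n) q
    have hcq : ContMDiffAt (𝓡 n) (𝓡 n) ∞ c ((extChartAt (𝓡 n) q).symm (extChartAt (𝓡 n) q q)) := by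
      rw [hqq]
      exact (contMDiffOn_of_mem_maximalAtlas hc).contMDiffAt (c.open_source.mem_nhds hq)
    have hws : ContDiffWithinAt ℝ ∞ w (Set.range (𝓡 n)) (extChartAt (𝓡 n) q q) := by
      rw [← contMDiffWithinAt_iff_contDiffWithinAt]
      exact hcq.comp_contMDiffWithinAt _ (contMDiffWithinAt_extChartAt_symm_range q hy₀)
    have hev : ∀ᶠ y in 𝓝[Set.range (𝓡 n)] (extChartAt (𝓡 n) q q), y ∈ (extChartAt (𝓡 n) q).target ∧
        (extChartAt (𝓡 n) q).symm y ∈ c.source := by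
      refine Filter.Eventually.and (extChartAt_target_mem_nhdsWithin q) ?_
      have h1 := continuousAt_extChartAt_symm (I := 𝓡 n) q
      rw [ContinuousAt, hqq] at h1
      exact mem_nhdsWithin_of_mem_nhds (h1 (c.open_source.mem_nhds hq))
    have hwq : w (extChartAt (𝓡 n) q q) = c q := by rw [hw]; simp only [hqq]
    have hB : MixedContDiffWithinAt ∞ (fun y => expForm (-((T.B a).inChart q y)))
        (Set.range (𝓡 n)) (extChartAt (𝓡 n) q q) :=
      mixedContDiffWithinAt_expForm (T.B_smooth a q hq).neg
    have hm : ContDiffWithinAt ℝ ∞ (fun y => metricDet c (c.symm (w y)) ^ (1 / 4 : ℝ))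
        (Set.range (𝓡 n)) (extChartAt (𝓡 n) q q) := by
      refine ContDiffWithinAt.rpow_const_of_ne ?_ ?_
      · refine ContDiffAt.comp_contDiffWithinAt (g := fun z => metricDet c (c.symm z)) _ ?_ hws
        rw [hwq]
        exact contDiffAt_metricDet hc (c.map_source hq)
      · rw [hwq, c.left_inv hq]
        exact (metricDet_pos hc hq).ne'
    have hρ : MixedContDiffWithinAt ∞ (fun y => ρ.toFun a (c.symm (w y)))
        (Set.range (𝓡 n)) (extChartAt (𝓡 n) q q) := by
      intro p
      refine ContDiffAt.comp_contDiffWithinAt (g := fun z => ρ.toFun a (c.symm z) p) _ ?_ hws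
      rw [hwq]
      exact (ρ.smooth a p).contDiffAt (c.open_target.mem_nhds (c.map_source hq))
    have hD : ContDiffWithinAt ℝ ∞ (fderivWithin ℝ w (Set.range (𝓡 n))) (Set.range (𝓡 n))
        (extChartAt (𝓡 n) q q) :=
      hws.fderivWithin_right (𝓡 n).uniqueDiffOn (by simp) (extChartAt_target_subset_range q hy₀)
    have hall := hB.mul ((hρ.pullLin hD).smul hm)
    intro p
    refine (hall p).congr_of_eventuallyEq_of_mem ?_ (extChartAt_target_subset_range q hy₀)
    filter_upwards [hev] with y hy
    refine congrFun ?_ p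
    rw [MForm.inChart, ρ.toForm_eq, ρ.formOn_eq (T.mem_around _) hy.2, SpinorField.formOn,
      pullLin_mul, pullLin_expForm, hw, fderivWithin_comp_extChartAt_symm hc hy.1 hy.2, ← pullLinₗ_apply, map_smul, pullLinₗ_apply,
      pullLin_pullLin]
    simp only [c.left_inv hy.2]
    rfl
  exact fun p q => key q p

end Spinors

/-! ### The forms `e^{-F} ∧ j^* α` and their exterior derivative. -/

section MixedForms

variable {E H : Type*} [NormedAddCommGroup E] [NormedSpace ℝ E] [FiniteDimensional ℝ E]
  [TopologicalSpace H]
  {I : ModelWithCorners ℝ E H} {X : Type*} [TopologicalSpace X] [ChartedSpace H X]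
  [IsManifold I ∞ X]
  {E' H' : Type*} [NormedAddCommGroup E'] [NormedSpace ℝ E'] [FiniteDimensional ℝ E']
  [TopologicalSpace H']
  {I' : ModelWithCorners ℝ E' H'} {Y : Type*} [TopologicalSpace Y] [ChartedSpace H' Y]
  [IsManifold I' ∞ Y]

theorem DForm.d_sub {p : ℕ} {η η' : DForm I X p} (hη : η.Smooth) (hη' : η'.Smooth) (x : X) :
    DForm.d (fun y => η y - η' y) x = η.d x - η'.d x := by
  simp only [DForm.d_eq]
  have h1 : DForm.inChart (fun y => η y - η' y) x = fun y => η.inChart x y - η'.inChart x y := by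
    ext y v
    rfl
  rw [h1, extDerivWithin, fderivWithin_fun_sub (uniqueDiffWithinAt_range (mem_extChartAt_target x))
    ((hη x).differentiableWithinAt (by simp)) ((hη' x).differentiableWithinAt (by simp))]
  exact map_sub (ContinuousAlternatingMap.alternatizeUncurryFinCLM ℝ E ℝ) _ _

theorem MForm.d_sub {α β : MForm I X} (hα : α.Smooth) (hβ : β.Smooth) :
    (α - β).d = α.d - β.d := by
  funext x p
  match p with
  | 0 => exact (sub_zero (0 : TangentSpace I x [⋀^Fin 0]→L[ℝ] ℝ)).symm
  | q + 1 => exact DForm.d_sub (hα q) (hβ q) x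

theorem MForm.Smooth.sub {α β : MForm I X} (hα : α.Smooth) (hβ : β.Smooth) : (α - β).Smooth :=
  fun p x => (hα p x).sub (hβ p x)

theorem MForm.eq_of_inChart_eq {α β : MForm I X} {x : X}
    (h : α.inChart x (extChartAt I x x) = β.inChart x (extChartAt I x x)) : α x = β x := by
  funext p
  rw [eq_inChart_comp_chartDeriv (fun x => α x p) (mem_extChartAt_source x),
    eq_inChart_comp_chartDeriv (fun x => β x p) (mem_extChartAt_source x)]
  exact congrArg (fun f => ContinuousAlternatingMap.compContinuousLinearMap f (chartDeriv I x x))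
    (congrFun h p)

theorem sub_pureForm_neg_mul {p : ℕ} (A C : MixedForm E) (B : E [⋀^Fin p]→L[ℝ] ℝ) :
    A - pureForm (-B) * C = A + pureForm B * C := by
  have h : pureForm (-B) = (-1 : ℝ) • pureForm B := by
    rw [← neg_one_smul ℝ B]
    exact map_smul (pureFormₗ (V := E) (p := p)) (-1 : ℝ) B
  rw [h, smul_mul_assoc]
  ext q v
  change A q v - -1 * (pureForm B * C) q v = A q v + (pureForm B * C) q v
  ring

instance (x : X) : FiniteDimensional ℝ (TangentSpace I x) :=
  inferInstanceAs (FiniteDimensional ℝ E)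

instance (x : X) : T2Space (TangentSpace I x) := inferInstanceAs (T2Space E)

/-- The mixed form `e^{-F} ∧ j^* α`. -/
noncomputable def expPull (j : X → Y) (F : DForm I X 2) (α : MForm I' Y) : MForm I X := fun x =>
  expForm (-(F x)) * α.pull (I := I) j x

theorem inChart_expPull (j : X → Y) (F : DForm I X 2) (α : MForm I' Y) (c : X) (y : E) :
    (expPull j F α).inChart c y =
      expForm (-(F.inChart c y)) * (α.pull (I := I) j).inChart c y := by
  rw [MForm.inChart, expPull, pullLin_mul, pullLin_expForm]
  rfl

variable {j : X → Y} {F : DForm I X 2} {α : MForm I' Y}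

theorem expPull_smooth (hj : ContMDiff I I' ∞ j) (hF : F.Smooth) (hα : α.Smooth) :
    (expPull j F α).Smooth := by
  have key : ∀ x, MixedContDiffWithinAt ∞ ((expPull j F α).inChart x) (Set.range I)
      (extChartAt I x x) := by
    intro x
    rw [show (expPull j F α).inChart x = _ from funext fun y => inChart_expPull j F α x y]
    exact (mixedContDiffWithinAt_expForm (hF x).neg).mul fun p => (hα.pull hj) p x
  exact fun p x => key x p

/-- The isotropy condition turns the term `-dF` produced by `e^{-F}` into `j^*H`, so that the
ordinary differential upstairs is the twisted one downstairs. -/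
theorem d_expPull (hj : ContMDiff I I' ∞ j) (hF : F.Smooth) (hα : α.Smooth) {h : DForm I' Y 3}
    (hd : ∀ x, F.d x + h.pull (I := I) j x = 0) :
    (expPull j F α).d = expPull j F (α.dTwisted h) := by
  funext x
  refine MForm.eq_of_inChart_eq ?_
  have hy := mem_extChartAt_target (I := I) x
  have hαp := hα.pull (I := I) hj
  rw [MForm.inChart_d (expPull_smooth hj hF hα) hy,
    show (expPull j F α).inChart x = _ from funext fun y => inChart_expPull j F α x y,
    mixedExtDeriv_expForm_neg_mul (σ := (α.pull (I := I) j).inChart x) ((hF x).differentiableWithinAt (by simp))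
      (fun p => (hαp p x).differentiableWithinAt (by simp)) (uniqueDiffWithinAt_range hy),
    inChart_expPull, ← MForm.inChart_d hαp hy, ← DForm.inChart_d hy (hF _), MForm.d_pull hα hj]
  congr 1
  set y := extChartAt I x x
  have h1 : F.d.inChart x y = -((h.pull (I := I) j).inChart x y) := by
    have := eq_neg_of_add_eq_zero_left (hd ((extChartAt I x).symm y))
    rw [DForm.inChart_def, this]
    rfl
  have h2 : ((α.dTwisted h).pull (I := I) j).inChart x y = (α.d.pull (I := I) j).inChart x y +
      pureForm ((h.pull (I := I) j).inChart x y) * (α.pull (I := I) j).inChart x y := by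
    have h3 (z : Y) : α.dTwisted h z = α.d z + pureForm (h z) * α z := rfl
    simp only [MForm.inChart, MForm.pull, h3, ← pullLinHom_apply, map_add, map_mul]
    simp only [pullLinHom_apply, pullLin_pureForm]
    rfl
  rw [h1, h2, sub_pureForm_neg_mul]

theorem pullLin_expPull {E₀ H₀ : Type*} [NormedAddCommGroup E₀] [NormedSpace ℝ E₀]
    [FiniteDimensional ℝ E₀] [TopologicalSpace H₀] {I₀ : ModelWithCorners ℝ E₀ H₀}
    {X₀ : Type*} [TopologicalSpace X₀] [ChartedSpace H₀ X₀] [IsManifold I₀ ∞ X₀] {i : X₀ → X}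
    (hi : ContMDiff I₀ I ∞ i) (hj : ContMDiff I I' ∞ j) (F : DForm I X 2) (α : MForm I' Y) :
    (expPull j F α).pull (I := I₀) i = expPull (j ∘ i) (F.pull (I := I₀) i) α := by
  funext x
  rw [MForm.pull, expPull, expPull, pullLin_mul, pullLin_expForm]
  congr 1
  change pullLin _ (pullLin _ _) = pullLin _ _
  rw [pullLin_pullLin, mfderiv_comp x (hj.mdifferentiable (by simp) _)
    (hi.mdifferentiable (by simp) _)]
  rfl

theorem expPull_sub (j : X → Y) (F : DForm I X 2) (α β : MForm I' Y) (x : X) :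
    expPull j F (α - β) x = expPull j F α x - expPull j F β x := by
  rw [expPull, expPull, expPull, ← mul_sub]
  rfl

end MixedForms

/-! ### Invariance of integrals of closed forms under homology. -/

section Homology

variable {n : ℕ} {M : Type u} [TopologicalSpace M] [ChartedSpace (Euc n) M]
  [IsManifold (𝓡 n) ∞ M] {H : DForm (𝓡 n) M 3} {k : ℕ}
  {X : Type*} [TopologicalSpace X] [ChartedSpace (EuclideanQuadrant k) X]
  [IsManifold (Corner k) ∞ X]
  {X' : Type*} [TopologicalSpace X'] [ChartedSpace (EuclideanQuadrant k) X']
  [IsManifold (Corner k) ∞ X']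
  {Y : Type*} [TopologicalSpace Y] [ChartedSpace (EuclideanQuadrant (k + 1)) Y]
  [IsManifold (Corner (k + 1)) ∞ Y]

/-- Injectivity and immersivity of `i` are inherited from the embedding `P.j = Q.j ∘ i`. -/
theorem IsBoundaryPiece.isFace {P : IsotropicPair (Corner k) X H}
    {Q : IsotropicPair (Corner (k + 1)) Y H} {s : ℝ} {i : X → Y} (h : IsBoundaryPiece P Q s i) :
    IsFace P.orientation Q.orientation s i where
  smooth := h.smooth
  boundary := h.boundary
  injective := by
    have := P.isEmbedding.injective
    rw [← h.comp] at this
    exact this.of_comp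
  immersive x := by
    have h1 := P.immersive x
    rw [← h.comp, mfderiv_comp x (Q.smooth.mdifferentiable (by simp) _)
      (h.smooth.mdifferentiable (by simp) _)] at h1
    exact Function.Injective.of_comp h1
  orientation := h.orientation

theorem IsBoundaryPiece.pull_expPull {P : IsotropicPair (Corner k) X H}
    {Q : IsotropicPair (Corner (k + 1)) Y H} {s : ℝ} {i : X → Y} (h : IsBoundaryPiece P Q s i)
    (α : MForm (𝓡 n) M) :
    DForm.pull (I := Corner k) i (fun y => expPull Q.j Q.F α y k) =
      fun x => expPull P.j P.F α x k := by
  have h1 := pullLin_expPull h.smooth Q.smooth Q.F α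
  rw [h.comp, funext h.form] at h1
  funext x
  exact congrFun (congrFun h1 x) k

/-- Integrals of `e^{-F} ∧ j^* α` for `d_H`-closed forms `α` are homological invariants. -/
theorem Homologous.integral_expPull_eq [T2Space X] [CompactSpace X] [T2Space X'] [CompactSpace X']
    {P : IsotropicPair (Corner k) X H} {P' : IsotropicPair (Corner k) X' H} (h : Homologous P P')
    {α : MForm (𝓡 n) M} (hα : α.Smooth) (hd : α.dTwisted H = 0) :
    integral P.orientation (fun x => expPull P.j P.F α x k) =
      integral P'.orientation (fun x => expPull P'.j P'.F α x k) := by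
  obtain ⟨Y, _, _, _, _, _, Q, i, i', hi, hi', hbd, hdisj⟩ := h
  rw [← hi.pull_expPull, ← hi'.pull_expPull]
  refine integral_pull_eq_of_closed hi.isFace hi'.isFace hbd hdisj
    (expPull_smooth Q.smooth Q.F_smooth hα k) fun q => ?_
  have h1 := congrFun (congrFun (d_expPull Q.smooth Q.F_smooth hα Q.isotropic) q) (k + 1)
  refine h1.trans ?_
  have h2 : expPull Q.j Q.F (α.dTwisted H) q = 0 := by
    rw [hd, expPull, MForm.pull]
    have h3 : pullLin (mfderiv (Corner (k + 1)) (𝓡 n) Q.j q) ((0 : MForm (𝓡 n) M) (Q.j q)) = 0 := rfl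
    rw [h3, mul_zero]
  rw [h2]
  rfl

end Homology

/-! ### Volume forms, orientations and equality of isotropic planes. -/

section Planes

open scoped RealInnerProductSpace

variable {V : Type*} [NormedAddCommGroup V] [InnerProductSpace ℝ V] [FiniteDimensional ℝ V]
  {n k : ℕ}

theorem volForm_sq (hn : finrank ℝ V = n) (o : Orientation ℝ V (Fin n)) (w : Fin n → V) :
    volForm hn o w ^ 2 = gramDet w := by
  set A : Matrix (Fin n) (Fin n) ℝ := Matrix.of fun i j => ⟪onb hn i, w j⟫ with hA
  have h1 : volForm hn o w = volForm hn o (onb hn) * A.det :=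
    topForm_apply (onb hn) (Equiv.refl _) (volForm hn o) w
  have h2 : Matrix.gram ℝ w = A.transpose * A := by
    ext i j
    rw [Matrix.gram_apply, Matrix.mul_apply, ← (onb hn).sum_inner_mul_inner]
    refine Finset.sum_congr rfl fun l _ => ?_
    rw [real_inner_comm]
    rfl
  rw [gramDet, h2, Matrix.det_mul, Matrix.det_transpose, h1]
  linear_combination A.det ^ 2 * volForm_mul_self hn o (onb hn)

theorem volForm_ne_zero (hn : finrank ℝ V = n) (o : Orientation ℝ V (Fin n)) :
    volForm hn o ≠ 0 := by
  intro h
  have := volForm_mul_self hn o (onb hn)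
  rw [h] at this
  simp at this

theorem volForm_neg (hn : finrank ℝ V = n) (o : Orientation ℝ V (Fin n)) :
    volForm hn (-o) = -volForm hn o := by
  have : Fact (finrank ℝ V = n) := ⟨hn⟩
  ext v
  exact congrArg (fun f => f v) o.volumeForm_neg_orientation

/-- The volume form is a positive multiple of every form which defines the orientation. -/
theorem exists_volForm_eq (hn : finrank ℝ V = n) (η : V [⋀^Fin n]→ₗ[ℝ] ℝ) (hη : η ≠ 0) :
    ∃ r > (0 : ℝ), ∀ v, volForm hn (rayOfNeZero ℝ η hη) v = r * η v := by
  have : Fact (finrank ℝ V = n) := ⟨hn⟩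
  set o : Orientation ℝ V (Fin n) := rayOfNeZero ℝ η hη with ho
  have h0 : o.volumeForm ≠ 0 := by
    intro h
    refine volForm_ne_zero hn o ?_
    ext v
    exact congrArg (fun f => f v) h
  -- The volume form lies in the ray of the orientation. Dimension zero, where an orientation is
  -- only a sign, is separate; otherwise an oriented orthonormal basis is used.
  have h1 : o = rayOfNeZero ℝ o.volumeForm h0 := by
    rcases Nat.eq_zero_or_pos n with rfl | hpos
    · have h1 : (AlternatingMap.constLinearEquivOfIsEmpty 1 : V [⋀^Fin 0]→ₗ[ℝ] ℝ) ≠ 0 := fun h =>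
        one_ne_zero (congrArg (fun f => f ![]) h)
      have hpos : rayOfNeZero ℝ _ h1 = (positiveOrientation : Orientation ℝ V (Fin 0)) := rfl
      rcases o.eq_or_eq_neg_of_isEmpty with h | h
      · have h2 : o.volumeForm = AlternatingMap.constLinearEquivOfIsEmpty 1 := by
          rw [h, Orientation.volumeForm_zero_pos]
        refine h.trans (hpos.symm.trans ?_)
        rw [ray_eq_iff, h2]
      · have h2 : o.volumeForm = -AlternatingMap.constLinearEquivOfIsEmpty 1 := by
          rw [h, Orientation.volumeForm_zero_neg]
        refine h.trans ((congrArg Neg.neg hpos.symm).trans ?_)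
        rw [neg_rayOfNeZero, ray_eq_iff, h2]
        exact SameRay.refl _
    · have h2 := o.finOrthonormalBasis_orientation hpos hn
      conv_lhs => rw [← h2]
      rw [Basis.orientation, ray_eq_iff, o.volumeForm_robust _ h2]
      exact SameRay.refl _
  have h2 : SameRay ℝ o.volumeForm η := by
    rw [← ray_eq_iff h0 hη, ← h1]
  obtain ⟨r₁, r₂, h₁, h₂, h3⟩ := h2.exists_pos h0 hη
  refine ⟨r₁⁻¹ * r₂, by positivity, fun v => ?_⟩
  have h4 := congrArg (fun f => f v) h3
  simp only [AlternatingMap.smul_apply, smul_eq_mul] at h4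
  rw [volForm_apply, mul_assoc, ← h4, ← mul_assoc, inv_mul_cancel₀ h₁.ne', one_mul]

namespace IsotropicPlane

theorem proj_of_mem (P : IsotropicPlane V k) {v : V} (hv : v ∈ P.L) :
    P.L.orthogonalProjectionOnto v = ⟨v, hv⟩ :=
  P.L.orthogonalProjectionOnto_mem_subspace_eq_self ⟨v, hv⟩

theorem projF_of_mem (P : IsotropicPlane V k) {v : Fin 2 → V} (hv : ∀ i, v i ∈ P.L) :
    P.projF v = P.F fun i => ⟨v i, hv i⟩ := by
  change P.F (fun i => P.L.orthogonalProjectionOnto (v i)) = _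
  simp only [P.proj_of_mem (hv _)]

theorem vol_of_mem (P : IsotropicPlane V k) {v : Fin k → V} (hv : ∀ i, v i ∈ P.L) :
    P.vol v = volForm P.finrank_eq P.orientation fun i => ⟨v i, hv i⟩ := by
  change volForm P.finrank_eq P.orientation (fun i => P.L.orthogonalProjectionOnto (v i)) = _
  simp only [P.proj_of_mem (hv _)]

theorem vol_sq_of_mem (P : IsotropicPlane V k) {v : Fin k → V} (hv : ∀ i, v i ∈ P.L) :
    P.vol v ^ 2 = gramDet v := by
  rw [P.vol_of_mem hv, volForm_sq]
  rfl

/-- Two orientations of a plane are equal or opposite, and opposite ones would have volume forms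
differing by a negative factor, against `c > 0`. -/
theorem eq_of_restrict {P Q : IsotropicPlane V k} (hL : P.L = Q.L)
    (hF : ∀ v : Fin 2 → V, (∀ i, v i ∈ P.L) → P.projF v = Q.projF v) {c : ℝ} (hc : 0 < c)
    (hvol : ∀ v : Fin k → V, (∀ i, v i ∈ P.L) → P.vol v = c * Q.vol v) : P = Q := by
  have hF' (v : Fin 2 → V) (h : ∀ i, v i ∈ P.L) : P.F (fun i => ⟨v i, h i⟩) =
      Q.F fun i => ⟨v i, hL ▸ h i⟩ := by
    rw [← P.projF_of_mem h, ← Q.projF_of_mem (hL ▸ h), hF v h]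
  have hvol' (v : Fin k → V) (h : ∀ i, v i ∈ P.L) :
      volForm P.finrank_eq P.orientation (fun i => ⟨v i, h i⟩) =
      c * volForm Q.finrank_eq Q.orientation fun i => ⟨v i, hL ▸ h i⟩ := by
    rw [← P.vol_of_mem h, ← Q.vol_of_mem (hL ▸ h), hvol v h]
  clear hF hvol
  obtain ⟨L, h, o, F⟩ := P
  obtain ⟨L', h', o', F'⟩ := Q
  dsimp only at hL hF' hvol'
  subst hL
  have h1 : F = F' := by
    ext v
    exact hF' (fun i => v i) fun i => (v i).2
  have h2 : o = o' := by
    rcases o.eq_or_eq_neg o' (by rw [Fintype.card_fin, h]) with h3 | h3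
    · exact h3
    · have h4 := hvol' (fun i => onb h i) fun i => (onb h i).2
      have h5 := volForm_mul_self h o' (onb h)
      rw [h3, volForm_neg] at h4
      change -volForm h o' (onb h) = c * volForm h o' (onb h) at h4
      generalize volForm h o' (onb h) = t at h4 h5
      exact absurd (show (c + 1) * (t * t) = 0 by linear_combination -t * h4)
        (by rw [h5]; positivity)
  rw [h1, h2]

end IsotropicPlane

end Planes

/-! ### Pointwise comparison along isotropic pairs, and restriction to subdomains. -/

section Pointwise

variable {n : ℕ} {M : Type u} [TopologicalSpace M] [ChartedSpace (Euc n) M]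
  {k : ℕ} {HX : Type*} [TopologicalSpace HX] {I : ModelWithCorners ℝ (Euc k) HX}
  {X : Type*} [TopologicalSpace X]
  [ChartedSpace HX X] {Ω : OrientationForm (𝓡 n) M n} {H : DForm (𝓡 n) M 3}
  [RiemannianBundle (fun x : M => TangentSpace (𝓡 n) x)]

namespace IsotropicPair

theorem mfderiv_mem_planeAt (P : IsotropicPair I X H) (x : X) (v : TangentSpace I x) :
    mfderiv I (𝓡 n) P.j x v ∈ (P.planeAt x).L := ⟨v, rfl⟩

theorem tangentEquiv_symm_apply (P : IsotropicPair I X H) (x : X) (v : TangentSpace I x) :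
    (P.tangentEquiv x).symm ⟨mfderiv I (𝓡 n) P.j x v, v, rfl⟩ = v :=
  (P.tangentEquiv x).symm_apply_apply v

theorem planeAt_F_apply (P : IsotropicPair I X H) (x : X) (v : Fin 2 → TangentSpace I x) :
    (P.planeAt x).F (fun i => ⟨mfderiv I (𝓡 n) P.j x (v i), v i, rfl⟩) = P.F x v := by
  change P.F x (fun i => (P.tangentEquiv x).symm ⟨mfderiv I (𝓡 n) P.j x (v i), v i, rfl⟩) = _
  simp only [tangentEquiv_symm_apply]

theorem planeAt_projF_comp (P : IsotropicPair I X H) (x : X) :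
    (P.planeAt x).projF.compContinuousLinearMap (mfderiv I (𝓡 n) P.j x) = P.F x := by
  ext v
  refine ((P.planeAt x).projF_of_mem fun i => P.mfderiv_mem_planeAt x (v i)).trans ?_
  exact P.planeAt_F_apply x v

/-- The volume form is positive with respect to the orientation. -/
theorem exists_vol_eq (P : IsotropicPair I X H) (x : X) :
    ∃ r > (0 : ℝ), ∀ v, P.vol x v = r * P.orientation.form x v := by
  have h0 : (P.orientation.form x).toAlternatingMap.compLinearMap
      (P.tangentEquiv x).symm.toLinearMap ≠ 0 := by
    intro h
    refine P.orientation.ne_zero x ?_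
    ext v
    have := congrArg (fun f => f fun i => P.tangentEquiv x (v i)) h
    simpa using this
  obtain ⟨r, hr, h⟩ := exists_volForm_eq (P.planeAt x).finrank_eq _ h0
  refine ⟨r, hr, fun v => ?_⟩
  refine ((P.planeAt x).vol_of_mem fun i => P.mfderiv_mem_planeAt x (v i)).trans
    ((h _).trans ?_)
  congr 1
  change P.orientation.form x (fun i => (P.tangentEquiv x).symm
    ⟨mfderiv I (𝓡 n) P.j x (v i), v i, rfl⟩) = _
  simp only [tangentEquiv_symm_apply]

/-- Pull-back by the differential of `j` turns `projF` into `F`, so this is `pairing_tau_mul_vol`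
along the submanifold. It identifies the Wess-Zumino type integrand with the pairing. -/
theorem expPull_apply [IsManifold I ∞ X] [IsManifold (𝓡 n) ∞ M] (P : IsotropicPair I X H)
    (α : MForm (𝓡 n) M) (x : X) (v : Fin k → TangentSpace I x) :
    expPull P.j P.F α x k v = pairing (V := TangentSpace (𝓡 n) (P.j x)) (finrank_tangent (P.j x))
      (Ω.at (P.j x)) (α (P.j x)) (P.tau Ω x) * P.vol x v := by
  refine Eq.trans ?_ ((P.planeAt x).pairing_tau_mul_vol (finrank_tangent (P.j x)) (Ω.at (P.j x))
    (α (P.j x)) _ fun i => P.mfderiv_mem_planeAt x (v i)).symm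
  have h : expPull P.j P.F α x = pullLin (mfderiv I (𝓡 n) P.j x)
      (expForm (-(P.planeAt x).projF) * α (P.j x)) := by
    rw [pullLin_mul, pullLin_expForm, expPull]
    congr 2
    exact congrArg Neg.neg (P.planeAt_projF_comp x).symm
  rw [h]
  rfl

/-- Calibration depends only on the oriented tangent plane and `F`. The tangent planes agree by
inclusion and equality of dimensions, and the form and orientation are restrictions. -/
theorem IsCalibratedBy.of_isRestriction {D : Type*} [TopologicalSpace D]
    [ChartedSpace (EuclideanQuadrant k) D] {PD : IsotropicPair (Corner k) D H}
    {P : IsotropicPair I X H} {T : Trivialisation Ω H} {ε : ZMod 2} {ρ : SpinorField T ε}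
    (hP : P.IsCalibratedBy ρ) (h : IsRestriction PD P) : PD.IsCalibratedBy ρ := by
  obtain ⟨ι, hι, hj, hF, ho⟩ := h
  -- The map is replaced by `P.j ∘ ι` itself, so that the two planes lie in literally the same
  -- tangent space.
  obtain ⟨j, hj1, hj2, hj3, oD, FD, hFD, hiso⟩ := PD
  dsimp only at hj hF ho
  subst hj
  intro d
  set PD : IsotropicPair (Corner k) D H := ⟨P.j ∘ ι, hj1, hj2, hj3, oD, FD, hFD, hiso⟩ with hPD
  have hcomp : mfderiv (Corner k) (𝓡 n) PD.j d =
      (mfderiv I (𝓡 n) P.j (ι d)).comp (mfderiv (Corner k) I ι d) :=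
    mfderiv_comp d (P.smooth.mdifferentiable (by simp) _) (hι.mdifferentiable (by simp) _)
  have key : PD.planeAt d = P.planeAt (ι d) := by
    have hL : (PD.planeAt d).L = (P.planeAt (ι d)).L := by
      refine Submodule.eq_of_le_of_finrank_eq ?_
        ((PD.planeAt d).finrank_eq.trans (P.planeAt (ι d)).finrank_eq.symm)
      rintro _ ⟨v, rfl⟩
      refine ⟨mfderiv (Corner k) I ι d v, ?_⟩
      exact (congrArg (fun f => f v) hcomp).symm
    have hex : ∀ {m : ℕ} (v : Fin m → TangentSpace (𝓡 n) (P.j (ι d))),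
        (∀ i, v i ∈ (PD.planeAt d).L) → ∃ w : Fin m → TangentSpace (Corner k) d,
          v = fun i => mfderiv I (𝓡 n) P.j (ι d) (mfderiv (Corner k) I ι d (w i)) := by
      intro m v hv
      choose w hw using hv
      refine ⟨w, funext fun i => ?_⟩
      rw [← hw i]
      exact congrArg (fun f => f (w i)) hcomp
    obtain ⟨r, hr, h1⟩ := PD.exists_vol_eq d
    obtain ⟨r', hr', h2⟩ := P.exists_vol_eq (ι d)
    obtain ⟨c, hc, h3⟩ := ho d
    refine IsotropicPlane.eq_of_restrict hL (fun v hv => ?_) (c := r * c / r') (by positivity)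
      fun v hv => ?_
    · obtain ⟨w, rfl⟩ := hex v hv
      have h4 := congrArg (fun f => f w) (PD.planeAt_projF_comp d)
      have h5 := congrArg (fun f => f fun i => mfderiv (Corner k) I ι d (w i))
        (P.planeAt_projF_comp (ι d))
      rw [hcomp] at h4
      refine Eq.trans h4 (Eq.trans ?_ h5.symm)
      exact (congrArg (fun f => f w) (hF d)).symm
    · obtain ⟨w, rfl⟩ := hex v hv
      have h4 := h1 w
      have h5 := h2 fun i => mfderiv (Corner k) I ι d (w i)
      have h6 : PD.orientation.form d w =
          c * P.orientation.form (ι d) fun i => mfderiv (Corner k) I ι d (w i) :=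
        congrArg (fun f => f w) h3
      rw [vol, hcomp] at h4
      refine Eq.trans h4 ?_
      refine Eq.trans ?_ (congrArg (r * c / r' * ·) h5.symm)
      rw [h6]
      field_simp
  have := hP (ι d)
  rw [← key] at this
  exact this

end IsotropicPair

end Pointwise

/-! ### Continuity of the energy density. -/

section Continuity

theorem topForm_apply_stdFrame {k : ℕ} (α : Euc k [⋀^Fin k]→L[ℝ] ℝ) (v : Fin k → Euc k) :
    α v = α (stdFrame k) * (EuclideanSpace.basisFun (Fin k) ℝ).toBasis.det v := by
  have hb : ⇑(EuclideanSpace.basisFun (Fin k) ℝ).toBasis = stdFrame k := by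
    ext i : 1
    simp [stdFrame]
  have h := congrArg (fun g => g v)
    (α.toAlternatingMap.eq_smul_basis_det (EuclideanSpace.basisFun (Fin k) ℝ).toBasis)
  simp only [AlternatingMap.smul_apply, smul_eq_mul, hb] at h
  exact h

theorem continuousOn_topForm {k : ℕ} {T : Type*} [NormedAddCommGroup T] [NormedSpace ℝ T]
    {s : Set T} {β : T → Euc k [⋀^Fin k]→L[ℝ] ℝ}
    (h : ContinuousOn (fun y => β y (stdFrame k)) s) : ContinuousOn β s := by
  rw [← contDiffOn_zero (𝕜 := ℝ)]
  refine fun y hy => contDiffWithinAt_form fun v => ?_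
  refine (contDiffOn_zero (𝕜 := ℝ)).2 ?_ y hy
  simp only [topForm_apply_stdFrame (β _) v]
  exact h.mul continuousOn_const

theorem continuousOn_matrix_inv {T : Type*} [TopologicalSpace T] {k : ℕ} {s : Set T}
    {G : T → Matrix (Fin k) (Fin k) ℝ} (hG : ContinuousOn G s) (h0 : ∀ y ∈ s, (G y).det ≠ 0) :
    ContinuousOn (fun y => (G y)⁻¹) s := by
  simp only [Matrix.inv_def, Ring.inverse_eq_inv']
  have h1 : ContinuousOn (fun y => (G y).det) s :=
    (Continuous.matrix_det continuous_id).comp_continuousOn hG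
  have h2 : ContinuousOn (fun y => (G y).adjugate) s :=
    (Continuous.matrix_adjugate continuous_id).comp_continuousOn hG
  exact (h1.inv₀ h0).smul h2

variable {n : ℕ} {M : Type u} [TopologicalSpace M] [ChartedSpace (Euc n) M]
  [IsManifold (𝓡 n) ∞ M]
  {k : ℕ} {HX : Type*} [TopologicalSpace HX] {I : ModelWithCorners ℝ (Euc k) HX}
  {X : Type*} [TopologicalSpace X]
  [ChartedSpace HX X] [IsManifold I ∞ X] {Ω : OrientationForm (𝓡 n) M n}
  {H : DForm (𝓡 n) M 3}
  [RiemannianBundle (fun x : M => TangentSpace (𝓡 n) x)]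

/-- The differential of the inverse of a chart as an isomorphism. -/
noncomputable def chartEquiv {c : X} {y : Euc k} (hy : y ∈ (extChartAt I c).target) :
    Euc k ≃ₗ[ℝ] TangentSpace I ((extChartAt I c).symm y) :=
  { (chartInv I c y).toLinearMap with
    invFun := chartDeriv I c ((extChartAt I c).symm y)
    left_inv := fun v => chartDeriv_chartInv_apply hy v
    right_inv := fun v => chartInv_chartDeriv_apply hy v }

namespace IsotropicPair

variable (P : IsotropicPair I X H)

/-- The images of the coordinate vector fields in the tangent spaces of `M`. -/
noncomputable def coordFrame (c : X) (y : Euc k) (i : Fin k) :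
    TangentSpace (𝓡 n) (P.j ((extChartAt I c).symm y)) :=
  mfderiv I (𝓡 n) P.j ((extChartAt I c).symm y) (chartInv I c y (stdFrame k i))

/-- The basis of the tangent plane given by the coordinate vector fields. -/
noncomputable def coordBasis {c : X} {y : Euc k} (hy : y ∈ (extChartAt I c).target) :
    Basis (Fin k) ℝ (P.planeAt ((extChartAt I c).symm y)).L :=
  (EuclideanSpace.basisFun (Fin k) ℝ).toBasis.map
    ((chartEquiv hy).trans (P.tangentEquiv ((extChartAt I c).symm y)))

theorem coordBasis_apply {c : X} {y : Euc k} (hy : y ∈ (extChartAt I c).target) (i : Fin k) :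
    P.coordBasis hy i = ⟨P.coordFrame c y i, chartInv I c y (stdFrame k i), rfl⟩ := by
  rw [coordBasis, Basis.map_apply, OrthonormalBasis.coe_toBasis, EuclideanSpace.basisFun_apply]
  rfl

theorem gramDet_coordFrame_pos {c : X} {y : Euc k} (hy : y ∈ (extChartAt I c).target) :
    0 < gramDet (P.coordFrame c y) := by
  have h := (P.coordBasis hy).linearIndependent.map'
    (P.planeAt ((extChartAt I c).symm y)).L.subtype (Submodule.ker_subtype _)
  have h1 : (P.planeAt ((extChartAt I c).symm y)).L.subtype ∘ P.coordBasis hy =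
      P.coordFrame c y := funext fun i => congrArg Subtype.val (P.coordBasis_apply hy i)
  rw [h1] at h
  exact gramDet_pos h

theorem expForm_planeAt_F (c : X) {y : Euc k} (hy : y ∈ (extChartAt I c).target) (p : ℕ)
    (g : Fin p → Fin k) :
    expForm (P.planeAt ((extChartAt I c).symm y)).F p (P.coordBasis hy ∘ g) =
      expForm (P.F.inChart c y) p (stdFrame k ∘ g) := by
  rw [show P.coordBasis hy ∘ g = fun i => P.coordBasis hy (g i) from rfl]
  simp only [coordBasis_apply]
  rw [DForm.inChart_def, ← pullLin_expForm]
  have h : expForm (P.planeAt ((extChartAt I c).symm y)).F = pullLin (LinearMap.toContinuousLinearMap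
      (P.tangentEquiv ((extChartAt I c).symm y)).symm.toLinearMap)
      (expForm (P.F ((extChartAt I c).symm y))) := (pullLin_expForm _ _).symm
  rw [h]
  change expForm (P.F ((extChartAt I c).symm y)) p (fun i => (P.tangentEquiv _).symm
    ⟨mfderiv I (𝓡 n) P.j ((extChartAt I c).symm y) (chartInv I c y (stdFrame k (g i))), _, rfl⟩) = _
  simp only [tangentEquiv_symm_apply]
  rfl

/-- The orthonormal bases in `formNorm` are chosen pointwise. The coordinate frame varies smoothly,
at the price of the inverse Gram matrix, and makes continuity visible. -/
theorem formNorm_tau_eq {c : X} {y : Euc k} (hy : y ∈ (extChartAt I c).target) :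
    formNorm (V := TangentSpace (𝓡 n) (P.j ((extChartAt I c).symm y))) (finrank_tangent _)
      (P.tau Ω ((extChartAt I c).symm y)) =
    Real.sqrt (∑ p ∈ Finset.range (k + 1), ((p.factorial : ℝ)⁻¹) *
      ∑ h : Fin p → Fin k, ∑ h' : Fin p → Fin k,
        (∏ i, (Matrix.gram ℝ (P.coordFrame c y))⁻¹ (h i) (h' i)) *
        (expForm (P.F.inChart c y) p (stdFrame k ∘ h) *
          expForm (P.F.inChart c y) p (stdFrame k ∘ h'))) := by
  rw [tau, IsotropicPlane.formNorm_tau, formNorm, formInner_eq_gram _ (P.coordBasis hy)]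
  simp only [expForm_planeAt_F]
  have h : (Matrix.of fun r s => inner ℝ (P.coordBasis hy r) (P.coordBasis hy s)) =
      Matrix.gram ℝ (P.coordFrame c y) := by
    ext r s
    rw [Matrix.of_apply, P.coordBasis_apply hy, P.coordBasis_apply hy]
    rfl
  rw [h]

/-- The square is the Gram determinant, and positivity with respect to the orientation determines
the sign of the root. -/
theorem inChart_vol_stdFrame (c : X) (y : Euc k) :
    P.vol.inChart c y (stdFrame k) =
      ((SignType.sign (P.orientation.form.inChart c y (stdFrame k)) : SignType) : ℝ) *
        Real.sqrt (gramDet (P.coordFrame c y)) := by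
  obtain ⟨r, hr, h⟩ := P.exists_vol_eq ((extChartAt I c).symm y)
  have h1 : P.vol.inChart c y (stdFrame k) = r * P.orientation.form.inChart c y (stdFrame k) := h _
  have h2 : P.vol.inChart c y (stdFrame k) ^ 2 = gramDet (P.coordFrame c y) :=
    (P.planeAt ((extChartAt I c).symm y)).vol_sq_of_mem fun i => P.mfderiv_mem_planeAt _ _
  have h3 : SignType.sign (P.orientation.form.inChart c y (stdFrame k)) =
      SignType.sign (P.vol.inChart c y (stdFrame k)) := by
    rw [h1, sign_mul, sign_pos hr, one_mul]
  rw [← h2, Real.sqrt_sq_eq_abs, h3, sign_mul_abs]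

variable [IsContMDiffRiemannianBundle (𝓡 n) ∞ (Euc n) (fun x : M => TangentSpace (𝓡 n) x)]

theorem continuousOn_gram_coordFrame (c : X) :
    ContinuousOn (fun y => Matrix.gram ℝ (P.coordFrame c y)) (extChartAt I c).target := by
  refine continuousOn_pi.2 fun r => continuousOn_pi.2 fun s => fun y hy => ?_
  have hyr := extChartAt_target_subset_range c hy
  have hf : ContMDiffWithinAt 𝓘(ℝ, Euc k) (𝓡 n) ∞ (fun z => P.j ((extChartAt I c).symm z))
      (Set.range I) y :=
    (P.smooth _).comp_contMDiffWithinAt y (contMDiffWithinAt_extChartAt_symm_range c hy)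
  have key (i : Fin k) : ContDiffWithinAt ℝ ∞ (fun z => chartDeriv (𝓡 n)
      (P.j ((extChartAt I c).symm y)) (P.j ((extChartAt I c).symm z)) (P.coordFrame c z i))
      (Set.range I) y := by
    have hc' := mem_extChartAt_source (I := 𝓡 n) (P.j ((extChartAt I c).symm y))
    have hw := contDiffWithinAt_written P.smooth hy hc'
    have h2 := (hw.fderivWithin_right (m := ∞) I.uniqueDiffOn (by simp) hyr).clm_apply
      (contDiffWithinAt_const (c := stdFrame k i))
    refine h2.congr_of_eventuallyEq_of_mem ?_ hyr
    filter_upwards [eventually_mem_target P.smooth.continuous hy hc'] with z hz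
    rw [fderivWithin_written hz.1 (P.smooth.mdifferentiable (by simp) _) hz.2]
    rfl
  exact ((contDiffWithinAt_inner hf (key r) (key s) hyr).continuousWithinAt).mono
    (extChartAt_target_subset_range c)

theorem continuousOn_formNorm_tau (c : X) :
    ContinuousOn (fun y => formNorm (V := TangentSpace (𝓡 n) (P.j ((extChartAt I c).symm y)))
      (finrank_tangent _) (P.tau Ω ((extChartAt I c).symm y))) (extChartAt I c).target := by
  refine ContinuousOn.congr ?_ fun y hy => P.formNorm_tau_eq hy
  have hG := continuousOn_matrix_inv (P.continuousOn_gram_coordFrame c)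
    fun y hy => (P.gramDet_coordFrame_pos hy).ne'
  have hE (p : ℕ) (v : Fin p → Euc k) :
      ContinuousOn (fun y => expForm (P.F.inChart c y) p v) (extChartAt I c).target := by
    refine continuousOn_apply_const (fun y hy => ?_) v
    exact (mixedContDiffWithinAt_expForm
      (P.F_smooth.contDiffOn_inChart c y hy) p).continuousWithinAt
  refine ContinuousOn.sqrt (continuousOn_finsetSum _ fun p _ => continuousOn_const.mul
    (continuousOn_finsetSum _ fun h _ => continuousOn_finsetSum _ fun h' _ =>
      ContinuousOn.mul ?_ ((hE p _).mul (hE p _))))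
  exact continuousOn_finsetProd _ fun i _ => continuousOn_pi.1 (continuousOn_pi.1 hG (h i)) (h' i)

theorem vol_cont : P.vol.Cont := by
  refine fun c => continuousOn_topForm ?_
  refine ContinuousOn.congr ?_ fun y _ => P.inChart_vol_stdFrame c y
  refine ContinuousOn.mul ?_ (ContinuousOn.sqrt ?_)
  · exact (continuous_of_discreteTopology (f := fun s : SignType => (s : ℝ))).comp_continuousOn
      (continuousOn_sign_orientation P.orientation c)
  · exact (Continuous.matrix_det continuous_id).comp_continuousOn (P.continuousOn_gram_coordFrame c)

variable (Ω) in
/-- The integrand of the Dirac-Born-Infeld term. -/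
noncomputable def energyForm (φ : M → ℝ) : DForm I X k := fun x =>
  (Real.exp (-φ (P.j x)) * formNorm (V := TangentSpace (𝓡 n) (P.j x)) (finrank_tangent (P.j x))
    (P.tau Ω x)) • P.vol x

theorem energyForm_cont {φ : M → ℝ} (hφ : Continuous φ) : (P.energyForm Ω φ).Cont := by
  intro c
  have h1 : ContinuousOn (fun y => Real.exp (-φ (P.j ((extChartAt I c).symm y))))
      (extChartAt I c).target :=
    (Real.continuous_exp.comp (hφ.comp P.smooth.continuous).neg).comp_continuousOn
      (continuousOn_extChartAt_symm c)
  exact (h1.mul (P.continuousOn_formNorm_tau c)).smul (P.vol_cont c)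

end IsotropicPair

end Continuity

/-! ### Energy comparison and the main theorem. -/

section Minimality

variable {n : ℕ} {M : Type u} [TopologicalSpace M] [ChartedSpace (Euc n) M]
  [IsManifold (𝓡 n) ∞ M] {Ω : OrientationForm (𝓡 n) M n} {H : DForm (𝓡 n) M 3}
  {T : Trivialisation Ω H} {ε : ZMod 2}

theorem MForm.Smooth.dilate {α : MForm (𝓡 n) M} (hα : α.Smooth) {φ : M → ℝ}
    (hφ : ContMDiff (𝓡 n) 𝓘(ℝ, ℝ) ∞ φ) : MForm.Smooth (dilate φ α) := fun p =>
  (hα p).smul ((Real.contDiff_exp.comp contDiff_neg).contMDiff.comp hφ)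

theorem dTwisted_sub {α β : MForm (𝓡 n) M} (hα : α.Smooth) (hβ : β.Smooth) :
    (α - β).dTwisted H = α.dTwisted H - β.dTwisted H := by
  funext x
  have h1 : (α - β).d x = α.d x - β.d x := congrFun (MForm.d_sub hα hβ) x
  change (α - β).d x + pureForm (H x) * (α x - β x) =
    (α.d x + pureForm (H x) * α x) - (β.d x + pureForm (H x) * β x)
  rw [h1, mul_sub]
  abel

variable {k : ℕ} {HX : Type*} [TopologicalSpace HX] {I : ModelWithCorners ℝ (Euc k) HX}
  {X : Type*} [TopologicalSpace X] [ChartedSpace HX X] [IsManifold I ∞ X]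

theorem expPull_dilate (j : X → M) (F : DForm I X 2) (φ : M → ℝ) (α : MForm (𝓡 n) M) (x : X) :
    expPull j F (dilate φ α) x = Real.exp (-φ (j x)) • expPull j F α x := by
  have h : (dilate φ α).pull (I := I) j x = Real.exp (-φ (j x)) • α.pull (I := I) j x := rfl
  rw [expPull, h, mul_smul_comm]
  rfl

variable [RiemannianBundle (fun x : M => TangentSpace (𝓡 n) x)]

namespace IsotropicPair

theorem energy_eq [T2Space X] [CompactSpace X] (P : IsotropicPair I X H) (φ : M → ℝ)
    (γ : SpinorField T ε) :
    P.energy φ γ = integral P.orientation (P.energyForm Ω φ) -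
      integral P.orientation (fun x => expPull P.j P.F (dilate φ γ.toForm) x k) := by
  simp only [expPull_dilate]
  rfl

theorem expPull_dilate_apply (P : IsotropicPair I X H) (φ : M → ℝ) (ρ : SpinorField T ε) (x : X)
    (v : Fin k → TangentSpace I x) :
    expPull P.j P.F (dilate φ ρ.toForm) x k v = Real.exp (-φ (P.j x)) *
      (pairing (V := TangentSpace (𝓡 n) (P.j x)) (finrank_tangent (P.j x)) (Ω.at (P.j x))
        (ρ.toForm (P.j x)) (P.tau Ω x) * P.vol x v) := by
  rw [← expPull_apply, expPull_dilate]
  rfl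

theorem IsCalibratedBy.energyForm_eq {P : IsotropicPair I X H} {ρ : SpinorField T ε}
    (hP : P.IsCalibratedBy ρ) (φ : M → ℝ) :
    P.energyForm Ω φ = fun x => expPull P.j P.F (dilate φ ρ.toForm) x k := by
  funext x
  ext v
  rw [expPull_dilate_apply]
  have h : pairing (V := TangentSpace (𝓡 n) (P.j x)) (finrank_tangent (P.j x)) (Ω.at (P.j x))
      (ρ.toForm (P.j x)) (P.tau Ω x) = _ := hP x
  rw [h, ← mul_assoc]
  rfl

variable [IsContMDiffRiemannianBundle (𝓡 n) ∞ (Euc n) (fun x : M => TangentSpace (𝓡 n) x)]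

/-- The difference of the integrands is `e^{-φ} (‖τ‖ - ⟨ρ, τ⟩)` times the volume form, hence
nonnegative for a calibration. Continuity of both integrands permits integrating the difference. -/
theorem integral_expPull_le [T2Space X] [CompactSpace X] (P : IsotropicPair I X H)
    {ρ : SpinorField T ε} (hρ : ρ.IsCalibration) {φ : M → ℝ}
    (hφ : ContMDiff (𝓡 n) 𝓘(ℝ, ℝ) ∞ φ) :
    integral P.orientation (fun x => expPull P.j P.F (dilate φ ρ.toForm) x k) ≤
      integral P.orientation (P.energyForm Ω φ) := by
  have hs := expPull_smooth P.smooth P.F_smooth (ρ.toForm_smooth.dilate hφ) k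
  rw [← sub_nonneg, ← integral_sub P.orientation (P.energyForm_cont hφ.continuous) hs.cont]
  refine integral_nonneg P.orientation fun x v => ?_
  obtain ⟨r, hr, hv⟩ := P.exists_vol_eq x
  have h1 := (hρ (P.j x)).1 k (P.planeAt x)
  have h2 : (P.energyForm Ω φ x - expPull P.j P.F (dilate φ ρ.toForm) x k) v =
      Real.exp (-φ (P.j x)) * (formNorm (V := TangentSpace (𝓡 n) (P.j x))
        (finrank_tangent (P.j x)) (P.tau Ω x) -
        pairing (V := TangentSpace (𝓡 n) (P.j x)) (finrank_tangent (P.j x)) (Ω.at (P.j x))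
        (ρ.toForm (P.j x)) (P.tau Ω x)) * (r * P.orientation.form x v) := by
    have h3 : (P.energyForm Ω φ x - expPull P.j P.F (dilate φ ρ.toForm) x k) v =
      Real.exp (-φ (P.j x)) * formNorm (V := TangentSpace (𝓡 n) (P.j x))
        (finrank_tangent (P.j x)) (P.tau Ω x) * P.vol x v -
        expPull P.j P.F (dilate φ ρ.toForm) x k v := rfl
    rw [h3, expPull_dilate_apply, hv]
    ring
  rw [h2, mul_left_comm]
  refine mul_nonneg (mul_nonneg (Real.exp_pos _).le (sub_nonneg.2 h1)) ?_
  rw [mul_left_comm]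
  refine mul_nonneg hr.le ?_
  rw [sign_mul_self]
  exact abs_nonneg _

end IsotropicPair

end Minimality

end GenCal

theorem theorem3p13 {n : ℕ} {M : Type u} [TopologicalSpace M] [ChartedSpace (GenCal.Euc n) M]
    [IsManifold (𝓡 n) ∞ M] [T2Space M] [SecondCountableTopology M]
    [RiemannianBundle (fun x : M => TangentSpace (𝓡 n) x)]
    [IsContMDiffRiemannianBundle (𝓡 n) ∞ (GenCal.Euc n) (fun x : M => TangentSpace (𝓡 n) x)]
    (Ω : GenCal.OrientationForm (𝓡 n) M n)
    (H : GenCal.DForm (𝓡 n) M 3) (hH : H.Smooth) (hdH : ∀ x, H.d x = 0)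
    (T : GenCal.Trivialisation Ω H) (ε : ZMod 2)
    (φ : M → ℝ) (hφ : ContMDiff (𝓡 n) 𝓘(ℝ, ℝ) ∞ φ)
    (ρ γ : GenCal.SpinorField T ε) (hρ : ρ.IsCalibration)
    (hργ : (GenCal.dilate φ ρ.toForm).dTwisted H = (GenCal.dilate φ γ.toForm).dTwisted H)
    {k : ℕ} {HL : Type*} [TopologicalSpace HL] (I : ModelWithCorners ℝ (GenCal.Euc k) HL)
    {L : Type*} [TopologicalSpace L] [ChartedSpace HL L] [IsManifold I ∞ L]
    (P : GenCal.IsotropicPair I L H) (hP : P.IsCalibratedBy ρ) :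
    P.IsLocallyMinimising φ γ := by
  intro D _ _ _ _ _ PD _ hres D' _ _ _ _ _ P' hom
  have hρs := ρ.toForm_smooth.dilate hφ
  have hγs := γ.toForm_smooth.dilate hφ
  have hd : (GenCal.dilate φ ρ.toForm - GenCal.dilate φ γ.toForm).dTwisted H = 0 := by
    rw [GenCal.dTwisted_sub hρs hγs, hργ, sub_self]
  have key := hom.integral_expPull_eq (hρs.sub hγs) hd
  have hsub : ∀ {D : Type u} [TopologicalSpace D] [ChartedSpace (EuclideanQuadrant k) D]
      [IsManifold (GenCal.Corner k) ∞ D] [T2Space D] [CompactSpace D]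
      (Q : GenCal.IsotropicPair (GenCal.Corner k) D H),
      GenCal.integral Q.orientation (fun x => GenCal.expPull Q.j Q.F
        (GenCal.dilate φ ρ.toForm - GenCal.dilate φ γ.toForm) x k) =
      GenCal.integral Q.orientation
        (fun x => GenCal.expPull Q.j Q.F (GenCal.dilate φ ρ.toForm) x k) -
      GenCal.integral Q.orientation
        (fun x => GenCal.expPull Q.j Q.F (GenCal.dilate φ γ.toForm) x k) := by
    intro D _ _ _ _ _ Q
    rw [← GenCal.integral_sub Q.orientation
      (GenCal.expPull_smooth Q.smooth Q.F_smooth hρs k).cont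
      (GenCal.expPull_smooth Q.smooth Q.F_smooth hγs k).cont]
    congr 1
    funext x
    exact congrFun (GenCal.expPull_sub Q.j Q.F _ _ x) k
  rw [hsub PD, hsub P'] at key
  have hle := P'.integral_expPull_le hρ hφ
  rw [PD.energy_eq, P'.energy_eq, (hP.of_isRestriction hres).energyForm_eq]
  -- On `D` the Dirac-Born-Infeld integral has become that of `ρ`, so the energy of `D` is the
  -- integral of the `ρ`-form minus that of the `γ`-form. By `key` it equals the same difference
  -- over `D'`, which `hle` bounds by the energy of `D'`.
  linarith
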